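/- Let $k$ be a field of characteristic $0$. Let $\mathcal I=I_2\amalg I_3\amalg\cdots$ be a partitioned set. An $\mathcal I$-decorated planar reduced tree is a planar rooted tree each of whose inner vertices has some number $n\ge 2$ of incoming edges and carries a decoration in $I_n$. Plain planar reduced trees are the case where every $I_n$ has one element; planar binary trees are the case where $I_2$ has one element and $I_n=\emptyset$ for $n\ge 3$. Let $T$ be the set of these trees, including the one-edge tree $|$, let $T_+=T\setminus\{|\}$, and let $\mathcal T\supset\mathcal T_+$ be their linear spans. Let $\mathcal H$ be the free associative algebra on $T_+$ (the algebra of planar forests, with unit $1=|$), with the coproduct $\Delta(t)=\sum_c P^c(t)\otimes R^c(t)$. Here $c$ runs over the admissible cuts of $t$: sets of edges not connected to a leaf (the root edge is allowed) such that each path from the root to a leaf contains at most one of them. $P^c(t)$ is the forest cut off, read from left to right, and $R^c(t)$ is the trunk, in which each subtree cut off is replaced by a leaf. Let $\sigma(t)$ be the number of automorphisms of the planar tree $t$, and let $N(t,u,v)$ be the number of cuts $c$ of $v$ with exactly one edge, with $P^c(v)=t$ and $R^c(v)=u$. For $t,u\in T_+$ put $$t\curvearrowright_\sigma u=\sum_{v\in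 T_+}M(t,u,v)\,v,\qquad M(t,u,v)=\frac{\sigma(t)\sigma(u)}{\sigma(v)}N(t,u,v),$$ extended bilinearly to $\mathcal T_+$. Let $\delta'$ be the normalized dual basis: $\langle\delta'_{t_1\cdots t_r},s\rangle=\sigma(t_1)\cdots\sigma(t_r)$ if $s$ is the forest $t_1\cdots t_r$, and $0$ for every other forest $s$, with $x\mapsto\delta'_x$ extended linearly. For an operad $P$ with $P_0=0$ and $P_1=k\,e$, let $G^e_P$ be the set of series $g=(g_n)_{n\ge1}\in\prod_{n\ge 1}(P_n)_{S_n}$ with $g_1=e$, with the product $(f\circ g)_N=\sum_{n}\sum_{m_1+\cdots+m_n=N}\gamma(f_n;g_{m_1},\dots,g_{m_n})$. Let $\mathfrak g^e_P$ be the space of series with $x_1=0$, with the bracket $[x,y]=x\curvearrowleft y-y\curvearrowleft x$, where $x_m\curvearrowleft y_n=\sum_{i=1}^m x_m\circ_i y_n$. For an $\mathbb S$-object $V$ with $V_1=k$, let $\mathcal F(V)$ be the free operad on $V$ in which $V_1$ is the line spanned by the operadic unit. Let $V_{\mathcal I}$ be the $\mathbb S$-object with $(V_{\mathcal I})_1=k$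 and $(V_{\mathcal I})_n=k^{(I_n)}\otimes k[S_n]$ for $n\ge2$, where $k^{(I_n)}$ is the space with basis $I_n$. Let $V=(k[S_n])_{n\ge1}$, and let $W$ be given by $W_1=k$, $W_2=k[S_2]$ and $W_n=0$ for $n\ge3$. Let $P$ be the operad of $\mathcal I$-decorated planar reduced trees with leaves labelled bijectively, whose composition replaces leaves by trees. For $t\in T$ with $n$ leaves, $[t]\in(P_n)_{S_n}$ denotes its class for any labelling of the leaves. A planar rooted hypertree with edges decorated by $\mathcal I$ is made of a root, a sequence of edges attached to the root from left to right, each with some number $n\ge 2$ of vertices (including the root) and a decoration in $I_n$, and, at each vertex of such an edge other than the root, in counterclockwise order, a planar rooted hypertree. The bijection $\Phi$ from $T$ to these hypertrees sends $|$ to the single vertex and $\bigvee_i(t_1,\dots,t_n)$ to $\beta_i(\Phi(t_1),\dots,\Phi(t_n))$. Here $\beta_i$ collects the roots, in reversed order, into a new edge decorated by $i$, whose root is the root of the last hypertree and which is the leftmost edge there. Let $H\mathcal T_+$ be the span of the hypertrees with at least one edge, and let $H\mathcal H$ be the free algebra on them, with the coproduct transported from $\mathcal H$ by $\Phi$. Put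 $s_1\twoheadrightarrow s_2=\Phi(\Phi^{-1}(s_1)\curvearrowright_\sigma\Phi^{-1}(s_2))$. Then: 1. $P$ is the free operad $\mathcal F(V_{\mathcal I})$, with $P_0=0$ and $P_1=k\,e$. For plain trees $P=\mathcal F(V)$, and for binary trees $P=\mathcal F(W)$, the free binary operad. 2. For $t,u,v\in T_+$, $M(t,u,v)$ is the number of ways to graft $t$ on a leaf of $u$ so as to obtain $v$. Hence $t\curvearrowright_\sigma u$ is the sum of all graftings of $t$ on leaves of $u$. The product $\curvearrowright_\sigma$ on $\mathcal T_+$, its extension to $\mathcal T$ as the sum of all graftings, and $\twoheadrightarrow$ on $H\mathcal T_+$ are left pre-Lie: $$x(yz)-(xy)z=y(xz)-(yx)z.$$ 3. For $x\in\mathcal T_+$, $\delta'_x$ is an infinitesimal character of $\mathcal H$. For $x,y\in\mathcal T_+$, with respect to the convolution product, $[\delta'_x,\delta'_y]=\delta'_{x\curvearrowright_\sigma y-y\curvearrowright_\sigma x}$. 4. The map $t\mapsto[t]$ is injective on $\mathcal T_+$. Its image is the set of finitely supported elements of $\mathfrak g^e_P$, and it sends $x\curvearrowright_\sigma y-y\curvearrowright_\sigma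 x$ to the opposite of the bracket of the images of $x$ and $y$. The same holds for $H\mathcal T_+$ with $\twoheadrightarrow$ and $s\mapsto[\Phi^{-1}(s)]$. 5. The characters (unital algebra morphisms to $k$) of $\mathcal H$, and those of $H\mathcal H$, form groups under convolution. If every $I_n$ is finite, then for each $n$ there are finitely many $t\in T$ with $n$ leaves, and the maps $\varphi\mapsto\big(\sum_{t\text{ with }n\text{ leaves}}\varphi(t)[t]\big)_{n\ge1}$ and $\varphi\mapsto\big(\sum_{t\text{ with }n\text{ leaves}}\varphi(\Phi(t))[t]\big)_{n\ge1}$ are group isomorphisms from the character groups of $\mathcal H$ and $H\mathcal H$ onto $G_P^{e,\mathrm{op}}$, that is, $G_P^e$ with reversed multiplication. In that case $\alpha\mapsto\big(\sum_{t\text{ with }n\text{ leaves}}\alpha(t)[t]\big)_{n\ge1}$ is also a linear isomorphism from the space of infinitesimal characters of $\mathcal H$, which is closed under the convolution commutator, onto $\mathfrak g^e_P$, and it reverses the bracket. -/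

import Mathlib

universe u v

open scoped TensorProduct MonoidAlgebra

noncomputable section

/-! ### Symmetric operads and the group of a (graded, augmented) operad -/

/-- A `k`-linear symmetric operad, in coordinate-free form: a functor `A ↦ P(A)` from finite sets
and bijections to vector spaces (so that the `n`-ary operations are `P(Fin n)`, with the symmetric
group `Perm (Fin n)` acting through `map`), a unit, and full compositions
`γ : P(A) ⊗ ⨂_{a ∈ A} P(B a) → P(Σ a, B a)` that are equivariant, unital and associative. -/
structure Operad (k : Type u) [Field k] where
  obj : (A : Type) → [Finite A] → Type v
  [acg : ∀ (A : Type) [Finite A], AddCommGroup (obj A)]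
  [mod : ∀ (A : Type) [Finite A], Module k (obj A)]
  map : ∀ {A B : Type} [Finite A] [Finite B], A ≃ B → obj A →ₗ[k] obj B
  one : obj Unit
  comp : ∀ {A : Type} {B : A → Type} [Finite A] [∀ a, Finite (B a)],
    obj A →ₗ[k] MultilinearMap k (fun a => obj (B a)) (obj (Σ a, B a))
  map_refl : ∀ {A : Type} [Finite A] (x : obj A), map (Equiv.refl A) x = x
  map_trans : ∀ {A B C : Type} [Finite A] [Finite B] [Finite C] (e : A ≃ B) (f : B ≃ C)
    (x : obj A), map (e.trans f) x = map f (map e x)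
  comp_map_left : ∀ {A A' : Type} {B : A' → Type} [Finite A] [Finite A'] [∀ a, Finite (B a)]
    (e : A ≃ A') (x : obj A) (y : ∀ a, obj (B a)),
    comp (map e x) y = map (Equiv.sigmaCongrLeft e) (comp x fun a => y (e a))
  comp_map_right : ∀ {A : Type} {B B' : A → Type} [Finite A] [∀ a, Finite (B a)]
    [∀ a, Finite (B' a)] (e : ∀ a, B a ≃ B' a) (x : obj A) (y : ∀ a, obj (B a)),
    comp x (fun a => map (e a) (y a)) = map (Equiv.sigmaCongrRight e) (comp x y)
  one_comp : ∀ {A : Type} [Finite A] (x : obj A),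
    map (Equiv.uniqueSigma fun _ : Unit => A) (comp one fun _ => x) = x
  comp_one : ∀ {A : Type} [Finite A] (x : obj A),
    map (Equiv.sigmaUnique A fun _ => Unit) (comp x fun _ => one) = x
  assoc : ∀ {A : Type} {B : A → Type} {C : ∀ a, B a → Type} [Finite A] [∀ a, Finite (B a)]
    [∀ a b, Finite (C a b)] (x : obj A) (y : ∀ a, obj (B a)) (z : ∀ a b, obj (C a b)),
    map (Equiv.sigmaAssoc C) (comp (comp x y) fun p : Σ a, B a => z p.1 p.2) =
      comp x fun a => comp (y a) (z a)

namespace Operad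

attribute [instance] Operad.acg Operad.mod

variable {k : Type u} [Field k]

/-- Morphisms of operads. -/
structure Hom (P Q : Operad.{u, v} k) where
  app : ∀ (A : Type) [Finite A], P.obj A →ₗ[k] Q.obj A
  app_map : ∀ {A B : Type} [Finite A] [Finite B] (e : A ≃ B) (x : P.obj A),
    app B (P.map e x) = Q.map e (app A x)
  app_one : app Unit P.one = Q.one
  app_comp : ∀ {A : Type} {B : A → Type} [Finite A] [∀ a, Finite (B a)] (x : P.obj A)
    (y : ∀ a, P.obj (B a)), app _ (P.comp x y) = Q.comp (app A x) fun a => app (B a) (y a)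

/-- An operad is augmented if it has no `0`-ary operation and if its `1`-ary operations are
spanned by the (nonzero) unit. -/
def IsAugmented (P : Operad.{u, v} k) : Prop :=
  (∀ (A : Type) [Finite A] [IsEmpty A], Subsingleton (P.obj A)) ∧
    P.one ≠ 0 ∧ ∀ x : P.obj Unit, ∃ c : k, x = c • P.one

variable (P : Operad.{u, v} k)

/-- The action of the symmetric group on the `n`-ary operations. -/
def rep (n : ℕ) : Representation k (Equiv.Perm (Fin n)) (P.obj (Fin n)) where
  toFun σ := P.map σ
  map_one' := LinearMap.ext fun x => P.map_refl x
  map_mul' σ τ := LinearMap.ext fun x => P.map_trans τ σ x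

/-- `P.Coinv N` is the space of coinvariants `(P_n)_{S_n}` for `n = N + 1`. -/
abbrev Coinv (N : ℕ) : Type v := (P.rep (N + 1)).Coinvariants

/-- The class in `(P_{N+1})_{S_{N+1}}` of an operation whose inputs are indexed by a finite set `A`
with `N + 1` elements (through any bijection `A ≃ Fin (N + 1)`, see `cls_eq`). It is set to `0` when
`A` does not have `N + 1` elements, so that `cls` is the projection to the component of arity
`N + 1`. -/
def cls (N : ℕ) {A : Type} [Finite A] : P.obj A →ₗ[k] P.Coinv N :=
  open Classical in
  if h : Nat.card A = N + 1 then
    Representation.Coinvariants.mk (P.rep (N + 1)) ∘ₗ P.map (Finite.equivFinOfCardEq h)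
  else 0

/-- The unit, seen as an element of `P_1 = P(Fin 1)`. -/
def unitFin : P.obj (Fin 1) := P.map (Equiv.ofUnique Unit (Fin 1)) P.one

/-- `∑_{m_0, …, m_n} γ(x; y_0(m_0), …, y_n(m_n))`, projected to arity `N + 1`, for an
`(n + 1)`-ary operation `x` and sequences `y_j` whose `m`-th term has arity `m + 1`.
(Terms with some `m_j > N` have arity greater than `N + 1`.) -/
def subst (N n : ℕ) (x : P.obj (Fin (n + 1)))
    (y : Fin (n + 1) → ∀ m, P.obj (Fin (m + 1))) : P.Coinv N :=
  ∑ m : Fin (n + 1) → Fin (N + 1), P.cls N (P.comp x fun j => y j (m j))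

/-- Elements of `∏_{n ≥ 1} (P_n)_{S_n}`; the term with index `n` is the component of arity
`n + 1`. -/
abbrev Series : Type v := ∀ n, P.Coinv n

variable {P} in
/-- Representatives of the components of a series. -/
def Series.rep (f : P.Series) (n : ℕ) : P.obj (Fin (n + 1)) :=
  (Submodule.Quotient.mk_surjective _ (f n)).choose

/-- The composition `f ∘ g`, with component of arity `N + 1` the sum of all
`γ(f_n; g_{m_1}, …, g_{m_n})` with `m_1 + ⋯ + m_n = N + 1`. It does not depend on the
chosen representatives, see `subst_congr` and `series_comp_mk`. -/
def seriesComp (f g : P.Series) : P.Series := fun N =>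
  ∑ n ∈ Finset.range (N + 1), P.subst N n (Series.rep f n) fun _ => Series.rep g

/-- The sequence `(e, 0, 0, …)` of representatives of the unit. -/
def unitSeq : ∀ m, P.obj (Fin (m + 1))
  | 0 => P.unitFin
  | _ + 1 => 0

/-- The right pre-Lie product on series, with
`x_m ↶ y_n = ∑_i γ(x_m; e, …, e, y_n, e, …, e)` (`y_n` in place `i`). -/
def preLie (f g : P.Series) : P.Series := fun N =>
  ∑ n ∈ Finset.range (N + 1), ∑ i : Fin (n + 1),
    P.subst N n (Series.rep f n) fun j => if j = i then Series.rep g else P.unitSeq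

/-- The Lie bracket `[f, g] = f ↶ g - g ↶ f`. -/
def lieBracket (f g : P.Series) : P.Series := P.preLie f g - P.preLie g f

/-- The group `G^e_P` of series whose component of arity `1` is the unit `e`. -/
def GroupE : Type v := {f : P.Series // f 0 = P.cls 0 P.one}

/-- The Lie algebra `𝔤^e_P`: series whose component of arity `1` vanishes, with the bracket
`lieBracket`. -/
def lieE : Submodule k P.Series := LinearMap.ker (LinearMap.proj 0)

end Operad

namespace Operad

variable {k : Type u} [Field k] (P : Operad.{u, v} k)

theorem mk_map {n : ℕ} (σ : Equiv.Perm (Fin n)) (x : P.obj (Fin n)) :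
    Representation.Coinvariants.mk (P.rep n) (P.map σ x) =
      Representation.Coinvariants.mk (P.rep n) x := by
  rw [Representation.Coinvariants.mk_eq_iff]
  exact Representation.Coinvariants.sub_mem_ker (ρ := P.rep n) σ x

theorem cls_eq {N : ℕ} {A : Type} [Finite A] (e : A ≃ Fin (N + 1)) (x : P.obj A) :
    P.cls N x = Representation.Coinvariants.mk (P.rep (N + 1)) (P.map e x) := by
  have h : Nat.card A = N + 1 := by rw [Nat.card_congr e, Nat.card_fin]
  have he : e = (Finite.equivFinOfCardEq h).trans ((Finite.equivFinOfCardEq h).symm.trans e) := by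
    ext a
    simp
  rw [cls, dif_pos h, LinearMap.comp_apply]
  conv_rhs => rw [he]
  rw [P.map_trans, P.mk_map]

theorem cls_map {N : ℕ} {A B : Type} [Finite A] [Finite B] (e : A ≃ B) (x : P.obj A) :
    P.cls N (P.map e x) = P.cls N x := by
  by_cases h : Nat.card B = N + 1
  · rw [P.cls_eq (Finite.equivFinOfCardEq h), P.cls_eq (e.trans (Finite.equivFinOfCardEq h)),
      P.map_trans]
  · have h' : ¬ Nat.card A = N + 1 := by rwa [Nat.card_congr e]
    rw [cls, dif_neg h, cls, dif_neg h']
    rfl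

theorem subst_map (N n : ℕ) (σ : Equiv.Perm (Fin (n + 1))) (x : P.obj (Fin (n + 1)))
    (y : Fin (n + 1) → ∀ m, P.obj (Fin (m + 1))) :
    P.subst N n (P.map σ x) y = P.subst N n x fun j => y (σ j) := by
  unfold subst
  refine Fintype.sum_equiv (Equiv.arrowCongr σ.symm (Equiv.refl _)) _ _ fun m => ?_
  rw [P.comp_map_left, P.cls_map]
  rfl

/-- `subst` as a linear map in its first argument. -/
def substLin (N n : ℕ) (y : Fin (n + 1) → ∀ m, P.obj (Fin (m + 1))) :
    P.obj (Fin (n + 1)) →ₗ[k] P.Coinv N where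
  toFun x := P.subst N n x y
  map_add' x x' := by simp [subst, Finset.sum_add_distrib]
  map_smul' c x := by simp [subst, Finset.smul_sum]

theorem cls_comp_update {N : ℕ} {A : Type} {B : A → Type} [Finite A] [DecidableEq A]
    [∀ a, Finite (B a)]
    (x : P.obj A) (y : ∀ a, P.obj (B a)) (a : A) (σ : Equiv.Perm (B a)) (z : P.obj (B a)) :
    P.cls N (P.comp x (Function.update y a (P.map σ z))) =
      P.cls N (P.comp x (Function.update y a z)) := by
  have h : Function.update y a (P.map σ z) = fun b =>
      P.map (Function.update (fun b => Equiv.refl (B b)) a σ b) (Function.update y a z b) := by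
    ext b
    by_cases h : b = a
    · subst h; simp
    · simp [h, P.map_refl]
  rw [h, P.comp_map_right, P.cls_map]

theorem cls_comp_congr {N : ℕ} {A : Type} {n : A → ℕ} [Finite A]
    (x : P.obj A) (y y' : ∀ a, P.obj (Fin (n a)))
    (h : ∀ a, Representation.Coinvariants.mk (P.rep (n a)) (y a) =
      Representation.Coinvariants.mk (P.rep (n a)) (y' a)) :
    P.cls N (P.comp x y) = P.cls N (P.comp x y') := by
  classical
  have := Fintype.ofFinite A
  have key : ∀ (w : ∀ a, P.obj (Fin (n a))) (a : A) (u u' : P.obj (Fin (n a))),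
      Representation.Coinvariants.mk (P.rep (n a)) u =
        Representation.Coinvariants.mk (P.rep (n a)) u' →
      P.cls N (P.comp x (Function.update w a u)) =
        P.cls N (P.comp x (Function.update w a u')) := by
    intro w a u u' huu
    rw [Representation.Coinvariants.mk_eq_iff] at huu
    have hle : Representation.Coinvariants.ker (P.rep (n a)) ≤
        LinearMap.ker (P.cls N ∘ₗ (P.comp x).toLinearMap w a) := by
      rw [Representation.Coinvariants.ker, Submodule.span_le]
      rintro _ ⟨⟨σ, z⟩, rfl⟩
      change P.cls N ((P.comp x).toLinearMap w a (P.map σ z - z)) = 0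
      rw [map_sub, map_sub, sub_eq_zero]
      exact P.cls_comp_update x w a σ z
    have h0 := hle huu
    rw [LinearMap.mem_ker, map_sub, sub_eq_zero] at h0
    exact h0
  have main : ∀ s : Finset A, P.cls N (P.comp x (s.piecewise y y')) =
      P.cls N (P.comp x y') := by
    intro s
    induction s using Finset.induction_on with
    | empty => simp
    | insert a s ha ih =>
      rw [Finset.piecewise_insert, ← ih, key _ a _ _ (h a)]
      congr 2
      ext b
      by_cases hb : b = a
      · subst hb; simp [ha]
      · simp [hb]
  simpa using main Finset.univ

/-- `subst` depends on its inserted arguments only through their classes. -/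
theorem subst_congr (N n : ℕ) (x : P.obj (Fin (n + 1)))
    (y y' : Fin (n + 1) → ∀ m, P.obj (Fin (m + 1)))
    (h : ∀ j m, Representation.Coinvariants.mk (P.rep (m + 1)) (y j m) =
      Representation.Coinvariants.mk (P.rep (m + 1)) (y' j m)) :
    P.subst N n x y = P.subst N n x y' :=
  Finset.sum_congr rfl fun m _ => P.cls_comp_congr x _ _ fun j => h j (m j)

theorem Series.mk_rep (f : P.Series) (n : ℕ) :
    Representation.Coinvariants.mk (P.rep (n + 1)) (Series.rep f n) = f n :=
  (Submodule.Quotient.mk_surjective _ (f n)).choose_spec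

theorem linear_congr {N n : ℕ} (L : P.obj (Fin (n + 1)) →ₗ[k] P.Coinv N)
    (hL : ∀ σ x, L (P.map σ x) = L x) {x x' : P.obj (Fin (n + 1))}
    (h : Representation.Coinvariants.mk (P.rep (n + 1)) x =
      Representation.Coinvariants.mk (P.rep (n + 1)) x') : L x = L x' := by
  rw [Representation.Coinvariants.mk_eq_iff] at h
  have hle : Representation.Coinvariants.ker (P.rep (n + 1)) ≤ LinearMap.ker L := by
    rw [Representation.Coinvariants.ker, Submodule.span_le]
    rintro _ ⟨⟨σ, z⟩, rfl⟩
    change L (P.map σ z - z) = 0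
    rw [map_sub, sub_eq_zero, hL]
  have h0 := hle h
  rwa [LinearMap.mem_ker, map_sub, sub_eq_zero] at h0

/-- The composition of series may be computed with any representatives. -/
theorem seriesComp_mk (x y : ∀ n, P.obj (Fin (n + 1))) (N : ℕ) :
    P.seriesComp (fun n => Representation.Coinvariants.mk (P.rep (n + 1)) (x n))
        (fun n => Representation.Coinvariants.mk (P.rep (n + 1)) (y n)) N =
      ∑ n ∈ Finset.range (N + 1), P.subst N n (x n) fun _ => y := by
  refine Finset.sum_congr rfl fun n _ => ?_
  rw [P.subst_congr N n _ _ (fun _ => y) fun _ m => Series.mk_rep P _ m]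
  exact P.linear_congr (P.substLin N n fun _ => y) (fun σ z => P.subst_map N n σ z _)
    (Series.mk_rep P _ n)

/-- The pre-Lie product of series may be computed with any representatives. -/
theorem preLie_mk (x y : ∀ n, P.obj (Fin (n + 1))) (N : ℕ) :
    P.preLie (fun n => Representation.Coinvariants.mk (P.rep (n + 1)) (x n))
        (fun n => Representation.Coinvariants.mk (P.rep (n + 1)) (y n)) N =
      ∑ n ∈ Finset.range (N + 1), ∑ i : Fin (n + 1),
        P.subst N n (x n) fun j => if j = i then y else P.unitSeq := by
  refine Finset.sum_congr rfl fun n _ => ?_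
  rw [Finset.sum_congr rfl fun i _ => P.subst_congr N n _ _
    (fun j => if j = i then y else P.unitSeq) fun j m => ?_]
  · have := P.linear_congr (∑ i, P.substLin N n fun j => if j = i then y else P.unitSeq)
      (fun σ z => ?_) (Series.mk_rep P (fun n => Representation.Coinvariants.mk _ (x n)) n)
    · simp only [LinearMap.sum_apply] at this
      exact this
    · simp only [LinearMap.sum_apply]
      refine Fintype.sum_equiv σ.symm _ _ fun i => ?_
      refine (P.subst_map N n σ z _).trans ?_
      simp only [Equiv.eq_symm_apply]
      rfl
  · split_ifs
    · exact Series.mk_rep P _ m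
    · rfl

theorem seriesComp_zero (f g : P.Series) (hf : f 0 = P.cls 0 P.one) (hg : g 0 = P.cls 0 P.one) :
    P.seriesComp f g 0 = P.cls 0 P.one := by
  have hr : ∀ h : P.Series, h 0 = P.cls 0 P.one →
      Representation.Coinvariants.mk (P.rep 1) (Series.rep h 0) =
        Representation.Coinvariants.mk (P.rep 1) P.unitFin := fun h hh => by
    rw [Series.mk_rep P h 0, hh, P.cls_eq (Equiv.ofUnique Unit (Fin 1)), unitFin]
  have h1 : P.seriesComp f g 0 = P.subst 0 0 (Series.rep f 0) fun _ => Series.rep g := by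
    simp [seriesComp]
  have h2 : P.subst 0 0 (Series.rep f 0) (fun _ => Series.rep g) =
      P.subst 0 0 P.unitFin fun _ => Series.rep g :=
    P.linear_congr (P.substLin 0 0 fun _ => Series.rep g) (fun σ z => P.subst_map 0 0 σ z _)
      (hr f hf)
  have : Subsingleton (Fin (0 + 1)) := inferInstanceAs (Subsingleton (Fin 1))
  rw [h1, h2, subst, Fintype.sum_subsingleton _ fun _ => 0]
  have h3 := P.cls_comp_congr (N := 0) (n := fun _ : Fin 1 => 1) P.unitFin
    (fun _ => Series.rep g 0) (fun _ => P.unitFin) (fun _ => hr g hg)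
  refine h3.trans ?_
  rw [← P.cls_map (Equiv.uniqueSigma fun _ : Fin 1 => Fin 1), unitFin, P.comp_map_left, P.cls_map,
    P.cls_map, P.comp_map_right (fun _ => Equiv.ofUnique Unit (Fin 1)), P.cls_map,
    ← P.cls_map (Equiv.uniqueSigma fun _ : Unit => Unit), P.one_comp]

/-- The product of `G^e_P` is the composition of series. -/
instance : Mul P.GroupE :=
  ⟨fun f g => ⟨P.seriesComp f.1 g.1, P.seriesComp_zero f.1 g.1 f.2 g.2⟩⟩

end Operad

/-! ### Free operads -/

/-- An `S`-object `V = V_1 ⊕ V_2 ⊕ ⋯` with `V_1 = k`: `obj n` is the component `V_{n+2}`, a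
representation of the symmetric group on `n + 2` letters. The component `V_1 = k` carries no
information and is left implicit; in the free operad it is the line spanned by the operadic unit. -/
structure SObject (k : Type u) [Field k] where
  obj : ℕ → Type v
  [acg : ∀ n, AddCommGroup (obj n)]
  [mod : ∀ n, Module k (obj n)]
  rep : ∀ n, Representation k (Equiv.Perm (Fin (n + 2))) (obj n)

namespace SObject

attribute [instance] SObject.acg SObject.mod

variable {k : Type u} [Field k]

/-- Morphisms of `S`-objects from `V` to an operad `P` (with `1 ∈ V_1 = k` sent to the unit). -/
structure Hom (V : SObject.{u, v} k) (P : Operad.{u, v} k) where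
  app : ∀ n, V.obj n →ₗ[k] P.obj (Fin (n + 2))
  app_rep : ∀ n (σ : Equiv.Perm (Fin (n + 2))) (x : V.obj n),
    app n (V.rep n σ x) = P.map σ (app n x)

/-- `P` is the free operad `F(V)` on the `S`-object `V`: there is a morphism of `S`-objects
`ι : V → P` through which every morphism of `S`-objects from `V` to an operad factors by a unique
morphism of operads. -/
def IsFreeOperad (V : SObject.{u, v} k) (P : Operad.{u, v} k) : Prop :=
  ∃ ι : V.Hom P, ∀ (Q : Operad.{u, v} k) (f : V.Hom Q),
    ∃! F : P.Hom Q, ∀ n (x : V.obj n), F.app (Fin (n + 2)) (ι.app n x) = f.app n x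

/-- The `S`-object `V = (k[S_n])_{n ≥ 1}`. -/
def regular (k : Type u) [Field k] : SObject.{u, u} k where
  obj n := k[Equiv.Perm (Fin (n + 2))]
  rep n := Representation.leftRegular k (Equiv.Perm (Fin (n + 2)))

/-- The `S`-object `V_I`, with `(V_I)_n = k^{|I_n|} ⊗ k[S_n]` for `n ≥ 2` (`I n` is the set
`I_{n+2}`). -/
def decorated (k : Type u) [Field k] (I : ℕ → Type u) : SObject.{u, u} k where
  obj n := (I n →₀ k) ⊗[k] k[Equiv.Perm (Fin (n + 2))]
  rep n := (Representation.trivial k (Equiv.Perm (Fin (n + 2))) (I n →₀ k)).tprod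
    (Representation.leftRegular k (Equiv.Perm (Fin (n + 2))))

/-- The `S`-object `W` with `W_1 = k`, `W_2 = k[S_2]` and `W_n = 0` for `n ≥ 3`, as the submodule
of `k[S_n]` that is everything for `n = 2` and zero for `n ≥ 3`. -/
def binary (k : Type u) [Field k] : SObject.{u, u} k where
  obj n := {x : k[Equiv.Perm (Fin (n + 2))] // x ∈ (if n = 0 then ⊤ else ⊥ : Submodule k _)}
  rep n := (Representation.leftRegular k (Equiv.Perm (Fin (n + 2)))).subrepresentation _
    fun σ x hx => by
      split_ifs at hx ⊢ with h
      · trivial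
      · rw [Submodule.mem_bot] at hx
        rw [hx]
        exact Submodule.zero_mem _

end SObject

/-! ### Planar reduced trees -/

/-- Planar reduced rooted trees (every inner vertex has at least two incoming edges), whose leaves
are labelled by elements of `A` and whose inner vertices are decorated: an inner vertex with `n + 2`
incoming edges carries an element of `I n`. Here `leaf` is the one-edge tree and `node i t` is
`⋁_i(t_0, …, t_{n+1})`. -/
inductive PTree (I : ℕ → Type u) (A : Type) : Type u
  | leaf (a : A) : PTree I A
  | node {n : ℕ} (i : I n) (ts : Fin (n + 2) → PTree I A) : PTree I A

namespace PTree

variable {I : ℕ → Type u} {A B C : Type}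

/-- The labels of the leaves, from left to right. -/
def leafList : PTree I A → List A
  | leaf a => [a]
  | node _ ts => (List.ofFn fun j => (ts j).leafList).flatten

/-- Replace every leaf, with label `a` say, by the tree `f a`. -/
def bind (f : A → PTree I B) : PTree I A → PTree I B
  | leaf a => f a
  | node i ts => node i fun j => (ts j).bind f

/-- Relabel the leaves. -/
def relabel (f : A → B) (t : PTree I A) : PTree I B := t.bind fun a => leaf (f a)

theorem bind_bind (f : A → PTree I B) (g : B → PTree I C) (t : PTree I A) :
    (t.bind f).bind g = t.bind fun a => (f a).bind g := by
  induction t with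
  | leaf a => rfl
  | node i ts ih => simp only [bind, ih]

theorem bind_leaf (t : PTree I A) : t.bind leaf = t := by
  induction t with
  | leaf a => rfl
  | node i ts ih => simp only [bind, ih]

theorem leafList_bind (f : A → PTree I B) (t : PTree I A) :
    (t.bind f).leafList = t.leafList.flatMap fun a => (f a).leafList := by
  induction t with
  | leaf a => simp [bind, leafList]
  | node i ts ih =>
    simp only [bind, leafList, ih, List.flatMap, List.map_flatten, List.flatten_flatten]
    simp [List.map_ofFn, Function.comp_def]

theorem leafList_relabel (f : A → B) (t : PTree I A) :
    (t.relabel f).leafList = t.leafList.map f := by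
  rw [relabel, leafList_bind, List.map_eq_flatMap]
  rfl

end PTree

/-- Planar reduced trees whose leaves are labelled bijectively by `A`. -/
def LTree (I : ℕ → Type u) (A : Type) : Type u :=
  {t : PTree I A // t.leafList.Nodup ∧ ∀ a, a ∈ t.leafList}

namespace LTree

variable {I : ℕ → Type u} {A B C : Type}

/-- Relabelling along a bijection. -/
def map (e : A ≃ B) (t : LTree I A) : LTree I B :=
  ⟨t.1.relabel e, by
    rw [PTree.leafList_relabel]
    exact ⟨t.2.1.map e.injective, fun b => List.mem_map.2 ⟨e.symm b, t.2.2 _, by simp⟩⟩⟩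

/-- The one-edge tree. -/
def one : LTree I Unit := ⟨.leaf (), by simp [PTree.leafList]⟩

/-- Replace, for all `a`, the leaf `a` of `t` by the tree `s a`. -/
def graft {B : A → Type} (t : LTree I A) (s : ∀ a, LTree I (B a)) : LTree I (Σ a, B a) :=
  ⟨t.1.bind fun a => (s a).1.relabel (Sigma.mk a), by
    have h : (t.1.bind fun a => (s a).1.relabel (Sigma.mk a)).leafList =
        t.1.leafList.flatMap fun a => (s a).1.leafList.map (Sigma.mk a) := by
      simp only [PTree.leafList_bind, PTree.leafList_relabel]
    rw [h]
    refine ⟨List.nodup_flatMap.2 ⟨fun a _ => (s a).2.1.map sigma_mk_injective, ?_⟩, ?_⟩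
    · refine t.2.1.imp fun {a b} hab => ?_
      simp only [Function.onFun, List.disjoint_left, List.mem_map]
      rintro _ ⟨x, _, rfl⟩ ⟨y, _, hy⟩
      exact hab (congrArg Sigma.fst hy).symm
    · rintro ⟨a, b⟩
      exact List.mem_flatMap.2 ⟨a, t.2.2 a, List.mem_map.2 ⟨b, (s a).2.2 b, rfl⟩⟩⟩

end LTree

section treeOperad

variable (k : Type u) [Field k] (I : ℕ → Type u)

open Classical in
/-- The multilinear map `(y_a)_a ↦ ⨂_a y_a` on finitely supported functions. -/
def finsuppTensor {A : Type} [Finite A] (T : A → Type u) :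
    MultilinearMap k (fun a => T a →₀ k) ((∀ a, T a) →₀ k) :=
  letI := Fintype.ofFinite A
  { toFun := fun y => Finsupp.onFinset (Fintype.piFinset fun a => (y a).support)
      (fun s => ∏ a, y a (s a)) fun s hs => by
        rw [Fintype.mem_piFinset]
        exact fun a => Finsupp.mem_support_iff.2 (Finset.prod_ne_zero_iff.1 hs a (Finset.mem_univ a))
    map_update_add' := fun {dec} y a u v => by
      ext s
      have := ((MultilinearMap.mkPiAlgebra k A k).compLinearMap
        fun a => Finsupp.lapply (R := k) (M := k) (s a)).map_update_add y a u v
      simp only [MultilinearMap.compLinearMap_apply, MultilinearMap.mkPiAlgebra_apply] at this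
      exact this
    map_update_smul' := fun {dec} y a c u => by
      ext s
      have := ((MultilinearMap.mkPiAlgebra k A k).compLinearMap
        fun a => Finsupp.lapply (R := k) (M := k) (s a)).map_update_smul y a c u
      simp only [MultilinearMap.compLinearMap_apply, MultilinearMap.mkPiAlgebra_apply] at this
      exact this }

theorem finsuppTensor_apply {A : Type} [Fintype A] (T : A → Type u) (y : ∀ a, T a →₀ k)
    (s : ∀ a, T a) : finsuppTensor k T y s = ∏ a, y a (s a) := by
  have h : ‹Fintype A› = Fintype.ofFinite A := Subsingleton.elim _ _
  rw [h]
  rfl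

theorem finsuppTensor_single {A : Type} [Finite A] (T : A → Type u) (s : ∀ a, T a) :
    finsuppTensor k T (fun a => Finsupp.single (s a) 1) = Finsupp.single s 1 := by
  classical
  have := Fintype.ofFinite A
  ext r
  rw [finsuppTensor_apply]
  by_cases h : s = r
  · subst h; simp
  · obtain ⟨a, ha⟩ := Function.ne_iff.1 h
    rw [Finsupp.single_eq_of_ne' h]
    exact Finset.prod_eq_zero (Finset.mem_univ a) (Finsupp.single_eq_of_ne' ha)

/-- The composition of the operad of trees, on linear combinations of trees. -/
def treeComp {A : Type} {B : A → Type} [Finite A] [∀ a, Finite (B a)] :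
    (LTree I A →₀ k) →ₗ[k]
      MultilinearMap k (fun a => LTree I (B a) →₀ k) (LTree I (Σ a, B a) →₀ k) :=
  Finsupp.linearCombination k fun t =>
    (Finsupp.lmapDomain k k (LTree.graft t)).compMultilinearMap
      (finsuppTensor k fun a => LTree I (B a))

theorem treeComp_single {A : Type} {B : A → Type} [Finite A] [∀ a, Finite (B a)] (t : LTree I A)
    (s : ∀ a, LTree I (B a)) :
    treeComp k I (Finsupp.single t 1) (fun a => Finsupp.single (s a) 1) =
      Finsupp.single (t.graft s) 1 := by
  simp [treeComp, finsuppTensor_single]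

end treeOperad

namespace LTree

variable {I : ℕ → Type u} {A A' : Type}

theorem map_refl (t : LTree I A) : t.map (Equiv.refl A) = t :=
  Subtype.ext (PTree.bind_leaf t.1)

theorem map_trans {B C : Type} (e : A ≃ B) (f : B ≃ C) (t : LTree I A) :
    t.map (e.trans f) = (t.map e).map f := by
  apply Subtype.ext
  simp only [map, PTree.relabel, PTree.bind_bind, PTree.bind]
  rfl

theorem map_graft {B : A' → Type} (e : A ≃ A') (t : LTree I A) (s : ∀ a, LTree I (B a)) :
    (t.map e).graft s = (t.graft fun a => s (e a)).map (Equiv.sigmaCongrLeft e) := by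
  apply Subtype.ext
  simp only [map, graft, PTree.relabel, PTree.bind_bind, PTree.bind]
  rfl

theorem graft_map {B B' : A → Type} (e : ∀ a, B a ≃ B' a) (t : LTree I A)
    (s : ∀ a, LTree I (B a)) :
    t.graft (fun a => (s a).map (e a)) = (t.graft s).map (Equiv.sigmaCongrRight e) := by
  apply Subtype.ext
  simp only [map, graft, PTree.relabel, PTree.bind_bind, PTree.bind]
  rfl

theorem one_graft (t : LTree I A) :
    (one.graft fun _ => t).map (Equiv.uniqueSigma fun _ : Unit => A) = t := by
  apply Subtype.ext
  simp only [map, graft, one, PTree.relabel, PTree.bind_bind, PTree.bind]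
  exact PTree.bind_leaf t.1

theorem graft_one (t : LTree I A) :
    (t.graft fun _ => one).map (Equiv.sigmaUnique A fun _ => Unit) = t := by
  apply Subtype.ext
  simp only [map, graft, one, PTree.relabel, PTree.bind_bind, PTree.bind]
  exact PTree.bind_leaf t.1

theorem graft_graft {B : A → Type} {C : ∀ a, B a → Type} (t : LTree I A)
    (s : ∀ a, LTree I (B a)) (r : ∀ a b, LTree I (C a b)) :
    ((t.graft s).graft fun p : Σ a, B a => r p.1 p.2).map (Equiv.sigmaAssoc C) =
      t.graft fun a => (s a).graft (r a) := by
  apply Subtype.ext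
  simp only [map, graft, PTree.relabel, PTree.bind_bind, PTree.bind]
  rfl

end LTree

section treeOperad

variable (k : Type u) [Field k] (I : ℕ → Type u)

theorem finsupp_multilinear_ext {A : Type} [Finite A] {T : A → Type u} {M : Type u}
    [AddCommGroup M] [Module k M] (F G : MultilinearMap k (fun a => T a →₀ k) M)
    (h : ∀ s : ∀ a, T a, F (fun a => Finsupp.single (s a) 1) =
      G (fun a => Finsupp.single (s a) 1)) : F = G := by
  refine Module.Basis.ext_multilinear (fun a => Finsupp.basisSingleOne) fun s => ?_
  simpa using h s

/-- Two bilinear-multilinear maps agree if they do on trees. -/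
theorem treeComp_induction {A : Type} {B : A → Type} [Finite A] [∀ a, Finite (B a)] {M : Type u}
    [AddCommGroup M] [Module k M]
    (F G : (LTree I A →₀ k) →ₗ[k] MultilinearMap k (fun a => LTree I (B a) →₀ k) M)
    (h : ∀ t (s : ∀ a, LTree I (B a)),
      F (Finsupp.single t 1) (fun a => Finsupp.single (s a) 1) =
        G (Finsupp.single t 1) (fun a => Finsupp.single (s a) 1)) : F = G :=
  Finsupp.lhom_ext' fun t => LinearMap.ext_ring (finsupp_multilinear_ext k _ _ (h t))

theorem finsuppTensor_sigma {A : Type} {B : A → Type} [Finite A] [∀ a, Finite (B a)]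
    (T : ∀ a, B a → Type u) (z : ∀ a b, T a b →₀ k) :
    finsuppTensor k (fun a => ∀ b, T a b) (fun a => finsuppTensor k (T a) (z a)) =
      Finsupp.lmapDomain k k (fun f a b => f ⟨a, b⟩)
        (finsuppTensor k (fun p : Σ a, B a => T p.1 p.2) fun p => z p.1 p.2) := by
  have := Fintype.ofFinite A
  have := fun a => Fintype.ofFinite (B a)
  ext r
  have h := Finsupp.mapDomain_apply (Equiv.piCurry T).injective
    (finsuppTensor k (fun p : Σ a, B a => T p.1 p.2) fun p => z p.1 p.2) fun p => r p.1 p.2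
  refine Eq.trans ?_ h.symm
  simp only [finsuppTensor_apply]
  rw [Fintype.prod_sigma]

theorem finsuppTensor_reindex {A A' : Type} [Finite A] [Finite A'] (T : A' → Type u) (e : A ≃ A')
    (y : ∀ a, T a →₀ k) :
    finsuppTensor k (fun a => T (e a)) (fun a => y (e a)) =
      Finsupp.lmapDomain k k (fun f a => f (e a)) (finsuppTensor k T y) := by
  have := Fintype.ofFinite A
  have := Fintype.ofFinite A'
  ext r
  obtain ⟨r, rfl⟩ := (Equiv.piCongrLeft T e).symm.surjective r
  have h := Finsupp.mapDomain_apply (Equiv.piCongrLeft T e).symm.injective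
    (finsuppTensor k T y) r
  refine Eq.trans ?_ h.symm
  rw [finsuppTensor_apply, finsuppTensor_apply]
  exact Fintype.prod_equiv e _ _ fun _ => rfl

theorem finsuppTensor_unit (T : Type u) (x : T →₀ k) :
    finsuppTensor k (fun _ : Unit => T) (fun _ => x) =
      Finsupp.lmapDomain k k (fun t _ => t) x := by
  ext r
  obtain ⟨r, rfl⟩ := (Equiv.funUnique Unit T).symm.surjective r
  have h := Finsupp.mapDomain_apply (Equiv.funUnique Unit T).symm.injective x r
  refine Eq.trans ?_ h.symm
  rw [finsuppTensor_apply]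
  simp

theorem treeComp_assoc {A : Type} {B : A → Type} {C : ∀ a, B a → Type} [Finite A]
    [∀ a, Finite (B a)] [∀ a b, Finite (C a b)] (x : LTree I A →₀ k)
    (y : ∀ a, LTree I (B a) →₀ k) (z : ∀ a b, LTree I (C a b) →₀ k) :
    Finsupp.lmapDomain k k (LTree.map (Equiv.sigmaAssoc C))
        (treeComp k I (treeComp k I x y) fun p : Σ a, B a => z p.1 p.2) =
      treeComp k I x fun a => treeComp k I (y a) (z a) := by
  let ev : ∀ {A' : Type} {B' : A' → Type} [Finite A'] [∀ a, Finite (B' a)]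
    (w : ∀ a, LTree I (B' a) →₀ k), (LTree I A' →₀ k) →ₗ[k] (LTree I (Σ a, B' a) →₀ k) :=
    fun w => LinearMap.mk ⟨fun x => treeComp k I x w, by simp⟩ (by simp)
  have key := treeComp_induction k I
    (((Finsupp.lmapDomain k k (LTree.map (Equiv.sigmaAssoc C))) ∘ₗ
      ev fun p : Σ a, B a => z p.1 p.2).compMultilinearMapₗ k ∘ₗ treeComp k I)
    (LinearMap.mk ⟨fun x => (treeComp k I x).compLinearMap fun a => ev (z a), by
      intros; ext; simp⟩ (by intros; ext; simp)) ?_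
  · exact congrArg (fun F => F x y) key
  intro t s
  change Finsupp.lmapDomain k k _ (treeComp k I (treeComp k I _ _) _) =
    treeComp k I _ fun a => treeComp k I _ (z a)
  rw [treeComp_single]
  simp only [treeComp, Finsupp.linearCombination_single, one_smul,
    LinearMap.compMultilinearMap_apply]
  have h := finsuppTensor_sigma k (fun a b => LTree I (C a b)) z
  have h2 : (finsuppTensor k fun a => LTree I (Σ b, C a b)).compLinearMap
      (fun a => Finsupp.lmapDomain k k (LTree.graft (s a))) =
      (Finsupp.lmapDomain k k fun (f : ∀ a b, LTree I (C a b)) a => (s a).graft (f a)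
        ).compMultilinearMap (finsuppTensor k fun a => ∀ b, LTree I (C a b)) := by
    apply finsupp_multilinear_ext
    intro r
    simp [finsuppTensor_single]
  have h3 := congrArg (fun F => F fun a => finsuppTensor k (fun b => LTree I (C a b)) (z a)) h2
  simp only [MultilinearMap.compLinearMap_apply, LinearMap.compMultilinearMap_apply] at h3
  rw [h3, h]
  simp only [Finsupp.lmapDomain_apply, ← Finsupp.mapDomain_comp]
  congr 1
  funext r
  exact LTree.graft_graft t s fun a b => r ⟨a, b⟩

/-- The operad of planar reduced trees decorated by `I`: its operations with inputs indexed by `A`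
are the linear combinations of decorated planar reduced trees whose leaves are labelled bijectively
by `A`; the composition replaces the leaves by trees. -/
def treeOperad : Operad.{u, u} k where
  obj A := LTree I A →₀ k
  map e := Finsupp.lmapDomain k k (LTree.map e)
  one := Finsupp.single LTree.one 1
  comp := treeComp k I
  map_refl {A} _ x := by
    have h : (LTree.map (Equiv.refl A) : LTree I A → _) = id := funext LTree.map_refl
    rw [h]
    exact Finsupp.mapDomain_id
  map_trans {A B C} _ _ _ e f x := by
    have h : (LTree.map (e.trans f) : LTree I A → _) = LTree.map f ∘ LTree.map e :=
      funext (LTree.map_trans e f)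
    rw [h]
    exact Finsupp.mapDomain_comp
  comp_map_left {A A' B} _ _ _ e x y := by
    induction x using Finsupp.induction_linear with
    | zero => simp
    | add x x' hx hx' => simp only [map_add, add_apply, hx, hx']
    | single t c =>
      simp only [Finsupp.lmapDomain_apply, Finsupp.mapDomain_single]
      simp only [treeComp, Finsupp.linearCombination_single, smul_apply,
        LinearMap.compMultilinearMap_apply, finsuppTensor_reindex k (fun a => LTree I (B a)) e y,
        Finsupp.lmapDomain_apply, ← Finsupp.mapDomain_comp, Finsupp.mapDomain_smul]
      congr 2
      funext s
      exact LTree.map_graft e t s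
  comp_map_right {A B B'} _ _ _ e x y := by
    have key := treeComp_induction k I
      (LinearMap.mk ⟨fun x => (treeComp k I x).compLinearMap fun a =>
        Finsupp.lmapDomain k k (LTree.map (e a)), by intros; ext; simp⟩ (by intros; ext; simp))
      ((Finsupp.lmapDomain k k (LTree.map (Equiv.sigmaCongrRight e))).compMultilinearMapₗ k ∘ₗ
        treeComp k I) ?_
    · exact congrArg (fun F => F x y) key
    intro t s
    change treeComp k I _ (fun a => Finsupp.lmapDomain k k _ _) =
      Finsupp.lmapDomain k k _ (treeComp k I _ _)
    simp only [Finsupp.lmapDomain_apply, Finsupp.mapDomain_single, treeComp_single, LTree.graft_map]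
  one_comp {A} _ x := by
    simp only [treeComp, Finsupp.linearCombination_single, one_smul,
      LinearMap.compMultilinearMap_apply, finsuppTensor_unit, Finsupp.lmapDomain_apply,
      ← Finsupp.mapDomain_comp]
    refine Eq.trans ?_ Finsupp.mapDomain_id
    congr 1
    funext t
    exact LTree.one_graft t
  comp_one {A} _ x := by
    induction x using Finsupp.induction_linear with
    | zero => simp
    | add x x' hx hx' => rw [map_add, add_apply, map_add, hx, hx']
    | single t c =>
      rw [← mul_one c, ← smul_eq_mul, ← Finsupp.smul_single, map_smul, smul_apply,
        treeComp_single, map_smul, Finsupp.lmapDomain_apply, Finsupp.mapDomain_single,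
        LTree.graft_one]
  assoc := treeComp_assoc k I

end treeOperad

/-! ### The Hopf algebra of planar reduced forests -/

namespace PTree

variable {I : ℕ → Type u}

/-- The admissible cuts of a planar reduced tree: sets of edges which are not connected to a leaf
(the root edge is allowed) such that every path from the root to a leaf contains at most one of
them. A cut of `⋁(t_0, …, t_{n+1})` is either the root edge alone (`none`), or it consists of an
admissible cut of each branch `t_j`, the root edge of the branch included. The one-edge tree only
has the empty cut. -/
def Cut : PTree I Unit → Type
  | leaf _ => Unit
  | node _ ts => Option (∀ j, Cut (ts j))

instance instFintypeCut : ∀ t : PTree I Unit, Fintype t.Cut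
  | leaf _ => inferInstanceAs (Fintype Unit)
  | node _ ts =>
    letI := fun j => instFintypeCut (ts j)
    letI := Classical.decEq
    inferInstanceAs (Fintype (Option (∀ j, Cut (ts j))))

/-- The pruning `P^c(t)`: the list, from left to right, of the subtrees above the edges of the cut
`c` (one tree for each edge of `c`). -/
def prune : ∀ t : PTree I Unit, t.Cut → List (PTree I Unit)
  | leaf _, _ => []
  | node i ts, none => [node i ts]
  | node _ ts, some c => (List.ofFn fun j => (ts j).prune (c j)).flatten

/-- The trunk `R^c(t)`: every subtree above an edge of `c` is replaced by a leaf. -/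
def trunk : ∀ t : PTree I Unit, t.Cut → PTree I Unit
  | leaf _, _ => leaf ()
  | node _ _, none => leaf ()
  | node i ts, some c => node i fun j => (ts j).trunk (c j)

end PTree

/-- The planar reduced trees different from the one-edge tree. -/
abbrev NTree (I : ℕ → Type u) : Type u := {t : PTree I Unit // t ≠ .leaf ()}

/-- The algebra `H^{red}_{pl}` of planar reduced forests: the free noncommutative algebra on the
planar reduced trees, the one-edge tree being identified with the unit. -/
abbrev Hred (k : Type u) [Field k] (I : ℕ → Type u) : Type u := FreeAlgebra k (NTree I)

section Hred

variable (k : Type u) [Field k] (I : ℕ → Type u)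

variable {I} in
/-- A planar reduced tree as an element of `H^{red}_{pl}`. -/
def PTree.toH : PTree I Unit → Hred k I
  | .leaf _ => 1
  | .node i ts => FreeAlgebra.ι k (⟨.node i ts, fun h => nomatch h⟩ : NTree I)

variable {I} in
/-- The pruning `P^c(t)` as a forest in `H^{red}_{pl}`. -/
def PTree.pruneH (t : PTree I Unit) (c : t.Cut) : Hred k I := ((t.prune c).map (PTree.toH k)).prod

/-- The coproduct `Δ_2`, with `Δ_2(t) = ∑_{c ∈ Adm t} P^c(t) ⊗ R^c(t)`. -/
def comulH : Hred k I →ₐ[k] Hred k I ⊗[k] Hred k I :=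
  FreeAlgebra.lift k fun t => ∑ c : t.1.Cut, t.1.pruneH k c ⊗ₜ (t.1.trunk c).toH k

/-- The counit. -/
def counitH : Hred k I →ₐ[k] k := FreeAlgebra.lift k fun _ => 0

theorem List.prod_ofFn_sum {R : Type u} [Semiring R] : ∀ {n : ℕ} {κ : Fin n → Type}
    [∀ j, Fintype (κ j)] [Fintype (∀ j, κ j)] (f : ∀ j, κ j → R),
    (List.ofFn fun j => ∑ c, f j c).prod = ∑ c : ∀ j, κ j, (List.ofFn fun j => f j (c j)).prod
  | 0, κ, _, _, f => by
    have : Unique (∀ j, κ j) := Pi.uniqueOfIsEmpty κ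
    simp
  | n + 1, κ, _, _, f => by
    classical
    rw [List.ofFn_succ, List.prod_cons, List.prod_ofFn_sum fun j => f j.succ,
      Finset.sum_mul_sum, ← Finset.sum_product']
    refine Fintype.sum_equiv (Fin.consEquiv κ) _ _ fun c => ?_
    simp [List.ofFn_succ]

theorem List.prod_ofFn_ite {R : Type u} [Semiring R] : ∀ {n : ℕ} (p : Fin n → Prop)
    [∀ j, Decidable (p j)] [Decidable (∀ j, p j)] (f : Fin n → R),
    (List.ofFn fun j => if p j then f j else 0).prod = if ∀ j, p j then (List.ofFn f).prod else 0
  | 0, p, _, _, f => by simp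
  | n + 1, p, _, _, f => by
    classical
    rw [List.ofFn_succ, List.prod_cons, List.prod_ofFn_ite fun j => p j.succ]
    by_cases h : p 0 <;> by_cases h' : ∀ j : Fin n, p j.succ <;>
      simp [Fin.forall_fin_succ, h, h', List.ofFn_succ]

variable {I}

theorem PTree.sum_cut_node {M : Type u} [AddCommMonoid M] {n : ℕ} (i : I n)
    (ts : Fin (n + 2) → PTree I Unit) (f : (PTree.node i ts).Cut → M) :
    ∑ c, f c = f none + ∑ c : ∀ j, (ts j).Cut, f (some c) := by
  classical
  have key : ∀ {α : Type} (i₁ i₂ : Fintype α) (f : α → M),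
      @Finset.sum _ _ _ (@Finset.univ α i₁) f = @Finset.sum _ _ _ (@Finset.univ α i₂) f := by
    intro α i₁ i₂ f
    rw [Subsingleton.elim i₁ i₂]
  exact (key _ _ _).trans (Fintype.sum_option (α := ∀ j, (ts j).Cut) f)

theorem PTree.sum_cut_leaf {M : Type u} [AddCommMonoid M] (a : Unit)
    (f : (PTree.leaf a : PTree I Unit).Cut → M) : ∑ c, f c = f () :=
  Fintype.sum_unique (ι := Unit) f

theorem PTree.pruneH_node_some {n : ℕ} (i : I n) (ts : Fin (n + 2) → PTree I Unit)
    (c : ∀ j, (ts j).Cut) : (PTree.node i ts).pruneH k (some c) =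
      (List.ofFn fun j => (ts j).pruneH k (c j)).prod := by
  simp only [PTree.pruneH, PTree.prune, List.map_flatten, List.prod_flatten, List.map_ofFn,
    Function.comp_def]

theorem PTree.pruneH_node_none {n : ℕ} (i : I n) (ts : Fin (n + 2) → PTree I Unit) :
    (PTree.node i ts).pruneH k none = (PTree.node i ts).toH k := by
  simp [PTree.pruneH, PTree.prune]

theorem comulH_toH (t : PTree I Unit) :
    comulH k I (t.toH k) = ∑ c : t.Cut, t.pruneH k c ⊗ₜ (t.trunk c).toH k := by
  cases t with
  | leaf a =>
    rw [PTree.sum_cut_leaf]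
    simp [PTree.toH, PTree.pruneH, PTree.prune, PTree.trunk, Algebra.TensorProduct.one_def]
  | node i ts =>
    exact FreeAlgebra.lift_ι_apply _ _

theorem counitH_toH_node {n : ℕ} (i : I n) (ts : Fin (n + 2) → PTree I Unit) :
    counitH k I ((PTree.node i ts).toH k) = 0 := by
  exact FreeAlgebra.lift_ι_apply _ _

theorem TensorProduct.prod_ofFn_tmul {R S : Type u} [Ring R] [Algebra k R] [Ring S] [Algebra k S] :
    ∀ {n : ℕ} (f : Fin n → R) (g : Fin n → S),
      (List.ofFn f).prod ⊗ₜ[k] (List.ofFn g).prod = (List.ofFn fun j => f j ⊗ₜ[k] g j).prod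
  | 0, f, g => by simp [Algebra.TensorProduct.one_def]
  | n + 1, f, g => by
    simp only [List.ofFn_succ, List.prod_cons, ← TensorProduct.prod_ofFn_tmul,
      Algebra.TensorProduct.tmul_mul_tmul]

theorem sum_single_node {R : Type u} [Semiring R] {n : ℕ} (i : I n) {κ κ' : Fin (n + 2) → Type}
    [∀ j, Fintype (κ j)] [∀ j, Fintype (κ' j)] (v : ∀ j, κ j → PTree I Unit) (x : ∀ j, κ j → R)
    (v' : ∀ j, κ' j → PTree I Unit) (x' : ∀ j, κ' j → R)
    (h : ∀ j, ∑ c, Finsupp.single (v j c) (x j c) = ∑ c, Finsupp.single (v' j c) (x' j c)) :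
    ∑ c : ∀ j, κ j, Finsupp.single (PTree.node i fun j => v j (c j))
        (List.ofFn fun j => x j (c j)).prod =
      ∑ c : ∀ j, κ' j, Finsupp.single (PTree.node i fun j => v' j (c j))
        (List.ofFn fun j => x' j (c j)).prod := by
  classical
  have key : ∀ {κ : Fin (n + 2) → Type} [∀ j, Fintype (κ j)] (v : ∀ j, κ j → PTree I Unit)
      (x : ∀ j, κ j → R) (rs : Fin (n + 2) → PTree I Unit),
      (∑ c : ∀ j, κ j, Finsupp.single (PTree.node i fun j => v j (c j))
        (List.ofFn fun j => x j (c j)).prod) (PTree.node i rs) =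
      (List.ofFn fun j => (∑ c, Finsupp.single (v j c) (x j c)) (rs j)).prod := by
    intro κ _ v x rs
    simp only [Finsupp.finsetSum_apply, List.prod_ofFn_sum, Finsupp.single_apply,
      List.prod_ofFn_ite, PTree.node.injEq, heq_eq_eq, true_and, funext_iff]
  ext1 r
  by_cases hr : ∃ rs, r = PTree.node i rs
  · obtain ⟨rs, rfl⟩ := hr
    rw [key, key]
    simp only [h]
  · have hz : ∀ {κ : Fin (n + 2) → Type} [∀ j, Fintype (κ j)] (v : ∀ j, κ j → PTree I Unit)
        (x : ∀ j, κ j → R), (∑ c : ∀ j, κ j, Finsupp.single (PTree.node i fun j => v j (c j))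
        (List.ofFn fun j => x j (c j)).prod) r = 0 := by
      intro κ _ v x
      rw [Finsupp.finsetSum_apply]
      exact Finset.sum_eq_zero fun c _ => Finsupp.single_eq_of_ne fun h => hr ⟨_, h⟩
    rw [hz, hz]

/-- `∑_{d ∈ Adm t} (p ⊗ P^d(t)) R^d(t)`, with trunks as formal symbols. -/
def cutSum (p : Hred k I) (t : PTree I Unit) : PTree I Unit →₀ Hred k I ⊗[k] Hred k I :=
  ∑ d : t.Cut, Finsupp.single (t.trunk d) (p ⊗ₜ[k] t.pruneH k d)

theorem coassoc_aux (t : PTree I Unit) :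
    ∑ c : t.Cut, Finsupp.single (t.trunk c) (comulH k I (t.pruneH k c)) =
      ∑ c : t.Cut, cutSum k (t.pruneH k c) (t.trunk c) := by
  classical
  have hleaf : ∀ (p : Hred k I) (a : Unit),
      cutSum k p (.leaf a) = Finsupp.single (.leaf ()) (p ⊗ₜ[k] 1) :=
    fun p a => PTree.sum_cut_leaf a _
  have hnode : ∀ (p : Hred k I) {n : ℕ} (i : I n) (ts : Fin (n + 2) → PTree I Unit),
      cutSum k p (.node i ts) = Finsupp.single (.leaf ()) (p ⊗ₜ[k] (PTree.node i ts).toH k) +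
        ∑ d : ∀ j, (ts j).Cut, Finsupp.single (.node i fun j => (ts j).trunk (d j))
          (p ⊗ₜ[k] (List.ofFn fun j => (ts j).pruneH k (d j)).prod) := by
    intro p n i ts
    refine (PTree.sum_cut_node i ts _).trans ?_
    simp only [PTree.pruneH_node_none, PTree.pruneH_node_some]
    rfl
  induction t with
  | leaf a =>
    refine (PTree.sum_cut_leaf a _).trans (Eq.trans ?_ (PTree.sum_cut_leaf a _).symm)
    refine Eq.trans ?_ (hleaf _ _).symm
    change Finsupp.single _ (comulH k I 1) = Finsupp.single _ ((1 : Hred k I) ⊗ₜ[k] 1)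
    rw [map_one, Algebra.TensorProduct.one_def]
    rfl
  | node i ts ih =>
    have hc : comulH k I ((PTree.node i ts).toH k) = (PTree.node i ts).toH k ⊗ₜ[k] 1 +
        ∑ c : ∀ j, (ts j).Cut, (List.ofFn fun j => (ts j).pruneH k (c j)).prod ⊗ₜ[k]
          (PTree.node i fun j => (ts j).trunk (c j)).toH k := by
      rw [comulH_toH]
      refine (PTree.sum_cut_node i ts _).trans ?_
      simp only [PTree.pruneH_node_none, PTree.pruneH_node_some]
      rfl
    refine (PTree.sum_cut_node i ts _).trans (Eq.trans ?_ (PTree.sum_cut_node i ts _).symm)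
    simp only [PTree.pruneH_node_none, PTree.pruneH_node_some]
    change Finsupp.single (.leaf ()) _ + ∑ c : ∀ j, (ts j).Cut,
        Finsupp.single (PTree.node i fun j => (ts j).trunk (c j)) _ =
      cutSum k _ (.leaf ()) + ∑ c : ∀ j, (ts j).Cut,
        cutSum k _ (PTree.node i fun j => (ts j).trunk (c j))
    simp only [hleaf, hnode, hc, Finset.sum_add_distrib, Finsupp.single_add, ← add_assoc,
      Finsupp.single_finsetSum]
    congr 1
    simp only [map_list_prod, List.map_ofFn, Function.comp_def]
    have h := sum_single_node (R := Hred k I ⊗[k] Hred k I) i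
      (κ := fun j => (ts j).Cut) (κ' := fun j => Σ c : (ts j).Cut, ((ts j).trunk c).Cut)
      (fun j c => (ts j).trunk c) (fun j c => comulH k I ((ts j).pruneH k c))
      (fun j p => ((ts j).trunk p.1).trunk p.2)
      (fun j p => (ts j).pruneH k p.1 ⊗ₜ[k] ((ts j).trunk p.1).pruneH k p.2)
      (fun j => by
        rw [ih j, Fintype.sum_sigma]
        rfl)
    rw [h, ← Fintype.sum_sigma']
    refine Fintype.sum_equiv
      { toFun := fun p => ⟨fun j => (p j).1, fun j => (p j).2⟩
        invFun := fun q j => ⟨q.1 j, q.2 j⟩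
        left_inv := fun _ => rfl
        right_inv := fun _ => rfl } _ _ fun p => ?_
    simp only [TensorProduct.prod_ofFn_tmul]
    rfl

theorem counit_aux (t : PTree I Unit) :
    ∑ c : t.Cut, Finsupp.single (t.trunk c) (counitH k I (t.pruneH k c)) =
      Finsupp.single t 1 := by
  induction t with
  | leaf a =>
    refine (PTree.sum_cut_leaf a _).trans ?_
    change Finsupp.single _ (counitH k I 1) = _
    rw [map_one]
    rfl
  | node i ts ih =>
    refine (PTree.sum_cut_node i ts _).trans ?_
    simp only [PTree.pruneH_node_none, PTree.pruneH_node_some]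
    rw [counitH_toH_node, Finsupp.single_zero, zero_add]
    simp only [map_list_prod, List.map_ofFn, Function.comp_def]
    have h := sum_single_node (R := k) i
      (κ := fun j => (ts j).Cut) (κ' := fun j => Unit)
      (fun j c => (ts j).trunk c) (fun j c => counitH k I ((ts j).pruneH k c))
      (fun j _ => ts j) (fun _ _ => 1) (fun j => by rw [ih j]; simp)
    refine Eq.trans h ?_
    simp

/-- The bialgebra structure of `H^{red}_{pl}`. -/
instance : Bialgebra k (Hred k I) := by
  refine Bialgebra.ofAlgHom (comulH k I) (counitH k I) ?_ ?_ ?_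
  · apply FreeAlgebra.hom_ext
    funext t
    obtain ⟨t, ht⟩ := t
    have e : FreeAlgebra.ι k (⟨t, ht⟩ : NTree I) = t.toH k := by
      cases t with
      | leaf a => exact absurd rfl ht
      | node i ts => rfl
    rw [Function.comp_apply, Function.comp_apply, e]
    simp only [AlgHom.comp_apply, comulH_toH, map_sum]
    let L : (PTree I Unit →₀ Hred k I ⊗[k] Hred k I) →ₗ[k]
        Hred k I ⊗[k] (Hred k I ⊗[k] Hred k I) :=
      Finsupp.lsum k fun r => (TensorProduct.assoc k _ _ _).toLinearMap ∘ₗ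
        (TensorProduct.mk k _ _).flip (r.toH k)
    have h := congrArg L (coassoc_aux k t)
    simp only [map_sum, cutSum, L, Finsupp.lsum_single] at h
    refine Eq.trans ?_ (h.trans ?_)
    · rfl
    · refine Finset.sum_congr rfl fun c _ => ?_
      simp [comulH_toH, TensorProduct.tmul_sum]
  · apply FreeAlgebra.hom_ext
    funext t
    obtain ⟨t, ht⟩ := t
    have e : FreeAlgebra.ι k (⟨t, ht⟩ : NTree I) = t.toH k := by
      cases t with
      | leaf a => exact absurd rfl ht
      | node i ts => rfl
    rw [Function.comp_apply, Function.comp_apply, e]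
    simp only [AlgHom.comp_apply, comulH_toH, map_sum]
    let L : (PTree I Unit →₀ k) →ₗ[k] k ⊗[k] Hred k I :=
      Finsupp.lsum k fun r => (TensorProduct.mk k _ _).flip (r.toH k)
    have h := congrArg L (counit_aux k t)
    simp only [map_sum, L, Finsupp.lsum_single] at h
    exact h
  · apply FreeAlgebra.hom_ext
    funext t
    obtain ⟨t, ht⟩ := t
    cases t with
    | leaf a => exact absurd rfl ht
    | node i ts =>
      have e : FreeAlgebra.ι k (⟨.node i ts, ht⟩ : NTree I) = (PTree.node i ts).toH k := rfl
      rw [Function.comp_apply, Function.comp_apply, e]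
      simp only [AlgHom.comp_apply, comulH_toH, map_sum]
      refine (PTree.sum_cut_node i ts _).trans ?_
      rw [Finset.sum_eq_zero]
      · rw [add_zero, PTree.pruneH_node_none]
        change _ ⊗ₜ[k] counitH k I 1 = _
        rw [map_one]
        rfl
      · intro c _
        change _ ⊗ₜ[k] counitH k I ((PTree.node i fun j => (ts j).trunk (c j)).toH k) = _
        rw [counitH_toH_node, TensorProduct.tmul_zero]

end Hred

/-! ### The grafting product and the normalized dual basis -/

namespace PTree

variable {I : ℕ → Type u} {A : Type}

/-- The vertices of a planar tree, including the leaves. -/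
def Vtx : PTree I Unit → Type
  | leaf _ => Unit
  | node _ ts => Option (Σ j, Vtx (ts j))

/-- The lowest vertex. -/
def rootVtx : ∀ t : PTree I Unit, t.Vtx
  | leaf _ => ()
  | node _ _ => none

/-- `IsChild t m p q`: the vertex `q` is the upper end of the `m`-th incoming edge of `p`. -/
inductive IsChild : ∀ t : PTree I Unit, ℕ → t.Vtx → t.Vtx → Prop
  | root {n : ℕ} (i : I n) (ts : Fin (n + 2) → PTree I Unit) (j : Fin (n + 2)) :
      IsChild (node i ts) j none (some ⟨j, (ts j).rootVtx⟩)
  | branch {n : ℕ} (i : I n) (ts : Fin (n + 2) → PTree I Unit) (j : Fin (n + 2)) (m : ℕ)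
      (p q : (ts j).Vtx) (h : IsChild (ts j) m p q) :
      IsChild (node i ts) m (some ⟨j, p⟩) (some ⟨j, q⟩)

/-- The decoration of a vertex (none for leaves). -/
def deco : ∀ t : PTree I Unit, t.Vtx → Option (Σ n, I n)
  | leaf _, _ => none
  | node (n := n) i _, none => some ⟨n, i⟩
  | node _ ts, some ⟨j, p⟩ => (ts j).deco p

/-- The symmetry factor `σ(t)`: the number of automorphisms of the planar tree `t`, that is, of
permutations of its vertices that preserve the edges, their planar order and the decorations. -/
def sigma (t : PTree I Unit) : ℕ :=
  Nat.card {f : Equiv.Perm t.Vtx //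
    (∀ m p q, t.IsChild m (f p) (f q) ↔ t.IsChild m p q) ∧ ∀ p, t.deco (f p) = t.deco p}

/-- `N(t, u, v)`: the number of elementary cuts (cuts with exactly one edge) of `v` with pruning `t`
and trunk `u`. -/
def numCuts (t u v : PTree I Unit) : ℕ :=
  Nat.card {c : v.Cut // v.prune c = [t] ∧ v.trunk c = u}

/-- The set of leaves of a tree. -/
def Leaf : PTree I A → Type
  | leaf _ => Unit
  | node _ ts => Σ j, Leaf (ts j)

instance instFintypeLeaf : ∀ t : PTree I A, Fintype t.Leaf
  | leaf _ => inferInstanceAs (Fintype Unit)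
  | node _ ts =>
    letI := fun j => instFintypeLeaf (ts j)
    inferInstanceAs (Fintype (Σ j, Leaf (ts j)))

/-- Graft `t` on the leaf `l` of `u`. -/
def graftAt : ∀ u : PTree I Unit, u.Leaf → PTree I Unit → PTree I Unit
  | leaf _, _, t => t
  | node i ts, ⟨j, l⟩, t => node i (Function.update ts j ((ts j).graftAt l t))

/-- The tree `t`, each of whose leaves is labelled by itself. -/
def selfLabel : ∀ t : PTree I A, PTree I t.Leaf
  | leaf _ => leaf ()
  | node i ts => node i fun j => (ts j).selfLabel.relabel (Sigma.mk j)

theorem selfLabel_bijective (t : PTree I A) :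
    t.selfLabel.leafList.Nodup ∧ ∀ l, l ∈ t.selfLabel.leafList := by
  induction t with
  | leaf a => exact ⟨List.nodup_singleton _, fun _ => List.mem_singleton.2 rfl⟩
  | node i ts ih =>
    have h : (node i ts).selfLabel.leafList = (List.ofFn fun j =>
        (ts j).selfLabel.leafList.map (Sigma.mk (β := fun j => (ts j).Leaf) j)).flatten :=
      congrArg List.flatten (congrArg List.ofFn (funext fun j => leafList_relabel _ _))
    have key : ∀ L : List (Σ j, (ts j).Leaf), L = (List.ofFn fun j =>
        (ts j).selfLabel.leafList.map (Sigma.mk (β := fun j => (ts j).Leaf) j)).flatten →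
        L.Nodup ∧ ∀ l, l ∈ L := by
      rintro _ rfl
      constructor
      · rw [List.nodup_flatten]
        refine ⟨fun l hl => ?_, ?_⟩
        · obtain ⟨j, rfl⟩ := (List.mem_ofFn' _ _).1 hl
          exact (ih j).1.map sigma_mk_injective
        · rw [List.pairwise_ofFn]
          intro j j' hj
          simp only [List.disjoint_left, List.mem_map]
          rintro _ ⟨x, _, rfl⟩ ⟨y, _, hy⟩
          exact hj.ne (congrArg Sigma.fst hy).symm
      · rintro ⟨j, l⟩
        exact List.mem_flatten.2
          ⟨_, (List.mem_ofFn' _ _).2 ⟨j, rfl⟩, List.mem_map.2 ⟨l, (ih j).2 l, rfl⟩⟩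
    exact key _ h

end PTree

section Grafting

variable (k : Type u) [Field k] {I : ℕ → Type u}

/-- The coefficient `M(t, u, v) = σ(t) σ(u) / σ(v) * N(t, u, v)`. -/
def graftCoeff (t u v : PTree I Unit) : k :=
  (t.sigma : k) * u.sigma / v.sigma * PTree.numCuts t u v

/-- The product `t ↷_σ u = ∑_v M(t, u, v) v` (a finite sum), extended bilinearly to linear
combinations of planar reduced trees different from the one-edge tree. -/
def graftSigma : (NTree I →₀ k) →ₗ[k] (NTree I →₀ k) →ₗ[k] (NTree I →₀ k) :=
  Finsupp.linearCombination k fun t : NTree I =>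
    Finsupp.linearCombination k fun u : NTree I =>
      ∑ᶠ v : NTree I, Finsupp.single v (graftCoeff k t.1 u.1 v.1)

/-- The sum of all graftings of `t` on the leaves of `u`, extended bilinearly to linear combinations
of all planar reduced trees, including the one-edge tree. -/
def graftAll : (PTree I Unit →₀ k) →ₗ[k] (PTree I Unit →₀ k) →ₗ[k] (PTree I Unit →₀ k) :=
  Finsupp.linearCombination k fun t : PTree I Unit =>
    Finsupp.linearCombination k fun u : PTree I Unit =>
      ∑ l : u.Leaf, Finsupp.single (u.graftAt l t) 1

/-- The left pre-Lie relation for a bilinear product. -/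
def IsLeftPreLie {V : Type u} [AddCommGroup V] [Module k V] (m : V →ₗ[k] V →ₗ[k] V) : Prop :=
  ∀ x y z, m x (m y z) - m (m x y) z = m y (m x z) - m (m y x) z

/-- Linear combinations of trees as elements of `H^{red}_{pl}`. -/
def spanToH : (NTree I →₀ k) →ₗ[k] Hred k I :=
  Finsupp.linearCombination k fun t : NTree I => FreeAlgebra.ι k t

/-- The normalized dual basis `x ↦ δ'_x`: for forests `f = t_1 ⋯ t_r` and `s`,
`⟨δ'_f, s⟩` is `σ(t_1) ⋯ σ(t_r)` if `s = f`, and `0` otherwise. -/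
def deltaPrime : Hred k I →ₗ[k] (Hred k I →ₗ[k] k) :=
  (FreeAlgebra.basisFreeMonoid k (NTree I)).constr k fun f =>
    ((f.toList.map fun t => (t.1.sigma : k)).prod) •
      (FreeAlgebra.basisFreeMonoid k (NTree I)).coord f

/-- Infinitesimal characters of a bialgebra. -/
def infChar (H : Type u) [Ring H] [Bialgebra k H] : Submodule k (H →ₗ[k] k) where
  carrier := {α | ∀ x y, α (x * y) = α x * Coalgebra.counit y + Coalgebra.counit x * α y}
  zero_mem' := by simp
  add_mem' := by
    intro a b ha hb x y
    simp only [LinearMap.add_apply, ha x y, hb x y]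
    ring
  smul_mem' := by
    intro c a ha x y
    simp only [LinearMap.smul_apply, ha x y, smul_eq_mul]
    ring

/-- The class of the tree `t` (with leaves labelled in any way) in `(P_{N+1})_{S_{N+1}}`, where `P`
is the operad of trees, if `t` has `N + 1` leaves; `0` otherwise. -/
def treeClass (N : ℕ) (t : PTree I Unit) : (treeOperad k I).Coinv N :=
  (treeOperad k I).cls N (A := t.Leaf) (Finsupp.single ⟨t.selfLabel, t.selfLabel_bijective⟩ 1 :
    LTree I t.Leaf →₀ k)

/-- Linear combinations of trees as series with coefficients in the operad of trees. -/
def treeSeries : (NTree I →₀ k) →ₗ[k] (treeOperad k I).Series :=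
  Finsupp.linearCombination k fun t : NTree I => fun N => treeClass k N t.1

end Grafting

/-! ### Planar rooted hypertrees -/

/-- Planar rooted hypertrees with decorated edges: the root has `m` edges attached to it, numbered
from left to right. The `e`-th one has `size e + 2` vertices (the root and `size e + 1` others, in
counterclockwise order starting from the root), and carries the decoration `dec e ∈ I (size e)`; the
`j`-th of the other vertices is the root of the planar rooted hypertree `sub e j`. -/
inductive HTree (I : ℕ → Type u) : Type u
  | mk (m : ℕ) (size : Fin m → ℕ) (dec : ∀ e, I (size e))
      (sub : ∀ e, Fin (size e + 1) → HTree I) : HTree I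

namespace HTree

variable {I : ℕ → Type u}

/-- The hypertree with given edges at the root. -/
def ofEdges {m : ℕ} (F : Fin m → Σ n, I n × (Fin (n + 1) → HTree I)) : HTree I :=
  mk m (fun e => (F e).1) (fun e => (F e).2.1) fun e => (F e).2.2

/-- The number of edges at the root of a hypertree. -/
def numEdges : HTree I → ℕ
  | mk m _ _ _ => m

/-- The edges at the root of a hypertree: size, decoration, and sub-hypertrees attached to the
vertices other than the root. -/
def edges : ∀ s : HTree I, Fin s.numEdges → Σ n, I n × (Fin (n + 1) → HTree I)
  | mk _ size dec sub => fun e => ⟨size e, dec e, sub e⟩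

/-- The hypertree with a single vertex. -/
def point : HTree I := ofEdges (Fin.elim0 : Fin 0 → _)

/-- `β_i(s_0, …, s_{n+1})`: the roots of the hypertrees `s_j` are collected, in the reversed order,
into a new edge with decoration `i`. The root of the new edge (and of the new hypertree) is the root
of `s_{n+1}`, and the new edge is the leftmost edge attached to it. -/
def beta {n : ℕ} (i : I n) (s : Fin (n + 2) → HTree I) : HTree I :=
  ofEdges (Fin.cons (α := fun _ => Σ n, I n × (Fin (n + 1) → HTree I))
    ⟨n, i, fun j => s j.succ.rev⟩ (s (Fin.last (n + 1))).edges)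

/-- Knuth's correspondence `Φ`, extended to planar reduced trees:
`Φ(⋁_i(t_0, …, t_{n+1})) = β_i(Φ(t_0), …, Φ(t_{n+1}))`. -/
def ofTree : PTree I Unit → HTree I
  | .leaf _ => point
  | .node i ts => beta i fun j => ofTree (ts j)

/-- The planar tree corresponding to a hypertree with given edges at the root. -/
def assemble : ∀ {m : ℕ}, (Fin m → Σ n, I n × (Fin (n + 1) → PTree I Unit)) → PTree I Unit
  | 0, _ => .leaf ()
  | _ + 1, F => .node (F 0).2.1
      (Fin.snoc (α := fun _ => PTree I Unit) (fun j => (F 0).2.2 j.rev) (assemble fun e => F e.succ))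

/-- The inverse of `Φ`. -/
def toTree : HTree I → PTree I Unit
  | mk _ size dec sub => assemble fun e => ⟨size e, dec e, fun j => toTree (sub e j)⟩

theorem ofEdges_edges (s : HTree I) : ofEdges s.edges = s := by
  cases s
  rfl

theorem toTree_cons {m n : ℕ} (i : I n) (f : Fin (n + 1) → HTree I)
    (G : Fin m → Σ n, I n × (Fin (n + 1) → HTree I)) :
    toTree (ofEdges (Fin.cons (α := fun _ => Σ n, I n × (Fin (n + 1) → HTree I)) ⟨n, i, f⟩ G)) =
      .node i (Fin.snoc (α := fun _ => PTree I Unit) (fun j => toTree (f j.rev))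
        (toTree (ofEdges G))) :=
  rfl

theorem toTree_ofTree (t : PTree I Unit) : toTree (ofTree t) = t := by
  induction t with
  | leaf a => rfl
  | node i ts ih =>
    rw [ofTree, beta, toTree_cons, ofEdges_edges]
    congr 1
    funext j
    refine Fin.lastCases ?_ (fun j => ?_) j
    · rw [Fin.snoc_last, ih]
    · rw [Fin.snoc_castSucc, Fin.rev_succ, Fin.rev_rev, ih]

theorem beta_snoc {m n : ℕ} (i : I n) (f : Fin (n + 1) → PTree I Unit) (t : PTree I Unit)
    (G : Fin m → Σ n, I n × (Fin (n + 1) → HTree I)) (h : ofTree t = ofEdges G) :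
    ofTree (.node i (Fin.snoc (α := fun _ => PTree I Unit) f t)) =
      ofEdges (Fin.cons (α := fun _ => Σ n, I n × (Fin (n + 1) → HTree I))
        ⟨n, i, fun j => ofTree (f j.rev)⟩ G) := by
  rw [ofTree, beta, Fin.snoc_last, h]
  simp only [Fin.rev_succ, Fin.snoc_castSucc]
  rfl

theorem ofTree_assemble : ∀ {m : ℕ} (F : Fin m → Σ n, I n × (Fin (n + 1) → PTree I Unit)),
    ofTree (assemble F) = ofEdges fun e => ⟨(F e).1, (F e).2.1, fun j => ofTree ((F e).2.2 j)⟩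
  | 0, F => congrArg ofEdges (funext fun e => e.elim0)
  | m + 1, F => by
    have ih := ofTree_assemble fun e => F e.succ
    rw [assemble, beta_snoc _ _ _ _ ih]
    refine congrArg ofEdges (funext fun e => Fin.cases ?_ (fun e => rfl) e)
    simp only [Fin.cons_zero, Fin.rev_rev]

theorem ofTree_toTree (s : HTree I) : ofTree (toTree s) = s := by
  induction s with
  | mk m size dec sub ih =>
    rw [toTree, ofTree_assemble]
    simp only [ih]
    rfl

/-- `Φ` as a bijection from planar reduced trees to planar rooted hypertrees. -/
def Phi : PTree I Unit ≃ HTree I where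
  toFun := ofTree
  invFun := toTree
  left_inv := toTree_ofTree
  right_inv := ofTree_toTree

end HTree

/-- The planar rooted hypertrees with at least one edge. -/
abbrev HNTree (I : ℕ → Type u) : Type u := {s : HTree I // s ≠ .point}

/-- `Φ` restricted to the trees different from the one-edge tree. -/
def PhiN (I : ℕ → Type u) : NTree I ≃ HNTree I :=
  HTree.Phi.subtypeEquiv fun t => not_congr
    ⟨fun h => by rw [h]; rfl, fun h => HTree.Phi.injective h⟩

/-- The free noncommutative algebra of planar rooted hyperforests, the hypertree with one vertex
being identified with the unit. -/
abbrev HHred (k : Type u) [Field k] (I : ℕ → Type u) : Type u := FreeAlgebra k (HNTree I)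

section Hyper

variable (k : Type u) [Field k] (I : ℕ → Type u)

/-- The algebra isomorphism induced by `Φ`. -/
def PhiAlg : Hred k I ≃ₐ[k] HHred k I :=
  AlgEquiv.ofAlgHom (FreeAlgebra.lift k fun t => FreeAlgebra.ι k (PhiN I t))
    (FreeAlgebra.lift k fun s => FreeAlgebra.ι k ((PhiN I).symm s))
    (by ext s; simp) (by ext t; simp)

/-- The bialgebra structure transported along an algebra isomorphism. -/
abbrev bialgebraTransport {A B : Type u} [Ring A] [Bialgebra k A] [Ring B] [Algebra k B]
    (e : A ≃ₐ[k] B) : Bialgebra k B :=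
  Bialgebra.ofAlgHom
    ((Algebra.TensorProduct.map e.toAlgHom e.toAlgHom).comp
      ((Bialgebra.comulAlgHom k A).comp e.symm.toAlgHom))
    ((Bialgebra.counitAlgHom k A).comp e.symm.toAlgHom)
    (by
      have hA : (Algebra.TensorProduct.assoc k k k A A A).toAlgHom.comp
          ((Algebra.TensorProduct.map (Bialgebra.comulAlgHom k A) (.id k A)).comp
            (Bialgebra.comulAlgHom k A)) =
          (Algebra.TensorProduct.map (.id k A) (Bialgebra.comulAlgHom k A)).comp
            (Bialgebra.comulAlgHom k A) :=
        AlgHom.ext fun a => Coalgebra.coassoc_apply (R := k) a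
      have hn : (Algebra.TensorProduct.assoc k k k B B B).toAlgHom.comp
          (Algebra.TensorProduct.map
            (Algebra.TensorProduct.map e.toAlgHom e.toAlgHom) e.toAlgHom) =
          (Algebra.TensorProduct.map e.toAlgHom
            (Algebra.TensorProduct.map e.toAlgHom e.toAlgHom)).comp
            (Algebra.TensorProduct.assoc k k k A A A).toAlgHom := by
        ext <;> simp [Algebra.TensorProduct.one_def]
      have h1 : (Algebra.TensorProduct.map
          ((Algebra.TensorProduct.map e.toAlgHom e.toAlgHom).comp
            ((Bialgebra.comulAlgHom k A).comp e.symm.toAlgHom)) (.id k B)).comp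
          (Algebra.TensorProduct.map e.toAlgHom e.toAlgHom) =
          (Algebra.TensorProduct.map (Algebra.TensorProduct.map e.toAlgHom e.toAlgHom)
            e.toAlgHom).comp (Algebra.TensorProduct.map (Bialgebra.comulAlgHom k A) (.id k A)) := by
        ext <;> simp
      have h2 : (Algebra.TensorProduct.map (.id k B)
          ((Algebra.TensorProduct.map e.toAlgHom e.toAlgHom).comp
            ((Bialgebra.comulAlgHom k A).comp e.symm.toAlgHom))).comp
          (Algebra.TensorProduct.map e.toAlgHom e.toAlgHom) =
          (Algebra.TensorProduct.map e.toAlgHom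
            (Algebra.TensorProduct.map e.toAlgHom e.toAlgHom)).comp
            (Algebra.TensorProduct.map (.id k A) (Bialgebra.comulAlgHom k A)) := by
        ext <;> simp
      apply AlgHom.ext
      intro b
      have e1 := DFunLike.congr_fun h1 (Coalgebra.comul (R := k) (e.symm b))
      have e2 := DFunLike.congr_fun h2 (Coalgebra.comul (R := k) (e.symm b))
      have e3 := DFunLike.congr_fun hn
        (Algebra.TensorProduct.map (Bialgebra.comulAlgHom k A) (.id k A)
          (Coalgebra.comul (R := k) (e.symm b)))
      have e4 := congrArg (Algebra.TensorProduct.map e.toAlgHom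
        (Algebra.TensorProduct.map e.toAlgHom e.toAlgHom)) (DFunLike.congr_fun hA (e.symm b))
      exact (congrArg (Algebra.TensorProduct.assoc k k k B B B) e1).trans
        (e3.trans (e4.trans e2.symm)))
    (by
      have h1 : (Algebra.TensorProduct.map
          ((Bialgebra.counitAlgHom k A).comp e.symm.toAlgHom) (.id k B)).comp
          (Algebra.TensorProduct.map e.toAlgHom e.toAlgHom) =
          (Algebra.TensorProduct.map (.id k k) e.toAlgHom).comp
            (Algebra.TensorProduct.map (Bialgebra.counitAlgHom k A) (.id k A)) := by
        ext <;> simp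
      apply AlgHom.ext
      intro b
      have e1 := DFunLike.congr_fun h1 (Coalgebra.comul (R := k) (e.symm b))
      have e2 := congrArg (Algebra.TensorProduct.map (.id k k) e.toAlgHom)
        (Coalgebra.rTensor_counit_comul (R := k) (e.symm b))
      refine e1.trans (e2.trans ?_)
      simp)
    (by
      have h1 : (Algebra.TensorProduct.map (.id k B)
          ((Bialgebra.counitAlgHom k A).comp e.symm.toAlgHom)).comp
          (Algebra.TensorProduct.map e.toAlgHom e.toAlgHom) =
          (Algebra.TensorProduct.map e.toAlgHom (.id k k)).comp
            (Algebra.TensorProduct.map (.id k A) (Bialgebra.counitAlgHom k A)) := by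
        ext <;> simp
      apply AlgHom.ext
      intro b
      have e1 := DFunLike.congr_fun h1 (Coalgebra.comul (R := k) (e.symm b))
      have e2 := congrArg (Algebra.TensorProduct.map e.toAlgHom (.id k k))
        (Coalgebra.lTensor_counit_comul (R := k) (e.symm b))
      refine e1.trans (e2.trans ?_)
      simp)

/-- The bialgebra structure of planar rooted hyperforests: the coproduct is
`(Φ ⊗ Φ) ∘ Δ_2 ∘ Φ⁻¹`. -/
instance : Bialgebra k (HHred k I) := bialgebraTransport k (PhiAlg k I)

variable {I}

/-- The product `s_1 ↠ s_2 = Φ(Φ⁻¹(s_1) ↷_σ Φ⁻¹(s_2))` on linear combinations of planar rooted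
hypertrees with at least one edge. -/
def graftHyper : (HNTree I →₀ k) →ₗ[k] (HNTree I →₀ k) →ₗ[k] (HNTree I →₀ k) :=
  ((graftSigma k).compl₁₂ (Finsupp.lmapDomain k k (PhiN I).symm)
    (Finsupp.lmapDomain k k (PhiN I).symm)).compr₂ (Finsupp.lmapDomain k k (PhiN I))

/-- Linear combinations of hypertrees as series with coefficients in the operad of trees. -/
def hyperSeries : (HNTree I →₀ k) →ₗ[k] (treeOperad k I).Series :=
  treeSeries k ∘ₗ Finsupp.lmapDomain k k (PhiN I).symm

end Hyper

/-! ### Undecorated and binary trees -/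

/-- The decorations for which decorated trees are plain planar reduced trees. -/
abbrev plain : ℕ → Type u := fun _ => PUnit

/-- The decorations for which decorated trees are planar binary trees: vertices with two incoming
edges have exactly one possible decoration, and vertices with more incoming edges have none. -/
def binaryDeco : ℕ → Type u
  | 0 => PUnit
  | _ + 1 => PEmpty

end

namespace PTree

variable {I : ℕ → Type u} {A B : Type}

/-- The label of a leaf. -/
def leafLabel : ∀ t : PTree I A, t.Leaf → A
  | leaf a, _ => a
  | node _ ts, ⟨j, l⟩ => (ts j).leafLabel l

theorem relabel_node {n : ℕ} (f : A → B) (i : I n) (ts : Fin (n + 2) → PTree I A) :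
    (node i ts).relabel f = node i fun j => (ts j).relabel f := rfl

theorem relabel_relabel {C : Type} (f : A → B) (g : B → C) (t : PTree I A) :
    (t.relabel f).relabel g = t.relabel (g ∘ f) := by
  simp only [relabel, bind_bind, bind]
  rfl

theorem bind_relabel {C : Type} (f : A → B) (g : B → PTree I C) (t : PTree I A) :
    (t.relabel f).bind g = t.bind (g ∘ f) := by
  simp only [relabel, bind_bind, bind]
  rfl

theorem selfLabel_relabel (t : PTree I A) : t.selfLabel.relabel t.leafLabel = t := by
  induction t with
  | leaf a => rfl
  | node i ts ih =>
    rw [selfLabel, relabel_node]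
    congr 1
    funext j
    exact (relabel_relabel _ _ _).trans (ih j)

/-- The leaves of a relabelled tree. -/
def relabelLeaf (f : A → B) : ∀ t : PTree I A, t.Leaf ≃ (t.relabel f).Leaf
  | leaf _ => Equiv.refl Unit
  | node _ ts => Equiv.sigmaCongrRight fun j => relabelLeaf f (ts j)

theorem leafLabel_relabelLeaf (f : A → B) (t : PTree I A) (l : t.Leaf) :
    (t.relabel f).leafLabel (t.relabelLeaf f l) = f (t.leafLabel l) := by
  induction t with
  | leaf a => rfl
  | node i ts ih => exact ih l.1 l.2

/-- The leaves of a tree obtained by replacing leaves by trees. -/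
def bindLeaf : ∀ (t : PTree I A) (f : A → PTree I B),
    (Σ l : t.Leaf, (f (t.leafLabel l)).Leaf) ≃ (t.bind f).Leaf
  | leaf a, f => Equiv.uniqueSigma fun _ : Unit => (f a).Leaf
  | node _ ts, f =>
    (Equiv.sigmaAssoc fun j (l : (ts j).Leaf) => (f ((ts j).leafLabel l)).Leaf).trans
      (Equiv.sigmaCongrRight fun j => bindLeaf (ts j) f)

theorem leafLabel_bindLeaf (t : PTree I A) (f : A → PTree I B)
    (p : Σ l : t.Leaf, (f (t.leafLabel l)).Leaf) :
    (t.bind f).leafLabel (t.bindLeaf f p) = (f (t.leafLabel p.1)).leafLabel p.2 := by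
  induction t with
  | leaf a => rfl
  | node i ts ih => exact ih p.1.1 ⟨p.1.2, p.2⟩

end PTree

namespace LTree

variable {I : ℕ → Type u} {A B : Type}

theorem leafLabel_bijective (t : LTree I A) : Function.Bijective t.1.leafLabel := by
  have h : t.1.leafList = t.1.selfLabel.leafList.map t.1.leafLabel := by
    rw [← PTree.leafList_relabel, PTree.selfLabel_relabel]
  obtain ⟨h1, h2⟩ := t.2
  rw [h] at h1 h2
  refine ⟨fun a b hab => ?_, fun a => ?_⟩
  · exact List.inj_on_of_nodup_map h1 (t.1.selfLabel_bijective.2 a) (t.1.selfLabel_bijective.2 b) hab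
  · obtain ⟨l, _, hl⟩ := List.mem_map.1 (h2 a)
    exact ⟨l, hl⟩

/-- The bijection from the leaves to the labels. -/
noncomputable def leafEquiv (t : LTree I A) : t.1.Leaf ≃ A :=
  Equiv.ofBijective _ t.leafLabel_bijective

/-- A tree, with leaves labelled by themselves. -/
def self (t : PTree I A) : LTree I t.Leaf := ⟨t.selfLabel, t.selfLabel_bijective⟩

theorem map_self (t : LTree I A) : (self t.1).map t.leafEquiv = t :=
  Subtype.ext t.1.selfLabel_relabel

/-- The tree with a single inner vertex. -/
def corolla {n : ℕ} (i : I n) : LTree I (Fin (n + 2)) :=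
  ⟨.node i .leaf, by
    have h : (PTree.node i (PTree.leaf (A := Fin (n + 2)))).leafList = List.finRange (n + 2) := by
      simp only [PTree.leafList, List.ofFn_eq_map, ← List.flatMap_def, List.flatMap_singleton']
    rw [h]
    exact ⟨List.nodup_finRange _, List.mem_finRange⟩⟩

theorem self_node {n : ℕ} (i : I n) (ts : Fin (n + 2) → PTree I A) :
    self (.node i ts) = (corolla i).graft fun j => self (ts j) := rfl

end LTree

namespace Operad

variable {k : Type u} [Field k] {I : ℕ → Type u} (Q : Operad.{u, u} k)
  (q : ∀ n, I n → Q.obj (Fin (n + 2)))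

/-- The value in an operad of a tree whose vertices are decorated by operations. -/
def evalTree {A : Type} : ∀ t : PTree I A, Q.obj t.Leaf
  | .leaf _ => Q.one
  | .node (n := n) i ts => Q.comp (q n i) fun j => evalTree (ts j)

theorem map_congr {A B : Type} [Finite A] [Finite B] {e f : A ≃ B} (h : ∀ a, e a = f a)
    (x : Q.obj A) : Q.map e x = Q.map f x := by
  rw [Equiv.ext h]

theorem evalTree_relabel {A B : Type} (f : A → B) (t : PTree I A) :
    Q.evalTree q (t.relabel f) = Q.map (t.relabelLeaf f) (Q.evalTree q t) := by
  induction t with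
  | leaf a => exact (Q.map_refl _).symm
  | node i ts ih =>
    refine Eq.trans ?_ (Q.comp_map_right _ _ _)
    exact congrArg (Q.comp (q _ i)) (funext ih)

theorem evalTree_bind {A B : Type} (t : PTree I A) (f : A → PTree I B) :
    Q.evalTree q (t.bind f) = Q.map (t.bindLeaf f)
      (Q.comp (Q.evalTree q t) fun l => Q.evalTree q (f (t.leafLabel l))) := by
  induction t with
  | leaf a => exact (Q.one_comp _).symm
  | node i ts ih =>
    refine Eq.trans ?_ (Q.map_trans _ _ _).symm
    refine Eq.trans ?_ (congrArg _ (Q.assoc (q _ i) (fun j => Q.evalTree q (ts j))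
      fun j l => Q.evalTree q (f ((ts j).leafLabel l))).symm)
    refine Eq.trans ?_ (Q.comp_map_right _ _ _)
    exact congrArg (Q.comp (q _ i)) (funext ih)

/-- The value of a tree with labelled leaves. -/
noncomputable def evalLTree {A : Type} [Finite A] (t : LTree I A) : Q.obj A :=
  Q.map t.leafEquiv (Q.evalTree q t.1)

theorem evalLTree_map {A B : Type} [Finite A] [Finite B] (e : A ≃ B) (t : LTree I A) :
    Q.evalLTree q (t.map e) = Q.map e (Q.evalLTree q t) := by
  unfold evalLTree
  refine (congrArg _ (Q.evalTree_relabel q e t.1)).trans ?_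
  refine (Q.map_trans _ _ _).symm.trans (Eq.trans ?_ (Q.map_trans _ _ _))
  exact Q.map_congr (fun l => t.1.leafLabel_relabelLeaf e l) _

theorem evalLTree_graft {A : Type} {B : A → Type} [Finite A] [∀ a, Finite (B a)] (t : LTree I A)
    (s : ∀ a, LTree I (B a)) :
    Q.evalLTree q (t.graft s) = Q.comp (Q.evalLTree q t) fun a => Q.evalLTree q (s a) := by
  unfold evalLTree
  rw [Q.comp_map_right fun a => (s a).leafEquiv, Q.comp_map_left]
  refine (congrArg _ (Q.evalTree_bind q t.1 _)).trans ?_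
  simp only [evalTree_relabel]
  refine (congrArg (fun x => Q.map (t.graft s).leafEquiv (Q.map _ x)) (Q.comp_map_right
    (fun l : t.1.Leaf => (s (t.leafEquiv l)).1.relabelLeaf (Sigma.mk (t.leafEquiv l)))
    (Q.evalTree q t.1) fun l => Q.evalTree q (s (t.leafEquiv l)).1)).trans ?_
  refine (congrArg _ (Q.map_trans _ _ _).symm).trans ?_
  refine (Q.map_trans _ _ _).symm.trans (Eq.trans ?_ (Q.map_trans _ _ _))
  refine Q.map_congr (fun p => ?_) _
  refine (PTree.leafLabel_bindLeaf _ _ _).trans ?_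
  exact PTree.leafLabel_relabelLeaf _ _ _

theorem evalLTree_one : Q.evalLTree q (LTree.one (I := I)) = Q.one := by
  have h : ∀ e : Unit ≃ Unit, Q.map e Q.one = Q.one := fun e => by
    rw [Subsingleton.elim e (Equiv.refl _), Q.map_refl]
  exact h _

theorem evalLTree_corolla {n : ℕ} (i : I n) : Q.evalLTree q (LTree.corolla i) = q n i := by
  refine Eq.trans ?_ (Q.comp_one (q n i))
  have h : ∀ e : (Σ _ : Fin (n + 2), Unit) ≃ Fin (n + 2), (∀ p, e p = p.1) →
      e = Equiv.sigmaUnique (Fin (n + 2)) fun _ => Unit := fun e he => Equiv.ext he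
  exact congrArg (fun e => Q.map e _) (h _ fun _ => rfl)

/-- The morphism from the operad of trees defined by the images of the corollas. -/
noncomputable def ofTrees : (treeOperad k I).Hom Q where
  app A _ := Finsupp.linearCombination k (Q.evalLTree q : LTree I A → Q.obj A)
  app_map {A B} _ _ e x := by
    refine congrArg (fun F => F x) (?_ : Finsupp.linearCombination k (Q.evalLTree q) ∘ₗ
      Finsupp.lmapDomain k k (LTree.map e) = Q.map e ∘ₗ Finsupp.linearCombination k (Q.evalLTree q))
    refine Finsupp.lhom_ext' fun t => LinearMap.ext_ring ?_
    simp [evalLTree_map]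
  app_one := by
    refine (Finsupp.linearCombination_single k (1 : k) (LTree.one (I := I))).trans ?_
    rw [one_smul, evalLTree_one]
  app_comp {A B} _ _ x y := by
    have key := treeComp_induction k I (B := B)
      ((Finsupp.linearCombination k (Q.evalLTree q)).compMultilinearMapₗ k ∘ₗ treeComp k I)
      (LinearMap.mk ⟨fun x => (Q.comp (Finsupp.linearCombination k (Q.evalLTree q) x)).compLinearMap
        fun a => Finsupp.linearCombination k (Q.evalLTree q), by intros; ext; simp⟩
        (by intros; ext; simp)) ?_
    · exact congrArg (fun F => F x y) key
    intro t s
    change Finsupp.linearCombination k _ (treeComp k I _ _) =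
      Q.comp (Finsupp.linearCombination k _ _) fun a => Finsupp.linearCombination k _ _
    simp [treeComp_single, evalLTree_graft]

theorem ofTrees_single {A : Type} [Finite A] (t : LTree I A) :
    (Q.ofTrees q).app A (Finsupp.single t 1 : LTree I A →₀ k) = Q.evalLTree q t :=
  (Finsupp.linearCombination_single k (1 : k) t).trans (one_smul _ _)

variable {Q q} in
theorem app_single_eq (F : (treeOperad k I).Hom Q)
    (hF : ∀ n (i : I n), F.app (Fin (n + 2)) (Finsupp.single (LTree.corolla i) 1 :
      LTree I (Fin (n + 2)) →₀ k) = q n i) {A : Type} [Finite A] (t : LTree I A) :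
    F.app A (Finsupp.single t 1 : LTree I A →₀ k) = Q.evalLTree q t := by
  have key : ∀ t : PTree I A, F.app t.Leaf
      (Finsupp.single (LTree.self t) 1 : LTree I t.Leaf →₀ k) = Q.evalTree q t := by
    intro t
    induction t with
    | leaf a => exact F.app_one
    | node i ts ih =>
      rw [LTree.self_node]
      refine (congrArg (F.app _) (treeComp_single k I (LTree.corolla i)
        fun j => LTree.self (ts j)).symm).trans ?_
      refine (F.app_comp _ _).trans ?_
      rw [hF]
      exact congrArg (Q.comp (q _ i)) (funext ih)
  have h : (Finsupp.single t 1 : LTree I A →₀ k) = (treeOperad k I).map t.leafEquiv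
      (Finsupp.single (LTree.self t.1) 1 : LTree I t.1.Leaf →₀ k) := by
    refine Eq.trans ?_ (Finsupp.mapDomain_single).symm
    rw [LTree.map_self]
  rw [h]
  refine (F.app_map _ _).trans ?_
  rw [key]
  rfl

theorem Hom.ext_app {P Q : Operad.{u, v} k} {F G : P.Hom Q}
    (h : ∀ (A : Type) [Finite A], F.app A = G.app A) : F = G := by
  cases F
  cases G
  simp only [Hom.mk.injEq]
  funext A _
  exact h A

end Operad

namespace SObject

variable {k : Type u} [Field k] {I : ℕ → Type u}

/-- The operad of trees is free on `V` when `V` is spanned by the orbits of elements which are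
sent to the corollas. -/
theorem isFreeOperad_treeOperad (V : SObject.{u, u} k) (ι : V.Hom (treeOperad k I))
    (b : ∀ n, I n → V.obj n)
    (hb : ∀ n i, ι.app n (b n i) = (Finsupp.single (LTree.corolla i) 1 :
      LTree I (Fin (n + 2)) →₀ k))
    (hspan : ∀ n, Submodule.span k (Set.range fun p : Equiv.Perm (Fin (n + 2)) × I n =>
      V.rep n p.1 (b n p.2)) = ⊤) :
    V.IsFreeOperad (treeOperad k I) := by
  refine ⟨ι, fun Q f => ⟨Q.ofTrees fun n i => f.app n (b n i), ?_, ?_⟩⟩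
  · intro n x
    have h : (Q.ofTrees fun n i => f.app n (b n i)).app (Fin (n + 2)) ∘ₗ ι.app n = f.app n := by
      refine LinearMap.ext_on (hspan n) ?_
      rintro _ ⟨⟨σ, i⟩, rfl⟩
      change (Q.ofTrees fun n i => f.app n (b n i)).app (Fin (n + 2)) (ι.app n _) = _
      rw [ι.app_rep, f.app_rep, Operad.Hom.app_map, hb, Operad.ofTrees_single,
        Operad.evalLTree_corolla]
    exact LinearMap.congr_fun h x
  · intro F hF
    refine Operad.Hom.ext_app fun A _ => ?_
    refine Finsupp.lhom_ext' fun t => LinearMap.ext_ring ?_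
    change F.app A (Finsupp.single t 1 : LTree I A →₀ k) =
      (Q.ofTrees fun n i => f.app n (b n i)).app A (Finsupp.single t 1 : LTree I A →₀ k)
    rw [Operad.ofTrees_single]
    refine Operad.app_single_eq F (fun n i => ?_) t
    rw [← hb, hF]

/-- The linear map sending a permutation `σ` to the corolla with leaves labelled by `σ`. -/
noncomputable def corollaMap {n : ℕ} (i : I n) :
    k[Equiv.Perm (Fin (n + 2))] →ₗ[k] (LTree I (Fin (n + 2)) →₀ k) :=
  Finsupp.linearCombination k (fun σ => Finsupp.single ((LTree.corolla i).map σ) 1) ∘ₗ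
    (MonoidAlgebra.coeffLinearEquiv k).toLinearMap

theorem corollaMap_single {n : ℕ} (i : I n) (σ : Equiv.Perm (Fin (n + 2))) :
    corollaMap (k := k) i (MonoidAlgebra.single σ 1) =
      Finsupp.single ((LTree.corolla i).map σ) 1 := by
  simp [corollaMap]

theorem corollaMap_rep {n : ℕ} (i : I n) (σ : Equiv.Perm (Fin (n + 2)))
    (x : k[Equiv.Perm (Fin (n + 2))]) :
    corollaMap i (Representation.leftRegular k _ σ x) =
      Finsupp.lmapDomain k k (LTree.map σ) (corollaMap i x) := by
  refine LinearMap.congr_fun (f := corollaMap i ∘ₗ Representation.leftRegular k _ σ)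
    (g := Finsupp.lmapDomain k k (LTree.map σ) ∘ₗ corollaMap i) ?_ x
  ext τ : 1
  refine LinearMap.ext_ring ?_
  simp [corollaMap_single, ← LTree.map_trans]
  rfl

theorem span_rep_single {G : Type*} [Group G] :
    Submodule.span k (Set.range fun g : G =>
      Representation.leftRegular k G g (MonoidAlgebra.single 1 1)) = ⊤ := by
  rw [eq_top_iff]
  rintro x -
  induction x using MonoidAlgebra.induction_linear with
  | zero => exact zero_mem _
  | add x y hx hy => exact add_mem hx hy
  | single g c =>
    have h : MonoidAlgebra.single g c =
        c • Representation.leftRegular k G g (MonoidAlgebra.single 1 1) := by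
      simp
    rw [h]
    exact Submodule.smul_mem _ _ (Submodule.subset_span ⟨g, rfl⟩)

theorem span_tprod_single {G : Type*} [Group G] {X : Type*} :
    Submodule.span k (Set.range fun p : G × X =>
      (Representation.trivial k G (X →₀ k)).tprod (Representation.leftRegular k G) p.1
        (Finsupp.single p.2 1 ⊗ₜ[k] MonoidAlgebra.single 1 1)) = ⊤ := by
  rw [eq_top_iff]
  rintro x -
  induction x using TensorProduct.induction_on with
  | zero => exact zero_mem _
  | add x y hx hy => exact add_mem hx hy
  | tmul x y =>
    induction x using Finsupp.induction_linear with
    | zero => rw [TensorProduct.zero_tmul]; exact zero_mem _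
    | add x x' hx hx' => rw [TensorProduct.add_tmul]; exact add_mem hx hx'
    | single i c =>
      have hy : y ∈ Submodule.span k (Set.range fun g : G =>
          Representation.leftRegular k G g (MonoidAlgebra.single 1 1)) := by
        rw [span_rep_single]
        exact Submodule.mem_top
      induction hy using Submodule.span_induction with
      | zero => rw [TensorProduct.tmul_zero]; exact zero_mem _
      | add y y' _ _ hy hy' => rw [TensorProduct.tmul_add]; exact add_mem hy hy'
      | smul a y _ hy => rw [TensorProduct.tmul_smul]; exact Submodule.smul_mem _ _ hy
      | mem y hy =>
        obtain ⟨σ, rfl⟩ := hy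
        have h : Finsupp.single i c ⊗ₜ[k]
            (Representation.leftRegular k _ σ (MonoidAlgebra.single 1 1)) =
            c • (Representation.trivial k G (X →₀ k)).tprod (Representation.leftRegular k G) σ
              (Finsupp.single i 1 ⊗ₜ MonoidAlgebra.single 1 1) := by
          simp [TensorProduct.smul_tmul']
        rw [h]
        exact Submodule.smul_mem _ _ (Submodule.subset_span ⟨⟨σ, i⟩, rfl⟩)

theorem regular_isFreeOperad : (regular k).IsFreeOperad (treeOperad k plain) := by
  refine isFreeOperad_treeOperad _
    ⟨fun n => corollaMap (I := plain) PUnit.unit, fun n σ x => corollaMap_rep _ σ x⟩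
    (fun n _ => MonoidAlgebra.single 1 1) (fun n i => ?_) fun n => ?_
  · refine (corollaMap_single _ _).trans ?_
    exact congrArg (fun t => Finsupp.single t (1 : k)) (LTree.map_refl _)
  · refine eq_top_mono (Submodule.span_mono ?_) (span_rep_single (k := k))
    rintro _ ⟨σ, rfl⟩
    exact ⟨⟨σ, PUnit.unit⟩, rfl⟩

theorem decorated_isFreeOperad : (decorated k I).IsFreeOperad (treeOperad k I) := by
  refine isFreeOperad_treeOperad _
    ⟨fun n => TensorProduct.lift (Finsupp.linearCombination k fun i : I n => corollaMap i),
      fun n σ x => ?_⟩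
    (fun n i => Finsupp.single i 1 ⊗ₜ MonoidAlgebra.single 1 1) (fun n i => ?_) fun n => ?_
  · refine LinearMap.congr_fun
      (f := TensorProduct.lift (Finsupp.linearCombination k fun i : I n => corollaMap i) ∘ₗ
        ((Representation.trivial k _ _).tprod (Representation.leftRegular k _)) σ)
      (g := Finsupp.lmapDomain k k (LTree.map σ) ∘ₗ
        TensorProduct.lift (Finsupp.linearCombination k fun i : I n => corollaMap i)) ?_ x
    refine TensorProduct.ext ?_
    refine Finsupp.lhom_ext' fun i => LinearMap.ext_ring (LinearMap.ext fun y => ?_)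
    simpa using corollaMap_rep i σ y
  · refine (TensorProduct.lift.tmul _ _).trans ?_
    refine (LinearMap.congr_fun (Finsupp.linearCombination_single k (1 : k) i) _).trans ?_
    refine (congrArg (fun f : _ →ₗ[k] _ => f _) (one_smul k (corollaMap i))).trans ?_
    refine (corollaMap_single _ _).trans ?_
    exact congrArg (fun t => Finsupp.single t (1 : k)) (LTree.map_refl _)
  · exact span_tprod_single

/-- The inclusion of `W` in the operad of binary trees. -/
noncomputable def binaryMap (k : Type u) [Field k] : ∀ n, (binary k).obj n →ₗ[k]
    (LTree binaryDeco.{u} (Fin (n + 2)) →₀ k)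
  | 0 => corollaMap (I := binaryDeco) (n := 0) PUnit.unit ∘ₗ Submodule.subtype _
  | _ + 1 => 0

theorem binary_isFreeOperad : (binary k).IsFreeOperad (treeOperad k binaryDeco) := by
  refine isFreeOperad_treeOperad _ ⟨binaryMap k, fun n σ x => ?_⟩
    (fun n => match n with
      | 0 => fun _ => ⟨MonoidAlgebra.single 1 1, Submodule.mem_top⟩
      | _ + 1 => PEmpty.elim) (fun n i => ?_) fun n => ?_
  · match n with
    | 0 => exact corollaMap_rep _ σ x.1
    | n + 1 => exact (map_zero ((treeOperad k binaryDeco).map σ)).symm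
  · match n with
    | 0 =>
      refine (corollaMap_single _ _).trans ?_
      exact congrArg (fun t => Finsupp.single t (1 : k)) (LTree.map_refl _)
    | n + 1 => exact i.elim
  · rw [eq_top_iff]
    rintro ⟨x, hx⟩ -
    match n with
    | 0 =>
      have hx' : x ∈ Submodule.span k (Set.range fun g : Equiv.Perm (Fin 2) =>
          Representation.leftRegular k _ g (MonoidAlgebra.single 1 1)) := by
        rw [span_rep_single]
        exact Submodule.mem_top
      induction hx' using Submodule.span_induction with
      | zero => exact zero_mem _
      | add y y' _ _ hy hy' => exact add_mem (hy Submodule.mem_top) (hy' Submodule.mem_top)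
      | smul a y _ hy => exact Submodule.smul_mem _ a (hy Submodule.mem_top)
      | mem y hy =>
        obtain ⟨σ, rfl⟩ := hy
        exact Submodule.subset_span ⟨⟨σ, PUnit.unit⟩, rfl⟩
    | n + 1 =>
      have h0 : x = 0 := hx
      subst h0
      exact zero_mem _

end SObject

theorem PTree.nonempty_leaf {I : ℕ → Type u} {A : Type} (t : PTree I A) : Nonempty t.Leaf := by
  induction t with
  | leaf a => exact ⟨()⟩
  | node i ts ih => exact ⟨⟨0, (ih 0).some⟩⟩

theorem PTree.eq_leaf_of_subsingleton {I : ℕ → Type u} {A : Type} (t : PTree I A)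
    [h : Subsingleton t.Leaf] : ∃ a, t = .leaf a := by
  cases t with
  | leaf a => exact ⟨a, rfl⟩
  | node i ts =>
    have h01 := congrArg Sigma.fst (@Subsingleton.elim _ h
      ⟨0, (ts 0).nonempty_leaf.some⟩ ⟨1, (ts 1).nonempty_leaf.some⟩)
    exact absurd h01 (by simp)

theorem LTree.eq_one {I : ℕ → Type u} (t : LTree I Unit) : t = LTree.one := by
  have : Subsingleton t.1.Leaf := t.leafEquiv.injective.subsingleton
  obtain ⟨a, ha⟩ := t.1.eq_leaf_of_subsingleton
  exact Subtype.ext ha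

theorem treeOperad_isAugmented (k : Type u) [Field k] (I : ℕ → Type u) :
    (treeOperad k I).IsAugmented := by
  refine ⟨fun A _ _ => ?_, ?_, fun x => ?_⟩
  · have : IsEmpty (LTree I A) := ⟨fun t => isEmptyElim (t.leafEquiv t.1.nonempty_leaf.some)⟩
    exact inferInstanceAs (Subsingleton (LTree I A →₀ k))
  · exact (Finsupp.single_ne_zero (a := LTree.one (I := I)) (b := (1 : k))).2 one_ne_zero
  · have h : ∀ x : LTree I Unit →₀ k, x = x LTree.one • Finsupp.single LTree.one 1 := fun x =>
      Finsupp.ext fun t => by simp [t.eq_one]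
    exact ⟨_, h x⟩

namespace PTree

variable {I : ℕ → Type u}

/-! ### Automorphisms of planar trees -/

theorem not_isChild_rootVtx {t : PTree I Unit} {m : ℕ} {p q : t.Vtx} (h : t.IsChild m p q) :
    q ≠ t.rootVtx := by
  intro e
  cases h with
  | root i ts j => exact Option.some_ne_none _ e
  | branch i ts j m p q h => exact Option.some_ne_none _ e

theorem vtx_induction {t : PTree I Unit} {P : t.Vtx → Prop} (h0 : P t.rootVtx)
    (h1 : ∀ m p q, t.IsChild m p q → P p → P q) (p : t.Vtx) : P p := by
  induction t with
  | leaf a => exact h0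
  | node i ts ih =>
    match p with
    | none => exact h0
    | some ⟨j, p⟩ =>
      exact ih j (P := fun p => P (some ⟨j, p⟩)) (h1 _ _ _ (.root i ts j) h0)
        (fun m p q h => h1 _ _ _ (.branch i ts j m p q h)) p

theorem isChild_unique {t : PTree I Unit} {m : ℕ} {p q q' : t.Vtx} (h : t.IsChild m p q)
    (h' : t.IsChild m p q') : q = q' := by
  induction h with
  | root i ts j =>
    have key : ∀ m' p', IsChild (node i ts) m' p' q' → m' = j → p' = none →
        q' = some ⟨j, (ts j).rootVtx⟩ := by
      intro m' p' h hm hp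
      cases h with
      | root _ _ j' =>
        obtain rfl := Fin.ext hm
        rfl
      | branch => exact absurd hp (Option.some_ne_none _)
    exact (key _ _ h' rfl rfl).symm
  | branch i ts j m p q h ih =>
    have key : ∀ p', IsChild (node i ts) m p' q' → p' = some ⟨j, p⟩ →
        some ⟨j, q⟩ = q' := by
      intro p' h hp
      cases h with
      | root => exact absurd hp.symm (Option.some_ne_none _)
      | branch _ _ j' _ p' q' hc =>
        obtain ⟨rfl, hp⟩ := Sigma.mk.inj (Option.some.inj hp)
        obtain rfl := eq_of_heq hp
        exact congrArg (fun q => some (Sigma.mk (β := fun j => (ts j).Vtx) _ q)) (ih hc)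
    exact key _ h' rfl

/-- A planar tree has no nontrivial automorphism. -/
theorem sigma_eq_one (t : PTree I Unit) : t.sigma = 1 := by
  rw [sigma, Nat.card_eq_one_iff_unique]
  refine ⟨⟨fun f g => ?_⟩, ⟨⟨1, fun _ _ _ => Iff.rfl, fun _ => rfl⟩⟩⟩
  have key : ∀ f : Equiv.Perm t.Vtx, (∀ m p q, t.IsChild m (f p) (f q) ↔ t.IsChild m p q) →
      ∀ p, f p = p := by
    intro f hf
    have h0 : f t.rootVtx = t.rootVtx := by
      have h : ∀ q, q = t.rootVtx ∨ ∃ m p, t.IsChild m p q :=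
        vtx_induction (Or.inl rfl) fun m p q h _ => Or.inr ⟨m, p, h⟩
      refine (h (f t.rootVtx)).resolve_right ?_
      rintro ⟨m, p, h⟩
      rw [← f.apply_symm_apply p, hf] at h
      exact not_isChild_rootVtx h rfl
    refine vtx_induction h0 fun m p q h hp => ?_
    have h' := (hf m p q).2 h
    rw [hp] at h'
    exact isChild_unique h' h
  exact Subtype.ext (Equiv.ext fun p => (key _ f.2.1 p).trans (key _ g.2.1 p).symm)

/-! ### Cuts -/

/-- The empty cut. -/
def emptyCut : ∀ t : PTree I Unit, t.Cut
  | leaf _ => ()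
  | node _ ts => some fun j => (ts j).emptyCut

theorem prune_eq_nil_iff (t : PTree I Unit) (c : t.Cut) : t.prune c = [] ↔ c = t.emptyCut := by
  induction t with
  | leaf a => exact ⟨fun _ => rfl, fun _ => rfl⟩
  | node i ts ih =>
    match c with
    | none => exact ⟨fun h => absurd h (List.cons_ne_nil _ _), fun h => absurd h.symm
        (Option.some_ne_none _)⟩
    | some c =>
      refine Iff.trans ?_ (Option.some_inj (a := c) (b := fun j => (ts j).emptyCut)).symm
      rw [prune, List.flatten_eq_nil_iff, funext_iff]
      simp only [List.mem_ofFn, forall_exists_index, forall_apply_eq_imp_iff, ih]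

theorem trunk_emptyCut (t : PTree I Unit) : t.trunk t.emptyCut = t := by
  induction t with
  | leaf a => rfl
  | node i ts ih => exact congrArg (node i) (funext ih)

theorem ne_leaf_of_mem_prune {t : PTree I Unit} {c : t.Cut} {s : PTree I Unit}
    (h : s ∈ t.prune c) : s ≠ leaf () := by
  induction t with
  | leaf a => exact absurd h List.not_mem_nil
  | node i ts ih =>
    match c with
    | none =>
      obtain rfl := List.mem_singleton.1 h
      exact nofun
    | some c =>
      obtain ⟨l, hl, hs⟩ := List.mem_flatten.1 h
      obtain ⟨j, rfl⟩ := (List.mem_ofFn' _ _).1 hl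
      exact ih j hs

theorem node_inj {n : ℕ} {i : I n} {ts ts' : Fin (n + 2) → PTree I Unit} :
    node i ts = node i ts' ↔ ts = ts' := by
  simp

end PTree

section ListSum

variable {α : Type*} {R : Type*} [CommSemiring R]

/-- `∑_j g(a_j) ∏_{j' ≠ j} e(a_{j'})` for a list `(a_j)_j`. -/
def List.derivProd (e g : α → R) : List α → R
  | [] => 0
  | a :: l => g a * (l.map e).prod + e a * List.derivProd e g l

theorem List.derivProd_append (e g : α → R) (l l' : List α) :
    (l ++ l').derivProd e g = l.derivProd e g * (l'.map e).prod +
      (l.map e).prod * l'.derivProd e g := by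
  induction l with
  | nil => simp [derivProd]
  | cons a l ih =>
    simp only [List.cons_append, derivProd, ih, List.map_append, List.prod_append,
      List.map_cons, List.prod_cons]
    ring

theorem List.derivProd_flatten (e g : α → R) (L : List (List α)) :
    L.flatten.derivProd e g =
      L.derivProd (fun l => (l.map e).prod) (fun l => l.derivProd e g) := by
  induction L with
  | nil => rfl
  | cons l L ih => simp [derivProd, List.derivProd_append, ih, List.map_flatten, List.prod_flatten,
      Function.comp_def]

theorem List.derivProd_map {β : Type*} (e g : α → R) (f : β → α) (l : List β) :
    (l.map f).derivProd e g = l.derivProd (e ∘ f) (g ∘ f) := by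
  induction l with
  | nil => rfl
  | cons a l ih => simp [derivProd, ih]

theorem List.derivProd_eq_sum [DecidableEq α] (e g : α → R) (l : List α) (hl : l.Nodup) :
    l.derivProd e g = (l.map fun a => (l.map fun b => if b = a then g b else e b).prod).sum := by
  induction l with
  | nil => rfl
  | cons a l ih =>
    obtain ⟨ha, hl⟩ := List.nodup_cons.1 hl
    rw [derivProd, ih hl, List.map_cons, List.sum_cons, List.map_cons, List.prod_cons, if_pos rfl,
      ← List.sum_map_mul_left]
    refine congrArg₂ (· + ·) (congrArg (g a * ·) (congrArg List.prod
      (List.map_congr_left fun b hb => (if_neg ?_).symm)))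
      (congrArg List.sum (List.map_congr_left fun b hb => ?_))
    · rintro rfl
      exact ha hb
    · rw [List.map_cons, List.prod_cons, if_neg]
      rintro rfl
      exact ha hb

theorem List.derivProd_univ {β : Type*} [Fintype β] [DecidableEq β] (e g : β → R) (l : List β)
    (hl : l.Nodup) (hl' : ∀ b, b ∈ l) :
    l.derivProd e g = ∑ a, ∏ b, if b = a then g b else e b := by
  have h : ∀ f : β → R, (l.map f).sum = ∑ a, f a := fun f => by
    rw [← List.sum_toFinset f hl]
    exact Finset.sum_congr (Finset.eq_univ_iff_forall.2 fun b => List.mem_toFinset.2 (hl' b))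
      fun _ _ => rfl
  have h' : ∀ f : β → R, (l.map f).prod = ∏ a, f a := fun f => by
    rw [← List.prod_toFinset f hl]
    exact Finset.prod_congr (Finset.eq_univ_iff_forall.2 fun b => List.mem_toFinset.2 (hl' b))
      fun _ _ => rfl
  rw [List.derivProd_eq_sum e g l hl, h]
  exact Finset.sum_congr rfl fun a _ => h' _

theorem List.derivProd_ofFn {n : ℕ} (e g : α → R) (f : Fin n → α) :
    (List.ofFn f).derivProd e g = ∑ j, ∏ j', if j' = j then g (f j') else e (f j') := by
  rw [List.ofFn_eq_map, List.derivProd_map,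
    List.derivProd_univ _ _ _ (List.nodup_finRange n) List.mem_finRange]
  rfl

open Classical in
theorem List.ite_flatten_eq_singleton {n : ℕ} (L : Fin n → List α) (t : α) :
    (if (List.ofFn L).flatten = [t] then (1 : R) else 0) = ∑ j, ∏ j', if j' = j then
      if L j' = [t] then 1 else 0 else if L j' = [] then 1 else 0 := by
  have h1 : ∀ l : List α, l.derivProd (fun _ => (0 : R)) (fun a => if a = t then 1 else 0) =
      if l = [t] then 1 else 0 := by
    intro l
    match l with
    | [] => simp [derivProd]
    | [a] => simp [derivProd]
    | a :: b :: l => simp [derivProd]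
  have h0 : ∀ l : List α, (l.map fun _ => (0 : R)).prod = if l = [] then 1 else 0 := by
    intro l
    cases l <;> simp
  rw [← h1, List.derivProd_flatten, List.derivProd_ofFn]
  simp only [h0, h1]

end ListSum

namespace PTree

variable {I : ℕ → Type u} (R : Type u) [CommSemiring R]

open Classical in
theorem sum_cut_empty (v u : PTree I Unit) :
    ∑ c : v.Cut, (if v.prune c = [] then if v.trunk c = u then (1 : R) else 0 else 0) =
      if u = v then 1 else 0 := by
  rw [Finset.sum_eq_single v.emptyCut]
  · rw [if_pos ((prune_eq_nil_iff _ _).2 rfl), trunk_emptyCut]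
    simp only [eq_comm]
  · exact fun c _ hc => if_neg fun h => hc ((prune_eq_nil_iff _ _).1 h)
  · exact fun h => absurd (Finset.mem_univ _) h

open Classical in
/-- The number of elementary cuts of `v` with pruning `t` and trunk `u` is the number of leaves of
`u` where the grafting of `t` gives `v`. -/
theorem sum_cut_eq_sum_leaf {t : PTree I Unit} (ht : t ≠ .leaf ()) (u v : PTree I Unit) :
    ∑ c : v.Cut, (if v.prune c = [t] then if v.trunk c = u then (1 : R) else 0 else 0) =
      ∑ l : u.Leaf, if u.graftAt l t = v then (1 : R) else 0 := by
  induction v generalizing u with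
  | leaf a =>
    rw [Finset.sum_eq_zero, Finset.sum_eq_zero]
    · intro l _
      refine if_neg ?_
      cases u with
      | leaf b => exact ht
      | node i us => exact nofun
    · exact fun c _ => if_neg (List.cons_ne_nil _ _).symm
  | node i vs ih =>
    have hsum := sum_cut_node i vs fun c => if (node i vs).prune c = [t] then
      if (node i vs).trunk c = u then (1 : R) else 0 else 0
    refine hsum.trans ?_
    cases u with
    | leaf b =>
      rw [Finset.sum_eq_zero fun c _ => ?_, add_zero]
      · refine Eq.trans ?_ (Fintype.sum_unique (ι := Unit) _).symm
        simp only [prune, trunk, graftAt, List.cons.injEq, and_true, eq_comm (a := t), if_true]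
      · rw [if_neg (show ¬ (node i vs).trunk (some c) = leaf b from nofun), ite_self]
    | node i' us =>
      rw [if_neg (show ¬ (node i vs).trunk none = node i' us from nofun), ite_self, zero_add]
      refine Eq.trans ?_ (Fintype.sum_sigma (ι := Fin _) (α := fun j => (us j).Leaf) _).symm
      by_cases hi : ∃ us', node i' us = node i us'
      · obtain ⟨us', hu⟩ := hi
        obtain ⟨rfl, hu⟩ := node.inj hu
        obtain ⟨rfl, rfl⟩ := by simpa using hu
        have h1 : ∀ c : ∀ j, (vs j).Cut, (if (node i' vs).prune (some c) = [t] then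
            if (node i' vs).trunk (some c) = node i' us then (1 : R) else 0 else 0) =
            ∑ j, ∏ j', if j' = j then
              if (vs j').prune (c j') = [t] then
                if (vs j').trunk (c j') = us j' then (1 : R) else 0 else 0
              else if (vs j').prune (c j') = [] then
                if (vs j').trunk (c j') = us j' then (1 : R) else 0 else 0 := by
          intro c
          have h := List.ite_flatten_eq_singleton (R := R) (fun j => (vs j).prune (c j)) t
          have h' : (if (node i' vs).trunk (some c) = node i' us then (1 : R) else 0) =
              ∏ j, if (vs j).trunk (c j) = us j then 1 else 0 := by
            rw [Finset.prod_ite_zero]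
            simp [trunk, funext_iff]
          have h2 : ∀ (p : Prop) [Decidable p] (x : R),
              (if p then x else 0) = (if p then 1 else 0) * x := by
            simp
          refine (h2 _ _).trans ?_
          refine (congrArg₂ (· * ·) h h').trans ?_
          rw [Finset.sum_mul]
          refine Finset.sum_congr rfl fun j _ => ?_
          rw [← Finset.prod_mul_distrib]
          refine Finset.prod_congr rfl fun j' _ => ?_
          split_ifs <;> simp
        rw [Finset.sum_congr rfl fun c _ => h1 c, Finset.sum_comm]
        refine Finset.sum_congr rfl fun j _ => ?_
        have h2 := Fintype.prod_sum (κ := fun j => (vs j).Cut) fun j' (c : (vs j').Cut) =>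
          if j' = j then
            if (vs j').prune c = [t] then if (vs j').trunk c = us j' then (1 : R) else 0 else 0
          else if (vs j').prune c = [] then if (vs j').trunk c = us j' then (1 : R) else 0 else 0
        refine h2.symm.trans ?_
        rw [← Finset.mul_prod_erase _ _ (Finset.mem_univ j)]
        have hB : ∀ j' ∈ Finset.univ.erase j, (∑ c : (vs j').Cut, if j' = j then
            if (vs j').prune c = [t] then if (vs j').trunk c = us j' then (1 : R) else 0 else 0
            else if (vs j').prune c = [] then if (vs j').trunk c = us j' then (1 : R) else 0 else 0)
            = if us j' = vs j' then 1 else 0 := fun j' hj' => by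
          simp only [if_neg (Finset.ne_of_mem_erase hj'), sum_cut_empty]
        rw [Finset.prod_congr rfl hB, Finset.prod_ite_zero, Finset.prod_const_one]
        simp only [if_true]
        rw [ih j, Finset.sum_mul]
        refine Finset.sum_congr rfl fun l _ => ?_
        have h3 : graftAt (node i' us) ⟨j, l⟩ t = node i' vs ↔
            (us j).graftAt l t = vs j ∧ ∀ j' ∈ Finset.univ.erase j, us j' = vs j' := by
          simp [graftAt, Function.update_eq_iff]
        by_cases hP : (us j).graftAt l t = vs j
        · by_cases hQ : ∀ j' ∈ Finset.univ.erase j, us j' = vs j'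
          · rw [if_pos hP, if_pos hQ, mul_one]
            exact (if_pos (h3.2 ⟨hP, hQ⟩)).symm
          · rw [if_neg hQ, mul_zero]
            exact (if_neg fun h => hQ (h3.1 h).2).symm
        · rw [if_neg hP, zero_mul]
          exact (if_neg fun h => hP (h3.1 h).1).symm
      · rw [Finset.sum_eq_zero, Finset.sum_eq_zero]
        · intro j _
          refine Finset.sum_eq_zero fun l _ => if_neg fun h => hi ?_
          obtain ⟨rfl, h⟩ := node.inj h
          obtain ⟨rfl, -⟩ := by simpa using h
          exact ⟨_, rfl⟩
        · intro c _
          rw [if_neg (c := (node i vs).trunk (some c) = node i' us) fun h => hi ⟨_, h.symm⟩, ite_self]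

end PTree

section Grafting

variable (k : Type u) [Field k] {I : ℕ → Type u}

theorem PTree.numCuts_eq {t : PTree I Unit} (ht : t ≠ .leaf ()) (u v : PTree I Unit) :
    PTree.numCuts t u v = Nat.card {l : u.Leaf // u.graftAt l t = v} := by
  classical
  have h := PTree.sum_cut_eq_sum_leaf (ULift.{u} ℕ) ht u v
  have h1 : ∀ (κ : Type) [Fintype κ] (P : κ → Prop) [DecidablePred P],
      (∑ c, if P c then (1 : ULift.{u} ℕ) else 0) = ULift.up (Nat.card {c // P c}) := by
    intro κ _ P _
    rw [Finset.sum_boole, Nat.card_eq_fintype_card, Fintype.card_subtype]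
    rfl
  simp only [← ite_and, h1] at h
  exact congrArg ULift.down h

theorem graftCoeff_eq (t : NTree I) (u v : PTree I Unit) :
    graftCoeff k t.1 u v = Nat.card {l : u.Leaf // u.graftAt l t.1 = v} := by
  simp [graftCoeff, PTree.sigma_eq_one, PTree.numCuts_eq t.2]

theorem PTree.graftAt_ne_leaf {t u : PTree I Unit} (hu : u ≠ .leaf ()) (l : u.Leaf) :
    u.graftAt l t ≠ .leaf () := by
  cases u with
  | leaf a => exact absurd rfl hu
  | node i us => exact nofun

/-- Grafting of trees different from the one-edge tree. -/
def NTree.graftAt (u : NTree I) (l : u.1.Leaf) (t : NTree I) : NTree I :=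
  ⟨u.1.graftAt l t.1, PTree.graftAt_ne_leaf u.2 l⟩

theorem finsum_single_card {X L : Type*} [Fintype L] (g : L → X) :
    ∑ᶠ v, Finsupp.single v (Nat.card {l // g l = v} : k) = ∑ l, Finsupp.single (g l) (1 : k) := by
  classical
  rw [finsum_eq_sum_of_support_subset (s := Finset.univ.image g),
    Finset.sum_comp (fun v => Finsupp.single v (1 : k)) g]
  · refine Finset.sum_congr rfl fun v _ => ?_
    rw [Nat.card_eq_fintype_card, Fintype.card_subtype, Finsupp.smul_single, nsmul_one]
  · intro v hv
    rw [Function.mem_support, Finsupp.single_ne_zero] at hv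
    have h0 : Nat.card {l // g l = v} ≠ 0 := fun h => hv (by rw [h, Nat.cast_zero])
    obtain ⟨⟨l, hl⟩, -⟩ := Nat.card_ne_zero.1 h0
    exact Finset.mem_coe.2 (Finset.mem_image.2 ⟨l, Finset.mem_univ l, hl⟩)

theorem graftSigma_single (t u : NTree I) :
    graftSigma k (Finsupp.single t 1) (Finsupp.single u 1) =
      ∑ l : u.1.Leaf, Finsupp.single (u.graftAt l t) 1 := by
  rw [graftSigma, Finsupp.linearCombination_single, one_smul, Finsupp.linearCombination_single,
    one_smul, ← finsum_single_card]
  simp only [graftCoeff_eq, NTree.graftAt, Subtype.ext_iff]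

theorem graftAll_single (t u : PTree I Unit) :
    graftAll k (Finsupp.single t 1) (Finsupp.single u 1) =
      ∑ l : u.Leaf, Finsupp.single (u.graftAt l t) 1 := by
  rw [graftAll, Finsupp.linearCombination_single, one_smul, Finsupp.linearCombination_single,
    one_smul]

theorem graftSigma_eq_graftAll (x y : NTree I →₀ k) :
    Finsupp.lmapDomain k k Subtype.val (graftSigma k x y) =
      graftAll k (Finsupp.lmapDomain k k Subtype.val x)
        (Finsupp.lmapDomain k k Subtype.val y) := by
  refine LinearMap.congr_fun₂ (f := (graftSigma k).compr₂ (Finsupp.lmapDomain k k Subtype.val))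
    (g := (graftAll k).compl₁₂ (Finsupp.lmapDomain k k Subtype.val)
      (Finsupp.lmapDomain k k Subtype.val)) ?_ x y
  refine Finsupp.lhom_ext' fun t => LinearMap.ext_ring ?_
  refine Finsupp.lhom_ext' fun u => LinearMap.ext_ring ?_
  simp [graftSigma_single, graftAll_single, NTree.graftAt]

/-- `⋁_i` on linear combinations of trees. -/
noncomputable def nodeMap {n : ℕ} (i : I n) :
    MultilinearMap k (fun _ : Fin (n + 2) => PTree I Unit →₀ k) (PTree I Unit →₀ k) :=
  (Finsupp.lmapDomain k k (PTree.node i)).compMultilinearMap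
    (finsuppTensor k fun _ => PTree I Unit)

theorem nodeMap_single {n : ℕ} (i : I n) (ts : Fin (n + 2) → PTree I Unit) :
    nodeMap k i (fun j => Finsupp.single (ts j) 1) = Finsupp.single (.node i ts) 1 := by
  simp [nodeMap, finsuppTensor_single]

theorem graftAll_leaf (x : PTree I Unit →₀ k) (a : Unit) :
    graftAll k x (Finsupp.single (.leaf a) 1) = x := by
  refine LinearMap.congr_fun (f := (graftAll k).flip (Finsupp.single (.leaf a) 1))
    (g := LinearMap.id) ?_ x
  refine Finsupp.lhom_ext' fun t => LinearMap.ext_ring ?_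
  refine (graftAll_single k t (.leaf a)).trans ?_
  exact Fintype.sum_unique (ι := Unit) _

theorem graftAll_nodeMap {n : ℕ} (i : I n) (x : PTree I Unit →₀ k)
    (w : Fin (n + 2) → (PTree I Unit →₀ k)) :
    graftAll k x (nodeMap k i w) =
      ∑ j, nodeMap k i (Function.update w j (graftAll k x (w j))) := by
  have h1 : ∀ (t : PTree I Unit) (ts : Fin (n + 2) → PTree I Unit),
      graftAll k (Finsupp.single t 1) (Finsupp.single (.node i ts) 1) =
      ∑ j, nodeMap k i (Function.update (fun j => Finsupp.single (ts j) 1) j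
        (graftAll k (Finsupp.single t 1) (Finsupp.single (ts j) 1))) := by
    intro t ts
    refine (graftAll_single k t _).trans ?_
    refine (Fintype.sum_sigma (ι := Fin _) (α := fun j => (ts j).Leaf) _).trans ?_
    refine Finset.sum_congr rfl fun j _ => ?_
    rw [graftAll_single, MultilinearMap.map_update_sum]
    refine Finset.sum_congr rfl fun l _ => ?_
    refine (nodeMap_single k i _).symm.trans (congrArg _ (funext fun j' => ?_))
    by_cases h : j' = j
    · subst h; simp
    · simp [h]
  have h2 : ∀ t : PTree I Unit, graftAll k (Finsupp.single t 1) (nodeMap k i w) =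
      ∑ j, nodeMap k i (Function.update w j (graftAll k (Finsupp.single t 1) (w j))) := by
    intro t
    have hu : ∀ (w : Fin (n + 2) → (PTree I Unit →₀ k)) (j : Fin (n + 2)),
        (fun j' => (if j' = j then graftAll k (Finsupp.single t 1) else LinearMap.id) (w j')) =
          Function.update w j (graftAll k (Finsupp.single t 1) (w j)) := by
      intro w j
      funext j'
      by_cases h : j' = j
      · subst h; simp
      · simp [h]
    have h3 := finsupp_multilinear_ext k
      ((graftAll k (Finsupp.single t 1)).compMultilinearMap (nodeMap k i))
      (∑ j, (nodeMap k i).compLinearMap fun j' =>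
        if j' = j then graftAll k (Finsupp.single t 1) else LinearMap.id)
      (fun ts => by
        simp only [LinearMap.compMultilinearMap_apply, nodeMap_single, sum_apply,
          MultilinearMap.compLinearMap_apply, h1, hu])
    have h4 := congrArg (fun F => F w) h3
    simpa only [LinearMap.compMultilinearMap_apply, sum_apply,
      MultilinearMap.compLinearMap_apply, hu] using h4
  have h5 := Finsupp.lhom_ext' (φ := (graftAll k).flip (nodeMap k i w))
    (ψ := ∑ j, (nodeMap k i).toLinearMap w j ∘ₗ (graftAll k).flip (w j))
    fun t => LinearMap.ext_ring (by simpa using h2 t)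
  simpa using LinearMap.congr_fun h5 x

theorem graftAll_isLeftPreLie : IsLeftPreLie k (graftAll k (I := I)) := by
  intro x y z
  have key : graftAll k x (graftAll k y z) - graftAll k y (graftAll k x z) =
      graftAll k (graftAll k x y - graftAll k y x) z := by
    refine LinearMap.congr_fun (f := graftAll k x ∘ₗ graftAll k y - graftAll k y ∘ₗ graftAll k x)
      (g := graftAll k (graftAll k x y - graftAll k y x)) ?_ z
    refine Finsupp.lhom_ext' fun t => LinearMap.ext_ring ?_
    change graftAll k x (graftAll k y (Finsupp.single t 1)) -
      graftAll k y (graftAll k x (Finsupp.single t 1)) = graftAll k _ (Finsupp.single t 1)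
    induction t with
    | leaf a => simp only [graftAll_leaf]
    | node i ts ih =>
      rw [← nodeMap_single]
      generalize hw : (fun j => Finsupp.single (ts j) (1 : k)) = w
      have ih' : ∀ j, graftAll k (graftAll k x y - graftAll k y x) (w j) =
          graftAll k x (graftAll k y (w j)) - graftAll k y (graftAll k x (w j)) := by
        subst hw
        exact fun j => (ih j).symm
      simp only [graftAll_nodeMap, ih', map_sum, MultilinearMap.map_update_sub]
      have h2 : ∀ x y : PTree I Unit →₀ k, ∑ j, ∑ j', nodeMap k i (Function.update
          (Function.update w j (graftAll k y (w j))) j'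
            (graftAll k x (Function.update w j (graftAll k y (w j)) j'))) =
          ∑ j, nodeMap k i (Function.update w j (graftAll k x (graftAll k y (w j)))) +
          ∑ j, ∑ j', if j' = j then 0 else nodeMap k i (Function.update
            (Function.update w j (graftAll k y (w j))) j' (graftAll k x (w j'))) := by
        intro x y
        rw [← Finset.sum_add_distrib]
        refine Finset.sum_congr rfl fun j _ => ?_
        rw [← Finset.add_sum_erase _ _ (Finset.mem_univ j),
          ← Finset.add_sum_erase (f := fun j' => if j' = j then 0 else _) _ (Finset.mem_univ j)]
        simp only [Function.update_self, Function.update_idem, if_true, zero_add]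
        congr 1
        refine Finset.sum_congr rfl fun j' hj' => ?_
        have h := Finset.ne_of_mem_erase hj'
        rw [if_neg h, Function.update_of_ne h]
      rw [h2 x y, h2 y x, Finset.sum_comm (f := fun j j' => if j' = j then 0 else
        nodeMap k i (Function.update (Function.update w j (graftAll k y (w j))) j' _)),
        Finset.sum_sub_distrib]
      have h3 : (∑ j, ∑ j', if j = j' then 0 else nodeMap k i (Function.update
            (Function.update w j' (graftAll k y (w j'))) j (graftAll k x (w j)))) =
          ∑ j, ∑ j', if j' = j then 0 else nodeMap k i (Function.update
            (Function.update w j (graftAll k x (w j))) j' (graftAll k y (w j'))) := by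
        refine Finset.sum_congr rfl fun j _ => Finset.sum_congr rfl fun j' _ => ?_
        by_cases h : j = j'
        · rw [if_pos h, if_pos h.symm]
        · rw [if_neg h, if_neg (Ne.symm h), Function.update_comm h]
      rw [h3]
      abel
  have h := key
  rw [map_sub, LinearMap.sub_apply, sub_eq_sub_iff_add_eq_add] at h
  rw [sub_eq_sub_iff_add_eq_add, h, add_comm]

theorem IsLeftPreLie.of_injective {V W : Type u} [AddCommGroup V] [Module k V] [AddCommGroup W]
    [Module k W] {m : V →ₗ[k] V →ₗ[k] V} {m' : W →ₗ[k] W →ₗ[k] W} (hm' : IsLeftPreLie k m')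
    (f : V →ₗ[k] W) (hf : Function.Injective f) (h : ∀ x y, f (m x y) = m' (f x) (f y)) :
    IsLeftPreLie k m := by
  intro x y z
  apply hf
  simp only [map_sub, h]
  exact hm' _ _ _

theorem graftSigma_isLeftPreLie : IsLeftPreLie k (graftSigma k (I := I)) :=
  (graftAll_isLeftPreLie k).of_injective k (Finsupp.lmapDomain k k Subtype.val)
    (Finsupp.mapDomain_injective Subtype.val_injective) (graftSigma_eq_graftAll k)

theorem graftHyper_isLeftPreLie : IsLeftPreLie k (graftHyper k (I := I)) :=
  (graftSigma_isLeftPreLie k).of_injective k (Finsupp.lmapDomain k k (PhiN I).symm)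
    (Finsupp.mapDomain_injective (PhiN I).symm.injective) fun x y => by
      simp [graftHyper, ← Finsupp.mapDomain_comp]

end Grafting

namespace PTree

variable {I : ℕ → Type u} {A B : Type}

/-- The tree without the labels of its leaves. -/
def shape (t : PTree I A) : PTree I Unit := t.relabel fun _ => ()

theorem shape_relabel (f : A → B) (t : PTree I A) : (t.relabel f).shape = t.shape :=
  relabel_relabel _ _ _

theorem shape_selfLabel (t : PTree I Unit) : t.selfLabel.shape = t :=
  t.selfLabel_relabel

theorem relabel_selfLabel (f : A → B) (t : PTree I A) :
    (t.relabel f).selfLabel = t.selfLabel.relabel (t.relabelLeaf f) := by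
  induction t with
  | leaf a => rfl
  | node i ts ih =>
    refine congrArg (node i) (funext fun j => ?_)
    refine (congrArg (relabel _) (ih j)).trans ((relabel_relabel _ _ _).trans ?_)
    exact (relabel_relabel (B := (node i ts).Leaf) (Sigma.mk j) ((node i ts).relabelLeaf f) _).symm

theorem card_leaf_relabel (f : A → B) (t : PTree I A) :
    Nat.card (t.relabel f).Leaf = Nat.card t.Leaf :=
  Nat.card_congr (t.relabelLeaf f).symm

theorem card_leaf_pos (t : PTree I A) : 0 < Nat.card t.Leaf :=
  have := t.nonempty_leaf
  Nat.card_pos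

theorem card_leaf_node {n : ℕ} (i : I n) (ts : Fin (n + 2) → PTree I A) :
    Nat.card (node i ts).Leaf = ∑ j, Nat.card (ts j).Leaf :=
  Nat.card_sigma (β := fun j => (ts j).Leaf)

theorem card_leaf_le_node {n : ℕ} (i : I n) (ts : Fin (n + 2) → PTree I A) (j : Fin (n + 2)) :
    Nat.card (ts j).Leaf ≤ Nat.card (node i ts).Leaf := by
  rw [card_leaf_node]
  exact Finset.single_le_sum (f := fun j => Nat.card (ts j).Leaf) (fun _ _ => Nat.zero_le _)
    (Finset.mem_univ j)

/-- The list of the trees above the leaves of the trunk of a cut: the subtrees cut off, and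
one-edge trees for the remaining leaves. -/
def pruneAll : ∀ t : PTree I Unit, t.Cut → List (PTree I Unit)
  | leaf _, _ => [leaf ()]
  | node i ts, none => [node i ts]
  | node _ ts, some c => (List.ofFn fun j => (ts j).pruneAll (c j)).flatten

open Classical in
theorem filter_pruneAll (t : PTree I Unit) (c : t.Cut) :
    (t.pruneAll c).filter (fun s => s ≠ leaf ()) = t.prune c := by
  induction t with
  | leaf a => simp [pruneAll, prune]
  | node i ts ih =>
    match c with
    | none => simp [pruneAll, prune]
    | some c => simp [pruneAll, prune, List.filter_flatten, List.map_ofFn, Function.comp_def, ← ih]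

theorem card_leaf_trunk_le (t : PTree I Unit) (c : t.Cut) :
    Nat.card (t.trunk c).Leaf ≤ Nat.card t.Leaf := by
  induction t with
  | leaf a => exact le_rfl
  | node i ts ih =>
    match c with
    | none => exact (Nat.card_unique (α := Unit)).trans_le (card_leaf_pos (node i ts))
    | some c =>
      rw [trunk, card_leaf_node, card_leaf_node]
      exact Finset.sum_le_sum fun j _ => ih j (c j)

theorem card_leaf_le_of_mem_pruneAll {t : PTree I Unit} {c : t.Cut} {s : PTree I Unit}
    (h : s ∈ t.pruneAll c) : Nat.card s.Leaf ≤ Nat.card t.Leaf := by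
  induction t with
  | leaf a =>
    obtain rfl := List.mem_singleton.1 h
    exact le_rfl
  | node i ts ih =>
    match c with
    | none =>
      obtain rfl := List.mem_singleton.1 h
      exact le_rfl
    | some c =>
      obtain ⟨l, hl, hs⟩ := List.mem_flatten.1 h
      obtain ⟨j, rfl⟩ := (List.mem_ofFn' _ _).1 hl
      exact (ih j hs).trans (card_leaf_le_node i ts j)

theorem trunk_injective (t : PTree I Unit) : Function.Injective t.trunk := by
  induction t with
  | leaf a => exact fun c c' _ => Subsingleton.elim (α := Unit) c c'
  | node i ts ih =>
    intro c c' h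
    match c, c' with
    | none, none => rfl
    | none, some c' => exact absurd h nofun
    | some c, none => exact absurd h nofun
    | some c, some c' =>
      exact congrArg some (funext fun j => ih j (congrFun (node_inj.1 h) j))

theorem eq_of_bind_eq {f g : A → PTree I B} {t : PTree I A} (h : t.bind f = t.bind g) {a : A}
    (ha : a ∈ t.leafList) : f a = g a := by
  induction t with
  | leaf b =>
    obtain rfl := List.mem_singleton.1 ha
    exact h
  | node i ts ih =>
    obtain ⟨l, hl, ha⟩ := List.mem_flatten.1 ha
    obtain ⟨j, rfl⟩ := (List.mem_ofFn' _ _).1 hl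
    have h' : (fun j => (ts j).bind f) = fun j => (ts j).bind g := by
      simpa [bind] using h
    exact ih j (congrFun h' j) ha

theorem exists_cut_bind (t : PTree I A) (s : A → PTree I Unit) :
    ∃ c : (t.bind s).Cut, (t.bind s).trunk c = t.shape ∧
      (t.bind s).pruneAll c = t.leafList.map s := by
  induction t with
  | leaf a =>
    change ∃ c : (s a).Cut, (s a).trunk c = leaf () ∧ (s a).pruneAll c = [s a]
    cases s a with
    | leaf b => exact ⟨(), rfl, rfl⟩
    | node i ts => exact ⟨none, rfl, rfl⟩
  | node i ts ih =>
    choose c hc hc' using ih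
    refine ⟨some c, congrArg (node i) (funext hc), ?_⟩
    refine (congrArg List.flatten (congrArg List.ofFn (funext hc'))).trans ?_
    rw [leafList, List.map_flatten, List.map_ofFn]
    rfl

theorem exists_bind_selfLabel (t : PTree I A) (v : PTree I Unit) (c : v.Cut)
    (h : v.trunk c = t.shape) : ∃ s : t.Leaf → PTree I Unit, t.selfLabel.bind s = v := by
  induction t generalizing v with
  | leaf a => exact ⟨fun _ => v, rfl⟩
  | node i ts ih =>
    match v, c with
    | leaf _, _ => exact absurd h nofun
    | node _ _, none => exact absurd h nofun
    | node i' vs, some c =>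
      obtain ⟨rfl, hi, ht⟩ := node.inj h
      obtain rfl := eq_of_heq hi
      choose s hs using fun j => ih j (vs j) (c j) (congrFun (eq_of_heq ht) j)
      refine ⟨fun p => s p.1 p.2, congrArg (node i') (funext fun j => ?_)⟩
      exact (bind_relabel _ _ _).trans (hs j)

end PTree

namespace LTree

variable {I : ℕ → Type u} {A : Type}

theorem card_leaf (t : LTree I A) : Nat.card t.1.Leaf = Nat.card A :=
  Nat.card_congr t.leafEquiv

theorem bind_injective (t : LTree I A) :
    Function.Injective fun s : A → PTree I Unit => t.1.bind s :=
  fun _ _ h => funext fun a => PTree.eq_of_bind_eq h (t.2.2 a)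

theorem exists_bind (t : LTree I A) (v : PTree I Unit) (c : v.Cut)
    (h : v.trunk c = t.1.shape) : ∃ s : A → PTree I Unit, t.1.bind s = v := by
  obtain ⟨s, hs⟩ := t.1.exists_bind_selfLabel v c h
  refine ⟨s ∘ t.leafEquiv.symm, ?_⟩
  have h1 : t.1 = t.1.selfLabel.relabel t.leafEquiv := t.1.selfLabel_relabel.symm
  refine (congrArg (PTree.bind _) h1).trans ((PTree.bind_relabel _ _ _).trans (Eq.trans ?_ hs))
  congr 1
  funext l
  simp

/-- A sum over cuts of `v` with a given trunk has at most one nonzero term, which corresponds to the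
only way to write `v` as a grafting on the trunk. -/
theorem sum_cut_eq {R : Type u} [AddCommMonoid R] (t : LTree I A) (v : PTree I Unit) (z : R)
    (h : List (PTree I Unit) → R) (h1 : ∀ s, t.1.bind s = v → z = h (t.1.leafList.map s))
    (h0 : (∀ s, t.1.bind s ≠ v) → z = 0) [DecidableEq (PTree I Unit)] :
    (∑ c : v.Cut, if v.trunk c = t.1.shape then h (v.pruneAll c) else 0) = z := by
  by_cases hs : ∃ s, t.1.bind s = v
  · obtain ⟨s, rfl⟩ := hs
    obtain ⟨c, hc, hc'⟩ := t.1.exists_cut_bind s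
    rw [Finset.sum_eq_single c, if_pos hc, hc', h1 s rfl]
    · exact fun c' _ hne => if_neg fun h => hne (PTree.trunk_injective _ (h.trans hc.symm))
    · exact fun h => absurd (Finset.mem_univ c) h
  · rw [h0 (not_exists.1 hs)]
    exact Finset.sum_eq_zero fun c _ => if_neg fun h => hs (t.exists_bind v c h)

end LTree

section Shape

variable (k : Type u) [Field k] {I : ℕ → Type u} {A : Type}

/-- The linear extension of the map from labelled trees to trees. -/
noncomputable def shapeMap : (LTree I A →₀ k) →ₗ[k] (PTree I Unit →₀ k) :=
  Finsupp.lmapDomain k k fun t => t.1.shape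

theorem shapeMap_single (t : LTree I A) (c : k) :
    shapeMap k (Finsupp.single t c) = Finsupp.single t.1.shape c :=
  Finsupp.mapDomain_single

theorem shapeMap_map {B : Type} (e : A ≃ B) (x : LTree I A →₀ k) :
    shapeMap k (Finsupp.lmapDomain k k (LTree.map e) x) = shapeMap k x := by
  rw [shapeMap, shapeMap, Finsupp.lmapDomain_apply, Finsupp.lmapDomain_apply,
    Finsupp.lmapDomain_apply, ← Finsupp.mapDomain_comp]
  exact congrArg (fun f => Finsupp.mapDomain f x) (funext fun t => PTree.shape_relabel e t.1)

theorem shapeMap_apply_of_card_ne [Finite A] (x : LTree I A →₀ k) {v : PTree I Unit}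
    (hv : Nat.card v.Leaf ≠ Nat.card A) : shapeMap k x v = 0 := by
  refine Finsupp.mapDomain_of_notMem_range x v ?_
  rintro ⟨t, rfl⟩
  exact hv ((PTree.card_leaf_relabel _ _).trans t.card_leaf)

/-- Linear combinations of graftings on the leaves of `t`. -/
noncomputable def bindMap [Finite A] (t : LTree I A) :
    MultilinearMap k (fun _ : A => PTree I Unit →₀ k) (PTree I Unit →₀ k) :=
  (Finsupp.lmapDomain k k fun s => t.1.bind s).compMultilinearMap
    (finsuppTensor k fun _ => PTree I Unit)

theorem bindMap_apply [Fintype A] (t : LTree I A) (Y : A → (PTree I Unit →₀ k))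
    (s : A → PTree I Unit) : bindMap k t Y (t.1.bind s) = ∏ a, Y a (s a) :=
  (Finsupp.mapDomain_apply t.bind_injective _ s).trans (finsuppTensor_apply k _ Y s)

theorem bindMap_apply_of_ne [Finite A] (t : LTree I A) (Y : A → (PTree I Unit →₀ k))
    {v : PTree I Unit} (h : ∀ s, t.1.bind s ≠ v) : bindMap k t Y v = 0 :=
  Finsupp.mapDomain_of_notMem_range _ _ fun ⟨s, hs⟩ => h s hs

theorem bindMap_const [Finite A] (t : LTree I A) (Y : PTree I Unit →₀ k) (v : PTree I Unit)
    [DecidableEq (PTree I Unit)] :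
    bindMap k t (fun _ => Y) v =
      ∑ c : v.Cut, if v.trunk c = t.1.shape then ((v.pruneAll c).map Y).prod else 0 := by
  have := Fintype.ofFinite A
  refine (t.sum_cut_eq v _ (fun l => (l.map Y).prod) ?_ fun h => bindMap_apply_of_ne k t _ h).symm
  rintro s rfl
  classical
  rw [bindMap_apply, List.map_map, ← List.prod_toFinset _ t.2.1]
  exact Finset.prod_congr
    (Finset.eq_univ_iff_forall.2 fun a => List.mem_toFinset.2 (t.2.2 a)).symm fun _ _ => rfl

theorem sum_bindMap_ite [Fintype A] [DecidableEq A] (t : LTree I A) (e g : PTree I Unit →₀ k)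
    (v : PTree I Unit) [DecidableEq (PTree I Unit)] :
    ∑ i, bindMap k t (fun a => if a = i then g else e) v =
      ∑ c : v.Cut, if v.trunk c = t.1.shape then (v.pruneAll c).derivProd e g else 0 := by
  refine (t.sum_cut_eq v _ (fun l => l.derivProd e g) ?_ fun h =>
    Finset.sum_eq_zero fun i _ => bindMap_apply_of_ne k t _ h).symm
  rintro s rfl
  rw [List.derivProd_map, List.derivProd_univ _ _ _ t.2.1 t.2.2]
  refine Finset.sum_congr rfl fun i _ => ?_
  rw [bindMap_apply]
  refine Finset.prod_congr rfl fun a _ => ?_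
  split_ifs <;> rfl

theorem shapeMap_treeComp {B : A → Type} [Finite A] [∀ a, Finite (B a)] (x : LTree I A →₀ k)
    (y : ∀ a, LTree I (B a) →₀ k) :
    shapeMap k (treeComp k I x y) =
      Finsupp.linearCombination k (fun t => bindMap k t fun a => shapeMap k (y a)) x := by
  have key := treeComp_induction k I (B := B)
    ((shapeMap k).compMultilinearMapₗ k ∘ₗ treeComp k I)
    (Finsupp.linearCombination k fun t => (bindMap k t).compLinearMap fun a => shapeMap k) ?_
  · have h := congrArg (fun F => F x y) key
    refine h.trans ?_
    simp [Finsupp.linearCombination_apply, Finsupp.sum, sum_apply]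
  · intro t s
    change shapeMap k (treeComp k I _ _) = _
    rw [treeComp_single, shapeMap_single, Finsupp.linearCombination_single, one_smul]
    simp only [MultilinearMap.compLinearMap_apply, shapeMap_single]
    refine Eq.symm ?_
    refine (congrArg (Finsupp.lmapDomain k k _) (finsuppTensor_single k
      (fun _ : A => PTree I Unit) fun a => (s a).1.shape)).trans ?_
    refine Finsupp.mapDomain_single.trans ?_
    refine congrArg (fun t => Finsupp.single t (1 : k)) ?_
    refine Eq.trans ?_ (PTree.bind_bind _ _ _).symm
    refine congrArg (fun f => t.1.bind f) (funext fun a => ?_)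
    exact (PTree.shape_relabel _ _).symm

theorem shapeMap_treeComp_apply {B : A → Type} [Finite A] [∀ a, Finite (B a)] (x : LTree I A →₀ k)
    (y : ∀ a, LTree I (B a) →₀ k) (v : PTree I Unit) :
    shapeMap k (treeComp k I x y) v =
      Finsupp.linearCombination k (fun t => bindMap k t (fun a => shapeMap k (y a)) v) x := by
  rw [shapeMap_treeComp]
  simp [Finsupp.linearCombination_apply, Finsupp.sum]

theorem sum_linearCombination {X ι : Type*} (s : Finset ι) (F : ι → X → k) (x : X →₀ k) :
    ∑ m ∈ s, Finsupp.linearCombination k (F m) x =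
      Finsupp.linearCombination k (fun t => ∑ m ∈ s, F m t) x := by
  simp only [Finsupp.linearCombination_apply, Finsupp.sum, Finset.smul_sum]
  exact Finset.sum_comm

end Shape

theorem List.derivProd_congr {α R : Type*} [CommSemiring R] (e g g' : α → R) (l : List α)
    (h : ∀ a ∈ l, g a = g' a) : l.derivProd e g = l.derivProd e g' := by
  induction l with
  | nil => rfl
  | cons a l ih =>
    rw [derivProd, derivProd, h a List.mem_cons_self, ih fun b hb => h b (List.mem_cons_of_mem a hb)]

namespace Operad

variable {k : Type u} [Field k] {I : ℕ → Type u}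

/-- Classes of operations, as linear combinations of trees. -/
noncomputable def coinvShape (N : ℕ) :
    (treeOperad k I).Coinv N →ₗ[k] (PTree I Unit →₀ k) :=
  Representation.Coinvariants.lift ((treeOperad k I).rep (N + 1)) (shapeMap k)
    fun σ => LinearMap.ext fun x => shapeMap_map k σ x

theorem coinvShape_mk (N : ℕ) (x : (treeOperad k I).obj (Fin (N + 1))) :
    coinvShape N (Representation.Coinvariants.mk ((treeOperad k I).rep (N + 1)) x) =
      shapeMap k x :=
  rfl

theorem coinvShape_cls {N : ℕ} {A : Type} [Finite A] (hA : Nat.card A = N + 1)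
    (x : (treeOperad k I).obj A) :
    coinvShape N ((treeOperad k I).cls N x) = shapeMap k x := by
  rw [(treeOperad k I).cls_eq (Finite.equivFinOfCardEq hA), coinvShape_mk]
  exact shapeMap_map k _ x

theorem coinvShape_cls_apply {N : ℕ} {A : Type} [Finite A] (x : (treeOperad k I).obj A)
    {v : PTree I Unit} (hv : Nat.card v.Leaf = N + 1) :
    coinvShape N ((treeOperad k I).cls N x) v = shapeMap k (A := A) x v := by
  by_cases hA : Nat.card A = N + 1
  · rw [coinvShape_cls hA]
  · rw [cls, dif_neg hA, LinearMap.zero_apply, map_zero, Finsupp.zero_apply]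
    exact (shapeMap_apply_of_card_ne k (A := A) x (by rw [hv]; exact Ne.symm hA)).symm

theorem coinvShape_apply_of_card_ne {N : ℕ} (x : (treeOperad k I).Coinv N) {v : PTree I Unit}
    (hv : Nat.card v.Leaf ≠ N + 1) : coinvShape N x v = 0 := by
  obtain ⟨x, rfl⟩ := Representation.Coinvariants.mk_surjective _ x
  exact shapeMap_apply_of_card_ne k (A := Fin (N + 1)) x (by rwa [Nat.card_fin])

theorem coinvShape_treeClass {N : ℕ} {t : PTree I Unit} (ht : Nat.card t.Leaf = N + 1) :
    coinvShape N (treeClass k N t) = Finsupp.single t 1 := by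
  refine (coinvShape_cls ht _).trans ((shapeMap_single k _ 1).trans ?_)
  exact congrArg (fun t => Finsupp.single t (1 : k)) t.shape_selfLabel

theorem treeClass_of_card_ne {N : ℕ} {t : PTree I Unit} (ht : Nat.card t.Leaf ≠ N + 1) :
    treeClass k N t = 0 := by
  have h : (treeOperad k I).cls N (A := t.Leaf) = 0 := dif_neg ht
  exact LinearMap.congr_fun h _

theorem cls_single (N : ℕ) {A : Type} [Finite A] (t : LTree I A) :
    (treeOperad k I).cls N (A := A) (Finsupp.single t 1 : LTree I A →₀ k) =
      treeClass k N t.1.shape := by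
  have h : t = (LTree.self t.1.shape).map
      ((t.1.relabelLeaf fun _ => ()).symm.trans t.leafEquiv) := by
    refine Subtype.ext ?_
    refine Eq.trans ?_ (congrArg (PTree.relabel _) (t.1.relabel_selfLabel fun _ => ()).symm)
    refine t.1.selfLabel_relabel.symm.trans (Eq.trans ?_ (PTree.relabel_relabel _ _ _).symm)
    refine congrArg (fun f => t.1.selfLabel.relabel f) (funext fun l => ?_)
    exact congrArg t.leafEquiv ((t.1.relabelLeaf fun _ => ()).symm_apply_apply l).symm
  have h' : (Finsupp.single t 1 : LTree I A →₀ k) = (treeOperad k I).map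
      ((t.1.relabelLeaf fun _ => ()).symm.trans t.leafEquiv)
      (Finsupp.single (LTree.self t.1.shape) 1 : LTree I t.1.shape.Leaf →₀ k) := by
    refine Eq.trans ?_ (Finsupp.mapDomain_single).symm
    rw [← h]
  rw [h']
  exact (treeOperad k I).cls_map _ _

theorem linearCombination_treeClass (N : ℕ) (x : (treeOperad k I).Coinv N) :
    Finsupp.linearCombination k (treeClass k N) (coinvShape N x) = x := by
  refine LinearMap.congr_fun
    (f := Finsupp.linearCombination k (treeClass k N) ∘ₗ coinvShape N) (g := LinearMap.id) ?_ x
  refine Representation.Coinvariants.hom_ext ?_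
  refine Finsupp.lhom_ext' (α := LTree I (Fin (N + 1))) fun t => LinearMap.ext_ring ?_
  change Finsupp.linearCombination k (treeClass k N) (shapeMap k (Finsupp.single t 1)) =
    Representation.Coinvariants.mk ((treeOperad k I).rep (N + 1))
      (Finsupp.single t 1 : LTree I (Fin (N + 1)) →₀ k)
  rw [shapeMap_single, Finsupp.linearCombination_single, one_smul]
  refine (cls_single N t).symm.trans (((treeOperad k I).cls_eq (Equiv.refl _) _).trans ?_)
  exact congrArg _ ((treeOperad k I).map_refl _)

theorem coinvShape_injective (N : ℕ) : Function.Injective (coinvShape (k := k) (I := I) N) :=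
  Function.LeftInverse.injective (linearCombination_treeClass N)

/-- The coefficient of a tree in a series. -/
noncomputable def coeff : (treeOperad k I).Series →ₗ[k] (PTree I Unit → k) :=
  LinearMap.pi fun t => Finsupp.lapply t ∘ₗ coinvShape (Nat.card t.Leaf - 1) ∘ₗ
    LinearMap.proj (Nat.card t.Leaf - 1)

theorem coeff_apply (f : (treeOperad k I).Series) {N : ℕ} {t : PTree I Unit}
    (ht : Nat.card t.Leaf = N + 1) : coeff f t = coinvShape N (f N) t := by
  have h : N = Nat.card t.Leaf - 1 := by omega
  subst h
  rfl

theorem coeff_injective : Function.Injective (coeff (k := k) (I := I)) := by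
  intro f g h
  funext N
  refine coinvShape_injective N (Finsupp.ext fun t => ?_)
  by_cases ht : Nat.card t.Leaf = N + 1
  · rw [← coeff_apply f ht, ← coeff_apply g ht, h]
  · rw [coinvShape_apply_of_card_ne _ ht, coinvShape_apply_of_card_ne _ ht]

/-- Sums of coefficients of bounded arity. -/
theorem sum_coinvShape_apply (f : (treeOperad k I).Series) {N : ℕ} {t : PTree I Unit}
    (ht : Nat.card t.Leaf ≤ N + 1) :
    (∑ n ∈ Finset.range (N + 1), coinvShape n (f n)) t = coeff f t := by
  have h0 := t.card_leaf_pos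
  rw [Finsupp.finsetSum_apply, Finset.sum_eq_single (Nat.card t.Leaf - 1)]
  · exact (coeff_apply f (by omega)).symm
  · exact fun n _ hn => coinvShape_apply_of_card_ne _ (by omega)
  · exact fun h => absurd (Finset.mem_range.2 (by omega)) h

theorem coinvShape_subst (N n : ℕ) (x : (treeOperad k I).obj (Fin (n + 1)))
    (y : Fin (n + 1) → ∀ m, (treeOperad k I).obj (Fin (m + 1))) {v : PTree I Unit}
    (hv : Nat.card v.Leaf = N + 1) :
    coinvShape N ((treeOperad k I).subst N n x y) v =
      Finsupp.linearCombination k (fun t : LTree I (Fin (n + 1)) => bindMap k t (fun j =>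
        ∑ m ∈ Finset.range (N + 1), shapeMap k (A := Fin (m + 1)) (y j m)) v) x := by
  have h1 : ∀ j, ∑ m ∈ Finset.range (N + 1), shapeMap k (A := Fin (m + 1)) (y j m) =
      ∑ m : Fin (N + 1), shapeMap k (A := Fin (m + 1)) (y j m) := fun j =>
    Finset.sum_range _
  simp only [h1, MultilinearMap.map_sum, subst, map_sum, Finsupp.finsetSum_apply,
    coinvShape_cls_apply _ hv]
  refine (Finset.sum_congr rfl fun (m : Fin (n + 1) → Fin (N + 1)) _ => shapeMap_treeComp_apply k
    (A := Fin (n + 1)) (B := fun j => Fin (m j + 1)) x (fun j => y j (m j : ℕ)) v).trans ?_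
  exact sum_linearCombination k _ _ _

/-- The composition of series in terms of cuts, for a linear combination of trees in which other
series are substituted. -/
theorem linearCombination_ite_cut {X : Type u} (x : X →₀ k) (sh : X → PTree I Unit)
    (v : PTree I Unit) (h : List (PTree I Unit) → k) [DecidableEq (PTree I Unit)] :
    Finsupp.linearCombination k (fun t =>
        ∑ c : v.Cut, if v.trunk c = sh t then h (v.pruneAll c) else 0) x =
      ∑ c : v.Cut, Finsupp.lmapDomain k k sh x (v.trunk c) * h (v.pruneAll c) := by
  induction x using Finsupp.induction_linear with
  | zero => simp
  | add x y hx hy => simp only [map_add, hx, hy, Finsupp.add_apply, add_mul, Finset.sum_add_distrib]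
  | single t a =>
    simp [Finsupp.linearCombination_single, Finset.mul_sum, Finsupp.single_apply, eq_comm]

theorem coinvShape_subst_const (N n : ℕ) (x : (treeOperad k I).obj (Fin (n + 1)))
    (y : Fin (n + 1) → ∀ m, (treeOperad k I).obj (Fin (m + 1))) {G : PTree I Unit →₀ k}
    (hy : ∀ j, ∑ m ∈ Finset.range (N + 1), shapeMap k (A := Fin (m + 1)) (y j m) = G)
    {v : PTree I Unit} (hv : Nat.card v.Leaf = N + 1) :
    coinvShape N ((treeOperad k I).subst N n x y) v = ∑ c : v.Cut,
      shapeMap k (A := Fin (n + 1)) x (v.trunk c) * ((v.pruneAll c).map G).prod := by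
  classical
  rw [coinvShape_subst N n x y hv]
  simp only [hy, bindMap_const]
  exact linearCombination_ite_cut x (fun t => t.1.shape) v fun l => (l.map G).prod

theorem sum_coinvShape_subst_ite (N n : ℕ) (x : (treeOperad k I).obj (Fin (n + 1)))
    (y : Fin (n + 1) → Fin (n + 1) → ∀ m, (treeOperad k I).obj (Fin (m + 1)))
    {e G : PTree I Unit →₀ k}
    (hy : ∀ i j, ∑ m ∈ Finset.range (N + 1), shapeMap k (A := Fin (m + 1)) (y i j m) =
      if j = i then G else e)
    {v : PTree I Unit} (hv : Nat.card v.Leaf = N + 1) :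
    ∑ i, coinvShape N ((treeOperad k I).subst N n x (y i)) v = ∑ c : v.Cut,
      shapeMap k (A := Fin (n + 1)) x (v.trunk c) * (v.pruneAll c).derivProd e G := by
  classical
  refine (Finset.sum_congr rfl fun i _ => coinvShape_subst N n x (y i) hv).trans ?_
  simp only [hy]
  refine (sum_linearCombination k (X := LTree I (Fin (n + 1))) _ _ x).trans ?_
  simp only [sum_bindMap_ite]
  exact linearCombination_ite_cut x (fun t => t.1.shape) v fun l => l.derivProd e G

theorem shapeMap_rep (f : (treeOperad k I).Series) (n : ℕ) :
    shapeMap k (A := Fin (n + 1)) (Series.rep f n) = coinvShape n (f n) := by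
  rw [← coinvShape_mk, Series.mk_rep]

theorem coeff_seriesComp (f g : (treeOperad k I).Series) (v : PTree I Unit) :
    coeff ((treeOperad k I).seriesComp f g) v =
      ∑ c : v.Cut, coeff f (v.trunk c) * ((v.pruneAll c).map (coeff g)).prod := by
  obtain ⟨N, hN⟩ : ∃ N, Nat.card v.Leaf = N + 1 := Nat.exists_eq_add_one.2 v.card_leaf_pos
  rw [coeff_apply _ hN, seriesComp, map_sum, Finsupp.finsetSum_apply]
  refine (Finset.sum_congr rfl fun n _ => coinvShape_subst_const N n (Series.rep f n)
    (fun _ => Series.rep g) (fun _ => Finset.sum_congr rfl fun m _ => shapeMap_rep g m) hN).trans ?_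
  rw [Finset.sum_comm]
  refine Finset.sum_congr rfl fun c _ => ?_
  rw [← Finset.sum_mul, Finset.sum_congr rfl fun n _ => congrArg
    (fun F : PTree I Unit →₀ k => F (v.trunk c)) (shapeMap_rep f n), ← Finsupp.finsetSum_apply,
    sum_coinvShape_apply f ((v.card_leaf_trunk_le c).trans hN.le)]
  refine congrArg (fun l => _ * List.prod l) (List.map_congr_left fun p hp => ?_)
  exact sum_coinvShape_apply g ((PTree.card_leaf_le_of_mem_pruneAll hp).trans hN.le)

theorem sum_shapeMap_unitSeq (N : ℕ) :
    ∑ m ∈ Finset.range (N + 1), shapeMap k (A := Fin (m + 1)) ((treeOperad k I).unitSeq m) =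
      Finsupp.single (.leaf ()) 1 := by
  rw [Finset.sum_eq_single 0]
  · refine (shapeMap_map k (A := Unit) _ _).trans ?_
    exact shapeMap_single k _ 1
  · intro m _ hm
    match m with
    | 0 => exact absurd rfl hm
    | m + 1 => exact map_zero _
  · exact fun h => absurd (Finset.mem_range.2 N.succ_pos) h

theorem coeff_preLie (f g : (treeOperad k I).Series) (v : PTree I Unit) :
    coeff ((treeOperad k I).preLie f g) v = ∑ c : v.Cut, coeff f (v.trunk c) *
      (v.pruneAll c).derivProd (Finsupp.single (.leaf ()) 1) (coeff g) := by
  obtain ⟨N, hN⟩ : ∃ N, Nat.card v.Leaf = N + 1 := Nat.exists_eq_add_one.2 v.card_leaf_pos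
  rw [coeff_apply _ hN, preLie, map_sum, Finsupp.finsetSum_apply]
  have h0 : ∀ n (i j : Fin (n + 1)), (∑ m ∈ Finset.range (N + 1), shapeMap k (A := Fin (m + 1))
      ((if j = i then Series.rep g else (treeOperad k I).unitSeq) m)) =
      if j = i then ∑ m ∈ Finset.range (N + 1), coinvShape m (g m)
        else Finsupp.single (.leaf ()) 1 := by
    intro n i j
    split_ifs
    · exact Finset.sum_congr rfl fun m _ => shapeMap_rep g m
    · exact sum_shapeMap_unitSeq N
  simp only [map_sum, Finsupp.finsetSum_apply]
  refine (Finset.sum_congr rfl fun n _ => sum_coinvShape_subst_ite N n (Series.rep f n)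
    (fun i j => if j = i then Series.rep g else (treeOperad k I).unitSeq) (h0 n) hN).trans ?_
  rw [Finset.sum_comm]
  refine Finset.sum_congr rfl fun c _ => ?_
  rw [← Finset.sum_mul, Finset.sum_congr rfl fun n _ => congrArg
    (fun F : PTree I Unit →₀ k => F (v.trunk c)) (shapeMap_rep f n), ← Finsupp.finsetSum_apply,
    sum_coinvShape_apply f ((v.card_leaf_trunk_le c).trans hN.le)]
  refine congrArg (fun x => _ * x) (List.derivProd_congr _ _ _ _ fun p hp => ?_)
  exact sum_coinvShape_apply g ((PTree.card_leaf_le_of_mem_pruneAll hp).trans hN.le)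

end Operad

namespace PTree

variable {I : ℕ → Type u}

theorem two_le_card_leaf {n : ℕ} (i : I n) (ts : Fin (n + 2) → PTree I Unit) :
    n + 2 ≤ Nat.card (node i ts).Leaf := by
  rw [card_leaf_node]
  simpa using Finset.card_nsmul_le_sum (Finset.univ : Finset (Fin (n + 2)))
    (fun j => Nat.card (ts j).Leaf) 1 fun j _ => (ts j).card_leaf_pos

theorem card_leaf_trunk_lt {t : PTree I Unit} {c : t.Cut} (hc : c ≠ t.emptyCut) :
    Nat.card (t.trunk c).Leaf < Nat.card t.Leaf := by
  induction t with
  | leaf a => exact absurd (Subsingleton.elim (α := Unit) c _) hc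
  | node i ts ih =>
    match c with
    | none =>
      refine (Nat.card_unique (α := Unit)).trans_lt ?_
      have := two_le_card_leaf i ts
      omega
    | some c =>
      obtain ⟨j, hj⟩ : ∃ j, c j ≠ (ts j).emptyCut := by
        by_contra! h
        exact hc (congrArg some (funext h))
      rw [trunk, card_leaf_node, card_leaf_node]
      exact Finset.sum_lt_sum (fun j _ => (ts j).card_leaf_trunk_le (c j))
        ⟨j, Finset.mem_univ j, ih j hj⟩

theorem finite_card_leaf_le (hI : ∀ n, Finite (I n)) (N : ℕ) :
    {t : PTree I Unit | Nat.card t.Leaf ≤ N}.Finite := by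
  induction N with
  | zero =>
    refine Set.Finite.subset Set.finite_empty fun t ht => ?_
    exact absurd t.card_leaf_pos (Nat.not_lt.2 ht)
  | succ N ih =>
    have : Finite {t : PTree I Unit // Nat.card t.Leaf ≤ N} := ih
    refine ((Set.finite_singleton (leaf ())).union (Set.finite_range fun p : Σ n : Fin N,
      I n × (Fin (n + 2) → {t : PTree I Unit // Nat.card t.Leaf ≤ N}) =>
        node p.2.1 fun j => (p.2.2 j).1)).subset ?_
    intro t ht
    cases t with
    | leaf a => exact Or.inl rfl
    | @node n i ts =>
      refine Or.inr ?_
      have h2 := (two_le_card_leaf i ts).trans ht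
      have hj : ∀ j, Nat.card (ts j).Leaf ≤ N := by
        intro j
        have h1 : Nat.card (node i ts).Leaf ≤ N + 1 := ht
        rw [card_leaf_node, ← Finset.add_sum_erase _ _ (Finset.mem_univ j)] at h1
        have h3 := Finset.card_nsmul_le_sum (Finset.univ.erase j)
          (fun j => Nat.card (ts j).Leaf) 1 fun j _ => (ts j).card_leaf_pos
        rw [Finset.card_erase_of_mem (Finset.mem_univ j), Finset.card_univ, Fintype.card_fin,
          smul_eq_mul] at h3
        omega
      exact ⟨⟨⟨n, by omega⟩, i, fun j => ⟨ts j, hj j⟩⟩, rfl⟩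

theorem finite_card_leaf_eq (hI : ∀ n, Finite (I n)) (N : ℕ) :
    Finite {t : PTree I Unit // Nat.card t.Leaf = N + 1} :=
  (finite_card_leaf_le hI (N + 1)).subset fun _ ht => le_of_eq ht

end PTree

namespace PTree

variable {k : Type u} [Field k] {I : ℕ → Type u}

theorem prod_map_prune {F : PTree I Unit → k} (hF : F (leaf ()) = 1) (t : PTree I Unit)
    (c : t.Cut) : ((t.pruneAll c).map F).prod = ((t.prune c).map F).prod := by
  classical
  rw [← filter_pruneAll]
  generalize t.pruneAll c = l
  induction l with
  | nil => rfl
  | cons a l ih =>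
    rw [List.map_cons, List.prod_cons, ih, List.filter_cons]
    by_cases ha : a = leaf ()
    · simp [ha, hF]
    · simp [ha]

theorem derivProd_prune {F : PTree I Unit → k} (hF : F (leaf ()) = 0) (t : PTree I Unit)
    (c : t.Cut) : (t.pruneAll c).derivProd (Finsupp.single (leaf ()) 1) F =
      (t.prune c).derivProd (fun _ => 0) F := by
  classical
  rw [← filter_pruneAll]
  generalize t.pruneAll c = l
  have h : ∀ l : List (PTree I Unit), (l.map (Finsupp.single (leaf ()) (1 : k))).prod =
      ((l.filter fun s => s ≠ leaf ()).map fun _ => (0 : k)).prod := by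
    intro l
    induction l with
    | nil => rfl
    | cons a l ih =>
      rw [List.map_cons, List.prod_cons, ih, List.filter_cons]
      by_cases ha : a = leaf ()
      · simp [ha]
      · simp [ha, Finsupp.single_eq_of_ne ha]
  induction l with
  | nil => rfl
  | cons a l ih =>
    rw [List.derivProd, ih, h, List.filter_cons]
    by_cases ha : a = leaf ()
    · simp [ha, hF]
    · simp [ha, List.derivProd, Finsupp.single_eq_of_ne ha]

theorem toH_coe (t : NTree I) : t.1.toH k = FreeAlgebra.ι k t := by
  obtain ⟨t, ht⟩ := t
  cases t with
  | leaf a => exact absurd rfl ht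
  | node i ts => rfl

theorem toH_leaf (a : Unit) : (leaf a : PTree I Unit).toH k = 1 := rfl

theorem counit_toH (t : PTree I Unit) [Decidable (t = leaf ())] :
    Coalgebra.counit (R := k) (t.toH k) = if t = leaf () then 1 else 0 := by
  split_ifs with h
  · subst h
    exact Bialgebra.counit_one
  · cases t with
    | leaf a => exact absurd rfl h
    | node i ts => exact counitH_toH_node k i ts

end PTree

section Convolution

open WithConv

variable {k : Type u} [Field k] {I : ℕ → Type u}

theorem convMul_toH (α β : Hred k I →ₗ[k] k) (t : PTree I Unit) :
    (toConv α * toConv β).ofConv (t.toH k) =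
      ∑ c : t.Cut, α (t.pruneH k c) * β ((t.trunk c).toH k) := by
  have h : Coalgebra.comul (R := k) (t.toH k) = ∑ c : t.Cut,
      t.pruneH k c ⊗ₜ[k] (t.trunk c).toH k := comulH_toH k t
  refine (LinearMap.convMul_apply (toConv α) (toConv β) (t.toH k)).trans ?_
  rw [h]
  simp

/-! ### Characters -/

theorem algHom_pruneH (φ : Hred k I →ₐ[k] k) (t : PTree I Unit) (c : t.Cut) :
    φ (t.pruneH k c) = ((t.pruneAll c).map fun s => φ (s.toH k)).prod := by
  rw [PTree.prod_map_prune (by rw [PTree.toH_leaf, map_one]), PTree.pruneH, map_list_prod,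
    List.map_map]
  rfl

theorem char_mul_toH (φ ψ : WithConv (Hred k I →ₐ[k] k)) (t : PTree I Unit) :
    (φ * ψ).ofConv (t.toH k) = ∑ c : t.Cut, ψ.ofConv ((t.trunk c).toH k) *
      ((t.pruneAll c).map fun s => φ.ofConv (s.toH k)).prod := by
  refine (convMul_toH φ.ofConv.toLinearMap ψ.ofConv.toLinearMap t).trans ?_
  refine Finset.sum_congr rfl fun c _ => ?_
  rw [mul_comm]
  exact congrArg _ (algHom_pruneH φ.ofConv t c)

theorem char_ext {φ ψ : WithConv (Hred k I →ₐ[k] k)}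
    (h : ∀ t : PTree I Unit, φ.ofConv (t.toH k) = ψ.ofConv (t.toH k)) : φ = ψ := by
  refine ofConv_injective (FreeAlgebra.hom_ext (funext fun t => ?_))
  simpa only [PTree.toH_coe, Function.comp_apply] using h t.1

/-- The character with given values on trees. -/
noncomputable def charOf (F : PTree I Unit → k) : WithConv (Hred k I →ₐ[k] k) :=
  toConv (FreeAlgebra.lift k fun t : NTree I => F t.1)

theorem charOf_toH {F : PTree I Unit → k} (hF : F (.leaf ()) = 1) (t : PTree I Unit) :
    (charOf F).ofConv (t.toH k) = F t := by
  by_cases h : t = .leaf ()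
  · rw [h, PTree.toH_leaf, map_one, hF]
  · exact (congrArg (charOf F).ofConv (PTree.toH_coe ⟨t, h⟩)).trans (FreeAlgebra.lift_ι_apply _ _)

open Classical in
/-- The values on trees of the convolution inverse of a character. -/
noncomputable def charInv (φ : WithConv (Hred k I →ₐ[k] k)) (t : PTree I Unit) : k :=
  if t = .leaf () then 1 else
    -∑ c : {c : t.Cut // c ≠ t.emptyCut}, φ.ofConv (t.pruneH k c.1) * charInv φ (t.trunk c.1)
termination_by Nat.card t.Leaf
decreasing_by exact PTree.card_leaf_trunk_lt c.2

theorem mul_charInv (φ : WithConv (Hred k I →ₐ[k] k)) : φ * charOf (charInv φ) = 1 := by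
  classical
  refine char_ext fun t => ?_
  have h1 : charInv φ (.leaf ()) = 1 := by rw [charInv, if_pos rfl]
  refine (convMul_toH φ.ofConv.toLinearMap (charOf (charInv φ)).ofConv.toLinearMap t).trans ?_
  simp only [AlgHom.toLinearMap_apply, charOf_toH h1]
  refine Eq.trans ?_ (PTree.counit_toH t).symm
  split_ifs with ht
  · subst ht
    refine (PTree.sum_cut_leaf () _).trans ?_
    change φ.ofConv 1 * charInv φ (.leaf ()) = 1
    rw [map_one, h1, one_mul]
  · rw [← Finset.add_sum_erase _ _ (Finset.mem_univ t.emptyCut), PTree.trunk_emptyCut,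
      PTree.pruneH, (PTree.prune_eq_nil_iff t _).2 rfl, List.map_nil, List.prod_nil, map_one,
      one_mul, charInv, if_neg ht, neg_add_eq_zero, Finset.sum_subtype (Finset.univ.erase _)]
    intro c
    simp

theorem isUnit_char (φ : WithConv (Hred k I →ₐ[k] k)) : IsUnit φ := by
  have h := mul_charInv φ
  have h' := mul_charInv (charOf (charInv φ))
  have e := left_inv_eq_right_inv h h'
  exact ⟨⟨φ, charOf (charInv φ), h, (congrArg (charOf (charInv φ) * ·) e).trans h'⟩, rfl⟩

/-! ### Infinitesimal characters -/

theorem infChar_one {H : Type u} [Ring H] [Bialgebra k H] {α : H →ₗ[k] k}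
    (hα : α ∈ infChar k H) : α 1 = 0 := by
  have h := hα 1 1
  rw [Bialgebra.counit_one, mul_one, mul_one, one_mul] at h
  exact left_eq_add.1 h

/-- The commutator of infinitesimal characters is an infinitesimal character. -/
theorem infChar_commutator {H : Type u} [Ring H] [Bialgebra k H] {α β : H →ₗ[k] k}
    (hα : α ∈ infChar k H) (hβ : β ∈ infChar k H) :
    (toConv α * toConv β - toConv β * toConv α).ofConv ∈ infChar k H := by
  have key : ∀ {α β : H →ₗ[k] k}, α ∈ infChar k H → β ∈ infChar k H → ∀ x y : H,
      (toConv α * toConv β).ofConv (x * y) =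
        (toConv α * toConv β).ofConv x * Coalgebra.counit y + α x * β y + β x * α y +
          Coalgebra.counit x * (toConv α * toConv β).ofConv y := by
    intro α β hα hβ x y
    let ε : H →ₗ[k] k := Coalgebra.counit
    let 𝓡 := Coalgebra.Repr.arbitrary k x
    let 𝓢 := Coalgebra.Repr.arbitrary k y
    have hc : ∀ (γ δ : H →ₗ[k] k) (z : H), (toConv γ * toConv δ).ofConv z =
        ∑ i ∈ (Coalgebra.Repr.arbitrary k z).index, γ ((Coalgebra.Repr.arbitrary k z).left i) *
          δ ((Coalgebra.Repr.arbitrary k z).right i) := fun γ δ z =>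
      (Coalgebra.Repr.arbitrary k z).convMul_apply (toConv γ) (toConv δ)
    have hε : ∀ γ : H →ₗ[k] k, toConv γ * toConv ε = toConv γ := fun γ => mul_one (toConv γ)
    have hε' : ∀ γ : H →ₗ[k] k, toConv ε * toConv γ = toConv γ := fun γ => one_mul (toConv γ)
    have h0 : Coalgebra.comul (R := k) (x * y) = ∑ i ∈ 𝓡.index, ∑ j ∈ 𝓢.index,
        (𝓡.left i * 𝓢.left j) ⊗ₜ[k] (𝓡.right i * 𝓢.right j) := by
      rw [Bialgebra.comul_mul, ← 𝓡.eq, ← 𝓢.eq, Finset.sum_mul_sum]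
      simp only [Algebra.TensorProduct.tmul_mul_tmul]
    have h1 : (toConv α * toConv β).ofConv (x * y) = ∑ i ∈ 𝓡.index, ∑ j ∈ 𝓢.index,
        α (𝓡.left i * 𝓢.left j) * β (𝓡.right i * 𝓢.right j) := by
      refine (LinearMap.convMul_apply (toConv α) (toConv β) (x * y)).trans ?_
      rw [h0]
      simp
    have h2 : (toConv α * toConv β).ofConv x * ε y + α x * β y + β x * α y +
        ε x * (toConv α * toConv β).ofConv y =
        (toConv α * toConv β).ofConv x * (toConv ε * toConv ε).ofConv y +
        (toConv α * toConv ε).ofConv x * (toConv ε * toConv β).ofConv y +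
        (toConv ε * toConv β).ofConv x * (toConv α * toConv ε).ofConv y +
        (toConv ε * toConv ε).ofConv x * (toConv α * toConv β).ofConv y := by
      rw [hε, hε, hε']
    refine h1.trans (Eq.trans ?_ h2.symm)
    simp only [hc, Finset.sum_mul_sum, ← Finset.sum_add_distrib]
    refine Finset.sum_congr rfl fun i _ => Finset.sum_congr rfl fun j _ => ?_
    rw [hα, hβ]
    simp only [ε, 𝓡, 𝓢]
    ring
  intro x y
  have h1 := key hα hβ x y
  have h2 := key hβ hα x y
  change (toConv α * toConv β).ofConv (x * y) - (toConv β * toConv α).ofConv (x * y) =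
    ((toConv α * toConv β).ofConv x - (toConv β * toConv α).ofConv x) * _ +
    _ * ((toConv α * toConv β).ofConv y - (toConv β * toConv α).ofConv y)
  rw [h1, h2]
  ring

theorem infChar_prod {α : Hred k I →ₗ[k] k} (hα : α ∈ infChar k (Hred k I))
    (l : List (PTree I Unit)) (hl : ∀ t ∈ l, t ≠ .leaf ()) :
    α (l.map (PTree.toH k)).prod = l.derivProd (fun _ => 0) fun t => α (t.toH k) := by
  classical
  have h1 : ∀ l : List (PTree I Unit), (∀ t ∈ l, t ≠ .leaf ()) →
      Coalgebra.counit (R := k) (l.map (PTree.toH k)).prod = (l.map fun _ => (0 : k)).prod := by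
    intro l hl
    induction l with
    | nil => exact Bialgebra.counit_one
    | cons t l ih =>
      rw [List.map_cons, List.prod_cons, Bialgebra.counit_mul, PTree.counit_toH,
        if_neg (hl t List.mem_cons_self), List.map_cons, List.prod_cons, zero_mul, zero_mul]
  induction l with
  | nil => exact infChar_one hα
  | cons t l ih =>
    rw [List.map_cons, List.prod_cons, hα, PTree.counit_toH, if_neg (hl t List.mem_cons_self),
      h1 l fun t ht => hl t (List.mem_cons_of_mem _ ht), List.derivProd,
      ih fun t ht => hl t (List.mem_cons_of_mem _ ht)]

theorem infChar_mul_toH {α β : Hred k I →ₗ[k] k} (hα : α ∈ infChar k (Hred k I))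
    (t : PTree I Unit) :
    (toConv α * toConv β).ofConv (t.toH k) = ∑ c : t.Cut, β ((t.trunk c).toH k) *
      (t.prune c).derivProd (fun _ => 0) fun s => α (s.toH k) := by
  refine (convMul_toH α β t).trans (Finset.sum_congr rfl fun c _ => ?_)
  rw [mul_comm]
  exact congrArg _ (infChar_prod hα _ fun s hs => PTree.ne_leaf_of_mem_prune hs)

theorem basisFreeMonoid_apply {X : Type*} (w : FreeMonoid X) :
    FreeAlgebra.basisFreeMonoid k X w = (w.toList.map (FreeAlgebra.ι k)).prod := by
  have h : FreeAlgebra.basisFreeMonoid k X w =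
      FreeAlgebra.equivMonoidAlgebraFreeMonoid.symm (MonoidAlgebra.single w 1) := rfl
  rw [h]
  refine (MonoidAlgebra.lift_single (FreeMonoid.lift (FreeAlgebra.ι k)) w (1 : k)).trans ?_
  rw [one_smul, FreeMonoid.lift_apply]

theorem infChar_ext {α β : Hred k I →ₗ[k] k} (hα : α ∈ infChar k (Hred k I))
    (hβ : β ∈ infChar k (Hred k I)) (h : ∀ t : NTree I, α (t.1.toH k) = β (t.1.toH k)) :
    α = β := by
  refine (FreeAlgebra.basisFreeMonoid k (NTree I)).ext fun w => ?_
  rw [basisFreeMonoid_apply]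
  have h1 : w.toList.map (FreeAlgebra.ι k) = (w.toList.map Subtype.val).map (PTree.toH k) := by
    rw [List.map_map]
    exact List.map_congr_left fun t _ => (PTree.toH_coe t).symm
  have h2 : ∀ t ∈ w.toList.map Subtype.val, t ≠ .leaf () := by
    intro t ht
    obtain ⟨t, _, rfl⟩ := List.mem_map.1 ht
    exact t.2
  rw [h1, infChar_prod hα _ h2, infChar_prod hβ _ h2, List.derivProd_map, List.derivProd_map]
  exact congrArg (fun g => List.derivProd _ g _) (funext h)

/-- The infinitesimal character with given values on trees. -/
noncomputable def infOf (g : NTree I → k) : Hred k I →ₗ[k] k :=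
  (FreeAlgebra.basisFreeMonoid k (NTree I)).constr k fun w => w.toList.derivProd (fun _ => 0) g

theorem infOf_basis (g : NTree I → k) (w : FreeMonoid (NTree I)) :
    infOf g (FreeAlgebra.basisFreeMonoid k (NTree I) w) =
      w.toList.derivProd (fun _ => 0) g :=
  Module.Basis.constr_basis _ _ _ _

theorem infOf_toH (g : NTree I → k) (t : NTree I) : infOf g (t.1.toH k) = g t := by
  have h := infOf_basis g (FreeMonoid.of t)
  rw [basisFreeMonoid_apply] at h
  simpa [List.derivProd, PTree.toH_coe] using h

theorem infOf_mem (g : NTree I → k) : infOf g ∈ infChar k (Hred k I) := by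
  let b := FreeAlgebra.basisFreeMonoid k (NTree I)
  let ε : Hred k I →ₗ[k] k := Coalgebra.counit
  have hb : ∀ w w', b w * b w' = b (w * w') := by
    intro w w'
    simp only [b, basisFreeMonoid_apply, FreeMonoid.toList_mul, List.map_append, List.prod_append]
  have hε : ∀ w, ε (b w) = (w.toList.map fun _ => (0 : k)).prod := by
    intro w
    simp only [b, basisFreeMonoid_apply]
    refine (map_list_prod (counitH k I) _).trans ?_
    rw [List.map_map]
    exact congrArg List.prod (List.map_congr_left fun t _ => FreeAlgebra.lift_ι_apply _ _)
  have key : (LinearMap.mul k (Hred k I)).compr₂ (infOf g) =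
      (LinearMap.mul k k).compl₁₂ (infOf g) ε + (LinearMap.mul k k).compl₁₂ ε (infOf g) := by
    refine b.ext fun w => b.ext fun w' => ?_
    change infOf g (b w * b w') = infOf g (b w) * ε (b w') + ε (b w) * infOf g (b w')
    rw [hb, infOf_basis, infOf_basis, infOf_basis, hε, hε, FreeMonoid.toList_mul,
      List.derivProd_append]
  exact fun x y => LinearMap.congr_fun₂ key x y

end Convolution

section Final

open WithConv Operad

variable {k : Type u} [Field k] {I : ℕ → Type u}

/-! ### The normalized dual basis and the Lie algebra -/

/-- The coefficients of a linear combination of trees different from the one-edge tree. -/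
noncomputable def extendZero : (NTree I →₀ k) →ₗ[k] (PTree I Unit →₀ k) :=
  Finsupp.lmapDomain k k Subtype.val

theorem extendZero_single (t : NTree I) (c : k) :
    extendZero (Finsupp.single t c) = Finsupp.single t.1 c :=
  Finsupp.mapDomain_single

theorem extendZero_coe (x : NTree I →₀ k) (t : NTree I) : extendZero x t.1 = x t :=
  Finsupp.mapDomain_apply Subtype.val_injective x t

theorem extendZero_leaf (x : NTree I →₀ k) : extendZero x (.leaf ()) = 0 :=
  Finsupp.mapDomain_of_notMem_range _ _ fun ⟨t, ht⟩ => t.2 ht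

theorem deltaPrime_spanToH (x : NTree I →₀ k) : deltaPrime k (spanToH k x) = infOf x := by
  have h : ∀ t : NTree I, deltaPrime k (FreeAlgebra.ι k t) = infOf (Finsupp.single t (1 : k)) := by
    intro t
    have ht : FreeAlgebra.ι k t = FreeAlgebra.basisFreeMonoid k (NTree I) (FreeMonoid.of t) := by
      rw [basisFreeMonoid_apply]
      simp
    refine (FreeAlgebra.basisFreeMonoid k (NTree I)).ext fun w => ?_
    rw [infOf_basis, ht, deltaPrime, Module.Basis.constr_basis]
    simp only [FreeMonoid.toList_of, List.map_cons, List.map_nil, List.prod_singleton,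
      PTree.sigma_eq_one, Nat.cast_one, one_smul, Module.Basis.coord_apply,
      Module.Basis.repr_self]
    match w with
    | [] => exact Finsupp.single_eq_of_ne (List.cons_ne_nil t [])
    | [s] =>
      refine Eq.trans ?_ (by simp [List.derivProd] :
        Finsupp.single t (1 : k) s = List.derivProd (fun _ => 0) (Finsupp.single t (1 : k)) [s])
      by_cases hs : s = t
      · subst hs
        exact (Finsupp.single_eq_same).trans Finsupp.single_eq_same.symm
      · rw [Finsupp.single_eq_of_ne hs]
        exact Finsupp.single_eq_of_ne fun h => hs (List.cons.inj h).1.symm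
    | s :: s' :: l =>
      refine Eq.trans ?_ (by simp [List.derivProd] :
        (0 : k) = List.derivProd (fun _ => 0) (Finsupp.single t (1 : k)) (s :: s' :: l))
      exact Finsupp.single_eq_of_ne fun h => List.cons_ne_nil _ _ (List.cons.inj h).2.symm
  have hlin : ∀ x : NTree I →₀ k, ∀ t : NTree I, deltaPrime k (spanToH k x) (t.1.toH k) = x t := by
    intro x t
    refine LinearMap.congr_fun (f := LinearMap.applyₗ (t.1.toH k) ∘ₗ deltaPrime k ∘ₗ spanToH k)
      (g := Finsupp.lapply t) ?_ x
    refine Finsupp.lhom_ext' fun s => LinearMap.ext_ring ?_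
    simp [spanToH, h, infOf_toH]
  refine infChar_ext ?_ (infOf_mem _) fun t => by rw [hlin, infOf_toH]
  induction x using Finsupp.induction_linear with
  | zero => simp
  | add x y hx hy => rw [map_add, map_add]; exact add_mem hx hy
  | single t c =>
    rw [spanToH, Finsupp.linearCombination_single, map_smul, h]
    exact Submodule.smul_mem _ _ (infOf_mem _)

theorem infOf_toH_eq (x : NTree I →₀ k) (t : PTree I Unit) :
    infOf x (t.toH k) = extendZero x t := by
  by_cases h : t = .leaf ()
  · rw [h, extendZero_leaf]
    exact infChar_one (infOf_mem x)
  · exact (infOf_toH _ ⟨t, h⟩).trans (extendZero_coe x ⟨t, h⟩).symm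

theorem extendZero_graftSigma (x y : NTree I →₀ k) (v : PTree I Unit) :
    extendZero (graftSigma k x y) v = ∑ c : v.Cut, extendZero y (v.trunk c) *
      (v.prune c).derivProd (fun _ => 0) (extendZero x) := by
  classical
  have hsingle : ∀ (t : PTree I Unit) (l : List (PTree I Unit)),
      l.derivProd (fun _ => (0 : k)) (Finsupp.single t 1) = if l = [t] then 1 else 0 := by
    intro t l
    match l with
    | [] => simp [List.derivProd]
    | [a] => simp [List.derivProd, Finsupp.single_apply, eq_comm]
    | a :: b :: l => simp [List.derivProd]
  have hadd : ∀ (x y : PTree I Unit →₀ k) (l : List (PTree I Unit)),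
      l.derivProd (fun _ => (0 : k)) (x + y) =
        l.derivProd (fun _ => 0) x + l.derivProd (fun _ => 0) y := by
    intro x y l
    induction l with
    | nil => simp [List.derivProd]
    | cons a l ih => simp [List.derivProd, add_mul]
  have hsmul : ∀ (c : k) (x : PTree I Unit →₀ k) (l : List (PTree I Unit)),
      l.derivProd (fun _ => (0 : k)) (c • x) = c * l.derivProd (fun _ => 0) x := by
    intro c x l
    cases l <;> simp [List.derivProd, mul_assoc]
  let D : List (PTree I Unit) → (PTree I Unit →₀ k) →ₗ[k] k := fun l =>
    { toFun := fun x => l.derivProd (fun _ => 0) x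
      map_add' := fun x y => hadd x y l
      map_smul' := fun c x => hsmul c x l }
  refine LinearMap.congr_fun₂
    (f := (graftSigma k).compr₂ (Finsupp.lapply v ∘ₗ extendZero))
    (g := ∑ c : v.Cut, ((LinearMap.mul k k).compl₁₂ (D (v.prune c) ∘ₗ extendZero)
      (Finsupp.lapply (v.trunk c) ∘ₗ extendZero))) ?_ x y |>.trans ?_
  · refine Finsupp.lhom_ext' fun t => LinearMap.ext_ring ?_
    refine Finsupp.lhom_ext' fun u => LinearMap.ext_ring ?_
    have h := PTree.sum_cut_eq_sum_leaf k t.2 u.1 v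
    change extendZero (graftSigma k (Finsupp.single t 1) (Finsupp.single u 1)) v =
      (∑ c : v.Cut, ((LinearMap.mul k k).compl₁₂ (D (v.prune c) ∘ₗ extendZero)
        (Finsupp.lapply (v.trunk c) ∘ₗ extendZero))) (Finsupp.single t 1) (Finsupp.single u 1)
    rw [graftSigma_single, map_sum, Finsupp.finsetSum_apply]
    simp only [extendZero_single, Finsupp.single_apply, LinearMap.sum_apply]
    refine (h.symm.trans (Finset.sum_congr rfl fun c _ => ?_))
    change _ = (v.prune c).derivProd (fun _ => (0 : k)) (extendZero (Finsupp.single t 1)) *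
      extendZero (Finsupp.single u 1) (v.trunk c)
    rw [extendZero_single, extendZero_single, hsingle, Finsupp.single_apply]
    by_cases hp : v.prune c = [t.1]
    · rw [if_pos hp, if_pos hp, one_mul]
      exact if_congr eq_comm rfl rfl
    · rw [if_neg hp, if_neg hp, zero_mul]
  · simp only [LinearMap.sum_apply, LinearMap.compl₁₂_apply]
    exact Finset.sum_congr rfl fun c _ => mul_comm _ _

theorem infOf_mul_toH (x y : NTree I →₀ k) (t : PTree I Unit) :
    (toConv (infOf x) * toConv (infOf y)).ofConv (t.toH k) = infOf (graftSigma k x y) (t.toH k) := by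
  rw [infChar_mul_toH (infOf_mem _)]
  simp only [infOf_toH_eq]
  exact (extendZero_graftSigma x y t).symm

theorem deltaPrime_bracket (x y : NTree I →₀ k) :
    toConv (deltaPrime k (spanToH k x)) * toConv (deltaPrime k (spanToH k y)) -
        toConv (deltaPrime k (spanToH k y)) * toConv (deltaPrime k (spanToH k x)) =
      toConv (deltaPrime k (spanToH k (graftSigma k x y - graftSigma k y x))) := by
  rw [map_sub, map_sub]
  simp only [deltaPrime_spanToH]
  refine ofConv_injective (infChar_ext (infChar_commutator (infOf_mem _) (infOf_mem _))
    (sub_mem (infOf_mem _) (infOf_mem _)) fun t => ?_)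
  exact congrArg₂ (· - ·) (infOf_mul_toH x y t.1) (infOf_mul_toH y x t.1)

/-! ### Linear combinations of trees as series -/

theorem coeff_treeSeries (x : NTree I →₀ k) : coeff (treeSeries k x) = extendZero x := by
  refine (LinearMap.congr_fun (f := coeff ∘ₗ treeSeries k)
    (g := Finsupp.lcoeFun ∘ₗ extendZero) ?_ x)
  refine Finsupp.lhom_ext' fun t => LinearMap.ext_ring ?_
  funext v
  obtain ⟨N, hN⟩ : ∃ N, Nat.card v.Leaf = N + 1 := Nat.exists_eq_add_one.2 v.card_leaf_pos
  change coeff (treeSeries k (Finsupp.single t 1)) v = extendZero (Finsupp.single t 1) v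
  rw [coeff_apply _ hN, treeSeries, Finsupp.linearCombination_single, one_smul, extendZero_single]
  by_cases ht : Nat.card t.1.Leaf = N + 1
  · rw [coinvShape_treeClass ht]
  · rw [treeClass_of_card_ne ht, map_zero, Finsupp.zero_apply, Finsupp.single_eq_of_ne]
    rintro rfl
    exact ht hN

theorem treeSeries_injective : Function.Injective (treeSeries k (I := I)) := by
  intro x y h
  refine Finsupp.mapDomain_injective (f := (Subtype.val : NTree I → PTree I Unit))
    Subtype.val_injective (DFunLike.coe_injective ?_)
  change ⇑(extendZero x) = ⇑(extendZero y)
  rw [← coeff_treeSeries, h, coeff_treeSeries]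

theorem treeSeries_graftSigma (x y : NTree I →₀ k) :
    treeSeries k (graftSigma k x y) =
      (treeOperad k I).preLie (treeSeries k y) (treeSeries k x) := by
  refine coeff_injective (funext fun v => ?_)
  rw [coeff_treeSeries, coeff_preLie, extendZero_graftSigma]
  refine Finset.sum_congr rfl fun c _ => ?_
  rw [PTree.derivProd_prune (by rw [coeff_treeSeries, extendZero_leaf]), coeff_treeSeries,
    coeff_treeSeries]

theorem treeSeries_bracket (x y : NTree I →₀ k) :
    treeSeries k (graftSigma k x y - graftSigma k y x) =
      -(treeOperad k I).lieBracket (treeSeries k x) (treeSeries k y) := by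
  rw [map_sub, treeSeries_graftSigma, treeSeries_graftSigma, lieBracket, neg_sub]

theorem PTree.card_leaf_eq_one {t : PTree I Unit} (h : Nat.card t.Leaf = 1) : t = .leaf () := by
  have := (Nat.card_eq_one_iff_unique.1 h).1
  exact t.eq_leaf_of_subsingleton.choose_spec

theorem coinvShape_zero_eq (f : (treeOperad k I).Series) :
    coinvShape 0 (f 0) = Finsupp.single (.leaf ()) (coeff f (.leaf ())) := by
  have h1 : Nat.card (PTree.leaf () : PTree I Unit).Leaf = 0 + 1 := Nat.card_unique (α := Unit)
  ext t
  by_cases ht : Nat.card t.Leaf = 0 + 1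
  · rw [PTree.card_leaf_eq_one ht, Finsupp.single_eq_same, coeff_apply f h1]
  · rw [coinvShape_apply_of_card_ne _ ht, Finsupp.single_eq_of_ne]
    rintro rfl
    exact ht h1

theorem mem_lieE_iff (f : (treeOperad k I).Series) :
    f ∈ (treeOperad k I).lieE ↔ coeff f (.leaf ()) = 0 := by
  have h : f ∈ (treeOperad k I).lieE ↔ f 0 = 0 := LinearMap.mem_ker
  rw [h, ← (coinvShape_injective 0).eq_iff, map_zero, coinvShape_zero_eq, Finsupp.single_eq_zero]

theorem eq_cls_one_iff (f : (treeOperad k I).Series) :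
    f 0 = (treeOperad k I).cls 0 (treeOperad k I).one ↔ coeff f (.leaf ()) = 1 := by
  have h : coinvShape 0 ((treeOperad k I).cls 0 (treeOperad k I).one) =
      Finsupp.single (.leaf ()) (1 : k) :=
    (coinvShape_cls (A := Unit) Nat.card_unique _).trans (shapeMap_single k LTree.one 1)
  rw [← (coinvShape_injective 0).eq_iff, h, coinvShape_zero_eq]
  exact (Finsupp.single_injective _).eq_iff

theorem mem_range_treeSeries (f : (treeOperad k I).Series) :
    f ∈ LinearMap.range (treeSeries k (I := I)) ↔
      f ∈ (treeOperad k I).lieE ∧ {n | f n ≠ 0}.Finite := by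
  constructor
  · rintro ⟨x, rfl⟩
    refine ⟨(mem_lieE_iff _).2 (by rw [coeff_treeSeries, extendZero_leaf]), ?_⟩
    refine ((extendZero x).support.finite_toSet.image fun t => Nat.card t.Leaf - 1).subset ?_
    intro n hn
    have h0 : coinvShape n (treeSeries k x n) ≠ 0 := fun h =>
      hn (coinvShape_injective n (h.trans (map_zero _).symm))
    obtain ⟨t, ht⟩ := DFunLike.ne_iff.1 h0
    have hc : Nat.card t.Leaf = n + 1 := by
      by_contra hc
      exact ht (coinvShape_apply_of_card_ne _ hc)
    refine ⟨t, Finsupp.mem_support_iff.2 ?_, by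
      change Nat.card t.Leaf - 1 = n
      omega⟩
    rw [← coeff_treeSeries, coeff_apply _ hc]
    exact ht
  · rintro ⟨h0, hf⟩
    let Z : PTree I Unit →₀ k := ∑ n ∈ hf.toFinset, coinvShape n (f n)
    have hZ : ∀ t, Z t = coeff f t := by
      intro t
      obtain ⟨N, hN⟩ : ∃ N, Nat.card t.Leaf = N + 1 := Nat.exists_eq_add_one.2 t.card_leaf_pos
      rw [Finsupp.finsetSum_apply, Finset.sum_eq_single N, coeff_apply f hN]
      · exact fun n _ hn => coinvShape_apply_of_card_ne _ (by omega)
      · intro h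
        have h' : f N = 0 := by simpa using h
        rw [h', map_zero, Finsupp.zero_apply]
    refine ⟨Z.comapDomain Subtype.val Subtype.val_injective.injOn, coeff_injective ?_⟩
    rw [coeff_treeSeries]
    funext t
    by_cases ht : t = .leaf ()
    · rw [ht, extendZero_leaf, (mem_lieE_iff f).1 h0]
    · rw [← hZ]
      exact extendZero_coe _ ⟨t, ht⟩

theorem hyperSeries_injective : Function.Injective (hyperSeries k (I := I)) :=
  treeSeries_injective.comp (Finsupp.mapDomain_injective (PhiN I).symm.injective)

theorem range_hyperSeries :
    LinearMap.range (hyperSeries k (I := I)) = LinearMap.range (treeSeries k (I := I)) := by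
  refine LinearMap.range_comp_of_range_eq_top _ (LinearMap.range_eq_top.2 fun x => ?_)
  exact ⟨Finsupp.lmapDomain k k (PhiN I) x, by simp [← Finsupp.mapDomain_comp]⟩

theorem hyperSeries_bracket (x y : HNTree I →₀ k) :
    hyperSeries k (graftHyper k x y - graftHyper k y x) =
      -(treeOperad k I).lieBracket (hyperSeries k x) (hyperSeries k y) := by
  have h : ∀ x y : HNTree I →₀ k, Finsupp.lmapDomain k k (PhiN I).symm (graftHyper k x y) =
      graftSigma k (Finsupp.lmapDomain k k (PhiN I).symm x)
        (Finsupp.lmapDomain k k (PhiN I).symm y) := fun x y => by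
    simp [graftHyper, ← Finsupp.mapDomain_comp]
  refine Eq.trans ?_ (treeSeries_bracket _ _)
  rw [hyperSeries, LinearMap.comp_apply, map_sub, h, h]

/-! ### Characters and infinitesimal characters as series -/

/-- The series with given coefficients. -/
noncomputable def ofCoeff (F : PTree I Unit → k) : (treeOperad k I).Series := fun N =>
  ∑ᶠ t : {t : PTree I Unit // Nat.card t.Leaf = N + 1}, F t.1 • treeClass k N t.1

theorem coeff_ofCoeff (hI : ∀ n, Finite (I n)) (F : PTree I Unit → k) :
    coeff (ofCoeff F) = F := by
  funext v
  obtain ⟨N, hN⟩ : ∃ N, Nat.card v.Leaf = N + 1 := Nat.exists_eq_add_one.2 v.card_leaf_pos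
  have := PTree.finite_card_leaf_eq hI N
  have := Fintype.ofFinite {t : PTree I Unit // Nat.card t.Leaf = N + 1}
  rw [coeff_apply _ hN, ofCoeff, finsum_eq_sum_of_fintype, map_sum, Finsupp.finsetSum_apply,
    Finset.sum_eq_single ⟨v, hN⟩]
  · rw [map_smul, coinvShape_treeClass hN, Finsupp.smul_apply, Finsupp.single_eq_same, smul_eq_mul,
      mul_one]
  · intro t _ ht
    rw [map_smul, coinvShape_treeClass t.2, Finsupp.smul_apply, Finsupp.single_eq_of_ne, smul_zero]
    exact fun h => ht (Subtype.ext h.symm)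
  · exact fun h => absurd (Finset.mem_univ _) h

/-- The element of `G^e` attached to a character, when the sets of decorations are finite. -/
noncomputable def charToGroup (hI : ∀ n, Finite (I n)) (φ : WithConv (Hred k I →ₐ[k] k)) :
    (treeOperad k I).GroupE :=
  ⟨ofCoeff fun t => φ.ofConv (t.toH k), by
    rw [eq_cls_one_iff, coeff_ofCoeff hI, PTree.toH_leaf, map_one]⟩

theorem coeff_charToGroup (hI : ∀ n, Finite (I n)) (φ : WithConv (Hred k I →ₐ[k] k)) :
    coeff (charToGroup hI φ).1 = fun t => φ.ofConv (t.toH k) :=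
  coeff_ofCoeff hI fun t => φ.ofConv (t.toH k)

theorem charToGroup_mul (hI : ∀ n, Finite (I n)) (φ ψ : WithConv (Hred k I →ₐ[k] k)) :
    charToGroup hI (φ * ψ) = charToGroup hI ψ * charToGroup hI φ := by
  refine Subtype.ext (coeff_injective (funext fun v => ?_))
  change _ = coeff ((treeOperad k I).seriesComp (charToGroup hI ψ).1 (charToGroup hI φ).1) v
  rw [coeff_seriesComp, coeff_charToGroup, coeff_charToGroup, coeff_charToGroup]
  exact char_mul_toH φ ψ v

theorem charToGroup_bijective (hI : ∀ n, Finite (I n)) :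
    Function.Bijective (charToGroup (k := k) hI) := by
  refine ⟨fun φ ψ h => char_ext fun t => ?_, fun g => ?_⟩
  · have h' := congrArg (fun g : (treeOperad k I).GroupE => coeff g.1) h
    simp only [coeff_charToGroup] at h'
    exact congrFun h' t
  · refine ⟨charOf (coeff g.1), Subtype.ext (coeff_injective ?_)⟩
    rw [coeff_charToGroup]
    exact funext fun t => charOf_toH ((eq_cls_one_iff _).1 g.2) t

/-- Characters as series, when the sets of decorations are finite. -/
noncomputable def charSeries (hI : ∀ n, Finite (I n)) :
    WithConv (Hred k I →ₐ[k] k) ≃* (treeOperad k I).GroupEᵐᵒᵖ :=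
  { (Equiv.ofBijective _ (charToGroup_bijective hI)).trans MulOpposite.opEquiv with
    map_mul' := fun φ ψ => congrArg MulOpposite.op (charToGroup_mul hI φ ψ) }

theorem ofCoeff_add (hI : ∀ n, Finite (I n)) (F G : PTree I Unit → k) :
    ofCoeff (F + G) = ofCoeff F + ofCoeff G :=
  coeff_injective (by rw [map_add, coeff_ofCoeff hI, coeff_ofCoeff hI, coeff_ofCoeff hI])

theorem ofCoeff_smul (hI : ∀ n, Finite (I n)) (c : k) (F : PTree I Unit → k) :
    ofCoeff (c • F) = c • ofCoeff F :=
  coeff_injective (by rw [map_smul, coeff_ofCoeff hI, coeff_ofCoeff hI])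

/-- `ofCoeff` as a linear map, when the sets of decorations are finite. -/
noncomputable def ofCoeffLinear (hI : ∀ n, Finite (I n)) :
    (PTree I Unit → k) →ₗ[k] (treeOperad k I).Series where
  toFun := ofCoeff
  map_add' := ofCoeff_add hI
  map_smul' := ofCoeff_smul hI

/-- The values on trees of an infinitesimal character. -/
noncomputable def infValues : infChar k (Hred k I) →ₗ[k] (PTree I Unit → k) where
  toFun α t := α.1 (t.toH k)
  map_add' _ _ := rfl
  map_smul' _ _ := rfl

theorem infValues_injective : Function.Injective (infValues (k := k) (I := I)) :=
  fun α β h => Subtype.ext (infChar_ext α.2 β.2 fun t => congrFun h t.1)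

theorem infValues_infOf (F : PTree I Unit → k) (hF : F (.leaf ()) = 0) :
    infValues ⟨infOf fun t => F t.1, infOf_mem _⟩ = F := by
  funext t
  by_cases ht : t = .leaf ()
  · rw [ht, hF]
    exact infChar_one (infOf_mem _)
  · exact infOf_toH _ ⟨t, ht⟩

/-- Infinitesimal characters as elements of the Lie algebra of series. -/
noncomputable def infSeriesHom (hI : ∀ n, Finite (I n)) :
    infChar k (Hred k I) →ₗ[k] (treeOperad k I).lieE :=
  LinearMap.codRestrict (treeOperad k I).lieE (ofCoeffLinear hI ∘ₗ infValues) fun α =>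
    (mem_lieE_iff _).2 ((congrFun (coeff_ofCoeff hI _) _).trans (infChar_one α.2))

theorem coeff_infSeriesHom (hI : ∀ n, Finite (I n)) (α : infChar k (Hred k I)) :
    coeff (infSeriesHom hI α).1 = infValues α :=
  coeff_ofCoeff hI _

theorem infSeriesHom_bijective (hI : ∀ n, Finite (I n)) :
    Function.Bijective (infSeriesHom (k := k) hI) := by
  refine ⟨fun α β h => infValues_injective ?_, fun f => ?_⟩
  · rw [← coeff_infSeriesHom hI, h, coeff_infSeriesHom hI]
  · refine ⟨⟨infOf fun t => coeff f.1 t.1, infOf_mem _⟩, Subtype.ext (coeff_injective ?_)⟩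
    exact (coeff_infSeriesHom hI _).trans (infValues_infOf _ ((mem_lieE_iff f.1).1 f.2))

/-- Infinitesimal characters as series, when the sets of decorations are finite. -/
noncomputable def infSeries (hI : ∀ n, Finite (I n)) :
    infChar k (Hred k I) ≃ₗ[k] (treeOperad k I).lieE :=
  LinearEquiv.ofBijective (infSeriesHom hI) (infSeriesHom_bijective hI)

theorem infSeries_mul (hI : ∀ n, Finite (I n)) (α β : infChar k (Hred k I)) :
    ofCoeff (fun t => (toConv α.1 * toConv β.1).ofConv (t.toH k)) =
      (treeOperad k I).preLie (infSeries hI β).1 (infSeries hI α).1 := by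
  refine coeff_injective (funext fun v => ?_)
  have h : ∀ α : infChar k (Hred k I), coeff (infSeries hI α).1 = fun t => α.1 (t.toH k) :=
    fun α => coeff_ofCoeff hI _
  rw [coeff_ofCoeff hI, coeff_preLie, h, h, infChar_mul_toH α.2]
  refine Finset.sum_congr rfl fun c _ => ?_
  rw [PTree.derivProd_prune (F := fun t => α.1 (t.toH k)) (infChar_one α.2)]

theorem infSeries_commutator (hI : ∀ n, Finite (I n)) (α β : infChar k (Hred k I)) :
    (infSeries hI ⟨_, infChar_commutator α.2 β.2⟩).1 =
      -(treeOperad k I).lieBracket (infSeries hI α).1 (infSeries hI β).1 := by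
  rw [lieBracket, neg_sub, ← infSeries_mul, ← infSeries_mul]
  refine coeff_injective ?_
  change coeff (ofCoeff _) = coeff (_ - _)
  rw [map_sub, coeff_ofCoeff hI, coeff_ofCoeff hI, coeff_ofCoeff hI]
  rfl

/-! ### Hypertrees -/

/-- `Φ` as an isomorphism of bialgebras. -/
noncomputable def phiBialgHom (k : Type u) [Field k] (I : ℕ → Type u) :
    Hred k I →ₐc[k] HHred k I :=
  BialgHom.ofAlgHom (PhiAlg k I).toAlgHom
    (AlgHom.ext fun x => congrArg (Coalgebra.counit (R := k)) ((PhiAlg k I).symm_apply_apply x))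
    (AlgHom.ext fun x => congrArg (fun y => Algebra.TensorProduct.map (PhiAlg k I).toAlgHom
      (PhiAlg k I).toAlgHom (Coalgebra.comul (R := k) y)) ((PhiAlg k I).symm_apply_apply x).symm)

/-- The pullback of characters along `Φ`. -/
noncomputable def charPhiFun (φ : WithConv (HHred k I →ₐ[k] k)) : WithConv (Hred k I →ₐ[k] k) :=
  toConv (φ.ofConv.comp (PhiAlg k I : Hred k I →ₐ[k] HHred k I))

theorem charPhiFun_bijective : Function.Bijective (charPhiFun (k := k) (I := I)) := by
  refine ⟨fun φ ψ h => ofConv_injective ?_,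
    fun φ => ⟨toConv (φ.ofConv.comp ((PhiAlg k I).symm : HHred k I →ₐ[k] Hred k I)),
      ofConv_injective ?_⟩⟩
  · refine AlgHom.ext fun x => ?_
    have h' := AlgHom.congr_fun (toConv_injective h) ((PhiAlg k I).symm x)
    simpa using h'
  · refine AlgHom.ext fun x => ?_
    exact congrArg φ.ofConv ((PhiAlg k I).symm_apply_apply x)

theorem charPhiFun_mul (φ ψ : WithConv (HHred k I →ₐ[k] k)) :
    charPhiFun (φ * ψ) = charPhiFun φ * charPhiFun ψ := by
  refine ofConv_injective (AlgHom.toLinearMap_injective ?_)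
  exact LinearMap.convMul_comp_coalgHom_distrib (toConv φ.ofConv.toLinearMap)
    (toConv ψ.ofConv.toLinearMap) (phiBialgHom k I).toCoalgHom

/-- The identification of the characters of the two bialgebras. -/
noncomputable def charPhi (k : Type u) [Field k] (I : ℕ → Type u) :
    WithConv (HHred k I →ₐ[k] k) ≃* WithConv (Hred k I →ₐ[k] k) :=
  { Equiv.ofBijective _ (charPhiFun_bijective (k := k) (I := I)) with map_mul' := charPhiFun_mul }

theorem isUnit_hyperChar (φ : WithConv (HHred k I →ₐ[k] k)) : IsUnit φ :=
  (MulEquiv.isUnit_map (charPhi k I)).1 (isUnit_char _)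

end Final

theorem mainTheorem6 (k : Type u) [Field k] [CharZero k] :
    -- the operads of plain, binary and decorated trees are the free operads on `V`, `W`, `V_I`
    (SObject.regular k).IsFreeOperad (treeOperad k plain) ∧
    (SObject.binary k).IsFreeOperad (treeOperad k binaryDeco) ∧
    ∀ I : ℕ → Type u,
      (SObject.decorated k I).IsFreeOperad (treeOperad k I) ∧
      (treeOperad k I).IsAugmented ∧
      -- `M(t, u, v)` is the number of ways to graft `t` on a leaf of `u` in order to obtain `v`,
      -- and `t ↷_σ u` is the sum of all graftings of `t` on `u`
      (∀ t u v : NTree I,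
        graftCoeff k t.1 u.1 v.1 = Nat.card {l : u.1.Leaf // u.1.graftAt l t.1 = v.1}) ∧
      (∀ x y : NTree I →₀ k, Finsupp.lmapDomain k k Subtype.val (graftSigma k x y) =
        graftAll k (Finsupp.lmapDomain k k Subtype.val x)
          (Finsupp.lmapDomain k k Subtype.val y)) ∧
      -- the left pre-Lie relation, without and with the one-edge tree, and for hypertrees
      IsLeftPreLie k (graftSigma k (I := I)) ∧
      IsLeftPreLie k (graftAll k (I := I)) ∧
      IsLeftPreLie k (graftHyper k (I := I)) ∧
      -- the normalized dual basis elements of trees are infinitesimal characters, with bracket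
      -- `[δ'_t, δ'_u] = δ'_{t ↷_σ u - u ↷_σ t}` for the convolution product
      (∀ x : NTree I →₀ k, deltaPrime k (spanToH k x) ∈ infChar k (Hred k I)) ∧
      (∀ x y : NTree I →₀ k,
        WithConv.toConv (deltaPrime k (spanToH k x)) * WithConv.toConv (deltaPrime k (spanToH k y)) -
          WithConv.toConv (deltaPrime k (spanToH k y)) *
            WithConv.toConv (deltaPrime k (spanToH k x)) =
        WithConv.toConv
          (deltaPrime k (spanToH k (graftSigma k x y - graftSigma k y x)))) ∧
      -- linear combinations of trees, resp. hypertrees, with the bracket `x ↷ y - y ↷ x`, identify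
      -- with the finitely supported elements of the opposite of the Lie algebra `𝔤^e`
      (Function.Injective (treeSeries k (I := I)) ∧
        (∀ f, f ∈ LinearMap.range (treeSeries k (I := I)) ↔
          f ∈ (treeOperad k I).lieE ∧ {n | f n ≠ 0}.Finite) ∧
        ∀ x y : NTree I →₀ k, treeSeries k (graftSigma k x y - graftSigma k y x) =
          -(treeOperad k I).lieBracket (treeSeries k x) (treeSeries k y)) ∧
      (Function.Injective (hyperSeries k (I := I)) ∧
        (∀ f, f ∈ LinearMap.range (hyperSeries k (I := I)) ↔
          f ∈ (treeOperad k I).lieE ∧ {n | f n ≠ 0}.Finite) ∧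
        ∀ x y : HNTree I →₀ k, hyperSeries k (graftHyper k x y - graftHyper k y x) =
          -(treeOperad k I).lieBracket (hyperSeries k x) (hyperSeries k y)) ∧
      -- characters form a group under convolution
      (∀ φ : WithConv (Hred k I →ₐ[k] k), IsUnit φ) ∧
      (∀ φ : WithConv (HHred k I →ₐ[k] k), IsUnit φ) ∧
      -- if all `I_n` are finite, this group is `G^e` with reversed multiplication, a character `φ`
      -- being identified with the series `∑_t φ(t) t`, and the Lie algebra of infinitesimal
      -- characters is the opposite of `𝔤^e`
      ((∀ n, Finite (I n)) →
        (∀ N, Finite {t : PTree I Unit // Nat.card t.Leaf = N + 1}) ∧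
        (∃ Θ : WithConv (Hred k I →ₐ[k] k) ≃* (treeOperad k I).GroupEᵐᵒᵖ,
          ∀ φ N, (Θ φ).unop.1 N =
            ∑ᶠ t : {t : PTree I Unit // Nat.card t.Leaf = N + 1},
              φ.ofConv (t.1.toH k) • treeClass k N t.1) ∧
        (∃ Θ : WithConv (HHred k I →ₐ[k] k) ≃* (treeOperad k I).GroupEᵐᵒᵖ,
          ∀ φ N, (Θ φ).unop.1 N =
            ∑ᶠ t : {t : PTree I Unit // Nat.card t.Leaf = N + 1},
              φ.ofConv (PhiAlg k I (t.1.toH k)) • treeClass k N t.1) ∧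
        (∃ Λ : infChar k (Hred k I) ≃ₗ[k] (treeOperad k I).lieE,
          (∀ α N, (Λ α).1 N =
            ∑ᶠ t : {t : PTree I Unit // Nat.card t.Leaf = N + 1},
              α.1 (t.1.toH k) • treeClass k N t.1) ∧
          ∀ α β, ∃ γ : infChar k (Hred k I),
            WithConv.toConv γ.1 = WithConv.toConv α.1 * WithConv.toConv β.1 -
              WithConv.toConv β.1 * WithConv.toConv α.1 ∧
            (Λ γ).1 = -(treeOperad k I).lieBracket (Λ α).1 (Λ β).1)) := by
  refine ⟨SObject.regular_isFreeOperad, SObject.binary_isFreeOperad, fun I =>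
    ⟨SObject.decorated_isFreeOperad, treeOperad_isAugmented k I,
      fun t u v => graftCoeff_eq k t u.1 v.1, graftSigma_eq_graftAll k, graftSigma_isLeftPreLie k,
      graftAll_isLeftPreLie k, graftHyper_isLeftPreLie k,
      fun x => (deltaPrime_spanToH x).symm ▸ infOf_mem _, deltaPrime_bracket,
      ⟨treeSeries_injective, mem_range_treeSeries, treeSeries_bracket⟩,
      ⟨hyperSeries_injective, fun f => by rw [range_hyperSeries]; exact mem_range_treeSeries f,
        hyperSeries_bracket⟩,
      isUnit_char, isUnit_hyperChar, fun hI => ⟨PTree.finite_card_leaf_eq hI,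
        ⟨charSeries hI, fun _ _ => rfl⟩,
        ⟨(charPhi k I).trans (charSeries hI), fun _ _ => rfl⟩,
        ⟨infSeries hI, fun _ _ => rfl, fun α β =>
          ⟨⟨_, infChar_commutator α.2 β.2⟩, rfl, infSeries_commutator hI α β⟩⟩⟩⟩⟩
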